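/- **Model.** Fix $M\ge 1$, $\lambda_b>0$, $\alpha>2$, $s>0$, $\mu>0$, $R$, $P$ with $s^2\pi\lambda_bM<1$. Base stations (BSs) and mobiles are randomly placed in the plane; each BS $k$ serves a set $\mathcal M_k$ of exactly $M$ mobiles, $b_j$ denotes the BS that serves mobile $j$, and $r_{j,k}$ the distance between mobile $j$ and BS $k$. The typical mobile $i$ is at the origin, $r_{j,b_j}\le R$ for all $j$, $r_{i,b_i}>0$, $E[(\log r_{i,b_i})^2]<\infty$ (e.g. $r_{i,b_i}$ is deterministic), and the BSs other than $b_i$ form a homogeneous Poisson point process of density $\lambda_b$; nothing else is assumed on the locations. For each number of antennas $L\ge1$ the fading vectors $\mathbf g_{j,k}\in\mathbb C^L$ have i.i.d. $\mathcal{CN}(0,1)$ entries, independent of the locations and of any further randomness used in the power allocation, and $\mathbf h_{j,k}=r_{j,k}^{-\alpha/2}\mathbf g_{j,k}$. *Partial zero forcing* (with $\beta=1/2$). Let $D=sL^{1/2}$ and $\mathcal D_k=\{j:r_{j,k}<D\}$. BS $k$ is active ($a_k=1$) if $|\mathcal D_k|<L$ or $|\mathcal D_k\cup\mathcal M_k|\le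 L$, and otherwise $a_k=0$. For $k=b_j$ the beamforming vector of mobile $j$ is $\mathbf w_j=\mathbf Q_{j,k}\mathbf g_{j,k}/\|\mathbf Q_{j,k}\mathbf g_{j,k}\|$ with $\mathbf Q_{j,k}=\mathbf I-\mathbf G(\mathbf G^{H}\mathbf G)^{-1}\mathbf G^{H}$, where the columns of $\mathbf G$ are the $\mathbf g_{\ell,k}$, $\ell\in\mathcal D_k\setminus\{j\}$. *Powers.* For each $L$, the amplitudes $\varphi_{j,b_j}$ are measurable functions of the locations, of further randomness and of the fading vectors $\mathbf g_{\ell,k}$ with $\ell\in\mathcal D_k\cup\mathcal M_k$ (the channel information that the BSs have), with $\sum_{j\in\mathcal M_k}\varphi_{j,k}^2\le P$ for every $k$. There are constants $\bar P\ge0$, $\delta$ and $\gamma>0$ such that for all large $L$ and all BSs $k\ne\ell$ other than $b_i$, with $d_{k,\ell}$ the distance between BSs $k$ and $\ell$ and $\Phi_b$ the locations of all BSs, $$\Big|E\Big[\sum_{j\in\mathcal M_k}\varphi_{j,k}^2\,\Big|\,a_k=1,r_{i,k}\Big]-\bar P\Big|\le\delta r_{i,k}^{-\gamma},$$ $$\Big|E\Big[\sum_{j\in\mathcal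 M_k}\varphi_{j,k}^2\sum_{j\in\mathcal M_\ell}\varphi_{j,\ell}^2\,\Big|\,\Phi_b,a_k=a_\ell=1\Big]-\bar P^2\Big|\le\min\{P^2,\delta d_{k,\ell}^{-\gamma}\}.$$ *Rate.* With noise variance $\sigma^2=\mu L^{-\zeta}$, $\zeta=\alpha/2-1$, let $R_i=\log_2(1+\eta_i)$, where $$\eta_i=\frac{|a_{b_i}\varphi_{i,b_i}\mathbf h_{i,b_i}^\dagger\mathbf w_i|^2}{\sum_{j\ne i}|a_{b_j}\varphi_{j,b_j}\mathbf h_{i,b_j}^\dagger\mathbf w_j|^2+\sigma^2}.$$ **Claim.** $R_i$ converges in mean square to $$\tilde R_i=\log_2\Big(1+L^{\alpha/2}\,\frac{(1-s^2\pi\lambda_bM)\,\varphi_{i,b_i}^2r_{i,b_i}^{-\alpha}}{s^{2-\alpha}\frac{2\pi\bar P\lambda_b}{\alpha-2}+\mu}\Big),$$ that is, $R_i-\tilde R_i$ is square integrable for every $L\ge1$ and $\lim_{L\to\infty}E\big[|R_i-\tilde R_i|^2\big]=0$. -/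

import Mathlib

open MeasureTheory ProbabilityTheory Filter Topology
open scoped ENNReal NNReal Matrix

noncomputable section

namespace Cellular

/-- The plane in which base stations (BSs) and mobiles are placed, with the Euclidean distance;
`volume` is the area. -/
abbrev Plane : Type := EuclideanSpace ℝ (Fin 2)

/-! ### Homogeneous Poisson point processes -/

/-- Number of points of the family `X` that lie in `B` (with multiplicity, possibly `∞`). -/
def pointCount {Ω ι : Type*} (X : ι → Ω → Plane) (B : Set Plane) (ω : Ω) : ℝ≥0∞ :=
  ∑' k, B.indicator (fun _ => (1 : ℝ≥0∞)) (X k ω)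

/-- The random points `X k` are an enumeration of a homogeneous Poisson point process of
density `lam`: the number of points in a Borel set of finite area `A` is Poisson distributed with
mean `lam * A`, and the numbers of points in disjoint such sets are independent. -/
structure IsHPPP {Ω ι : Type*} [MeasurableSpace Ω] (Pr : Measure Ω) (lam : ℝ)
    (X : ι → Ω → Plane) : Prop where
  measurable : ∀ k, Measurable (X k)
  poisson : ∀ B : Set Plane, MeasurableSet B → volume B ≠ ∞ →
    Pr.map (pointCount X B) =
      (poissonMeasure (lam * (volume B).toReal).toNNReal).map (fun n : ℕ => (n : ℝ≥0∞))
  indep : ∀ (n : ℕ) (B : Fin n → Set Plane), (∀ j, MeasurableSet (B j)) →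
    (∀ j, volume (B j) ≠ ∞) → Pairwise (fun j j' => Disjoint (B j) (B j')) →
    iIndepFun (fun j => pointCount X (B j)) Pr

/-! ### Locations of base stations and mobiles -/

/-- Labels of the mobiles: `(k, m)` is the `m`-th of the `M` mobiles that BS `k` serves. -/
abbrev Mobile (M : ℕ) : Type := ℕ × Fin M

/-- `𝓜_k`, the set of the mobiles served by BS `k`. -/
def served (M : ℕ) (k : ℕ) : Set (Mobile M) := {i | i.1 = k}

/-- Random locations of the BSs and of the mobiles. -/
structure Deployment (M : ℕ) (Ω : Type*) where
  /-- location of a BS -/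
  bs : ℕ → Ω → Plane
  /-- location of a mobile -/
  mob : Mobile M → Ω → Plane

namespace Deployment

variable {M : ℕ} {Ω : Type*} (N : Deployment M Ω)

/-- `r_{i,k}`, the distance between mobile `i` and BS `k`. -/
def r (i : Mobile M) (k : ℕ) (ω : Ω) : ℝ := dist (N.mob i ω) (N.bs k ω)

/-- `𝓓_k`, the set of the mobiles at distance less than `D` from BS `k`. -/
def near (D : ℝ) (k : ℕ) (ω : Ω) : Set (Mobile M) := {i | N.r i k ω < D}

/-- The event `a_k = 1` that BS `k`, with `L` antennas and zero-forcing radius `D`, transmits. -/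
def Active (L : ℕ) (D : ℝ) (k : ℕ) (ω : Ω) : Prop :=
  (N.near D k ω).encard < (L : ℕ∞) ∨ (N.near D k ω ∪ served M k).encard ≤ (L : ℕ∞)

/-- The network as seen from the typical mobile `i`: this mobile is at the origin, every mobile is
within distance `R` of the BS that serves it, and the BSs other than the one that serves `i` form a
homogeneous Poisson point process of density `lam`. Nothing else is assumed on the locations of the
mobiles. -/
structure IsTypical [MeasurableSpace Ω] (Pr : Measure Ω) (lam R : ℝ) (i : Mobile M) : Prop where
  measurable_bs : ∀ k, Measurable (N.bs k)
  measurable_mob : ∀ j, Measurable (N.mob j)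
  origin : ∀ᵐ ω ∂Pr, N.mob i ω = 0
  dist_le : ∀ᵐ ω ∂Pr, ∀ j : Mobile M, N.r j j.1 ω ≤ R
  dist_pos : ∀ᵐ ω ∂Pr, 0 < N.r i i.1 ω
  hppp : IsHPPP Pr lam (fun k : {k : ℕ // k ≠ i.1} => N.bs k)

end Deployment

/-! ### Fading -/

/-- The law `𝒞𝒩(0,1)`: independent real and imaginary parts, centered Gaussian of variance `1/2`. -/
def stdComplexGaussian : Measure ℂ :=
  ((gaussianReal 0 (1 / 2)).prod (gaussianReal 0 (1 / 2))).map
    Complex.measurableEquivRealProd.symm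

instance : IsProbabilityMeasure stdComplexGaussian :=
  Measure.isProbabilityMeasure_map Complex.measurableEquivRealProd.symm.measurable.aemeasurable

/-- All fading coefficients: the entry `(i, k, n)` is the one between mobile `i` and antenna `n` of
BS `k`. -/
abbrev Fading (M L : ℕ) : Type := Mobile M × ℕ × Fin L → ℂ

/-- All fading coefficients are i.i.d. with law `𝒞𝒩(0,1)`. -/
def fadingLaw (M L : ℕ) : Measure (Fading M L) :=
  Measure.infinitePi (fun _ => stdComplexGaussian)

instance (M L : ℕ) : IsProbabilityMeasure (fadingLaw M L) := by
  unfold fadingLaw; infer_instance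

/-- The joint law of the fading coefficients and of everything else (locations and any further
randomness used in the allocation of powers), which are independent. -/
def jointLaw {Ω : Type*} [MeasurableSpace Ω] (Pr : Measure Ω) (M L : ℕ) :
    Measure (Ω × Fading M L) :=
  Pr.prod (fadingLaw M L)

/-- `𝐠_{i,k}`, the fading vector between mobile `i` and BS `k`. -/
def fadingVec {M L : ℕ} (g : Fading M L) (i : Mobile M) (k : ℕ) : EuclideanSpace ℂ (Fin L) :=
  WithLp.toLp 2 (fun n => g (i, k, n))

/-! ### Partial zero forcing -/

/-- The matrix whose columns are the fading vectors between BS `k` and the mobiles of `S`. -/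
def fadingMat {M L : ℕ} (g : Fading M L) (S : Set (Mobile M)) (k : ℕ) : Matrix (Fin L) S ℂ :=
  Matrix.of (fun n j => g (j.1, k, n))

open Classical in
/-- The projection `𝐐 = 𝐈 - 𝐆 (𝐆ᴴ 𝐆)⁻¹ 𝐆ᴴ` for the matrix `𝐆` of the fading vectors between BS `k`
and the mobiles of `S` (the value for infinite `S` is not used). -/
def zfProj {M L : ℕ} (g : Fading M L) (S : Set (Mobile M)) (k : ℕ) :
    Matrix (Fin L) (Fin L) ℂ :=
  if h : S.Finite then
    letI : Fintype S := h.fintype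
    1 - fadingMat g S k * ((fadingMat g S k)ᴴ * fadingMat g S k)⁻¹ * (fadingMat g S k)ᴴ
  else 0

namespace Deployment

variable {M : ℕ} {Ω : Type*} (N : Deployment M Ω)

/-- `𝐐_{i,k} 𝐠_{i,k}` for `k = b_i`. -/
def zfVec (L : ℕ) (D : ℝ) (i : Mobile M) (p : Ω × Fading M L) : EuclideanSpace ℂ (Fin L) :=
  WithLp.toLp 2
    (zfProj p.2 (N.near D i.1 p.1 \ {i}) i.1 *ᵥ (fun n => p.2 (i, i.1, n)))

/-- The normalized zero-forcing beamforming vector `𝐰_i` that BS `b_i` uses for mobile `i`. -/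
def beam (L : ℕ) (D : ℝ) (i : Mobile M) (p : Ω × Fading M L) : EuclideanSpace ℂ (Fin L) :=
  ((‖N.zfVec L D i p‖⁻¹ : ℝ) : ℂ) • N.zfVec L D i p

/-- The channel vector `𝐡_{i,k} = r_{i,k}^{-α/2} 𝐠_{i,k}`. -/
def channel (L : ℕ) (α : ℝ) (i : Mobile M) (k : ℕ) (p : Ω × Fading M L) :
    EuclideanSpace ℂ (Fin L) :=
  ((N.r i k p.1 ^ (-(α / 2)) : ℝ) : ℂ) • fadingVec p.2 i k

open Classical in
/-- Power received at mobile `i` from the signal intended for mobile `j`,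
`|a_{b_j} φ_{j,b_j} 𝐡_{i,b_j}† 𝐰_j|²`, where `φ j` is the amplitude allocated to mobile `j`. -/
def rxPower (L : ℕ) (D α : ℝ) (φ : Mobile M → Ω × Fading M L → ℝ) (i j : Mobile M)
    (p : Ω × Fading M L) : ℝ :=
  ‖(if N.Active L D j.1 p.1 then (1 : ℂ) else 0) * ((φ j p : ℝ) : ℂ) *
    inner ℂ (N.channel L α i j.1 p) (N.beam L D j p)‖ ^ 2

/-- The SINR `η_i` of mobile `i`, with noise variance `σ2`. -/
def sinr (L : ℕ) (D α σ2 : ℝ) (φ : Mobile M → Ω × Fading M L → ℝ) (i : Mobile M)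
    (p : Ω × Fading M L) : ℝ :=
  N.rxPower L D α φ i i p /
    ((∑' j : {j : Mobile M // j ≠ i}, N.rxPower L D α φ i j p) + σ2)

/-- The achievable rate `R_i = log₂ (1 + η_i)` per unit bandwidth. -/
def rate (L : ℕ) (D α σ2 : ℝ) (φ : Mobile M → Ω × Fading M L → ℝ) (i : Mobile M)
    (p : Ω × Fading M L) : ℝ :=
  Real.logb 2 (1 + N.sinr L D α σ2 φ i p)

/-- The asymptotic rate `R̃_i` when `D = s √L` and `σ² = μ L^{1-α/2}`. -/
def asympRate (L : ℕ) (α s lam μ Pbar : ℝ) (φ : Mobile M → Ω × Fading M L → ℝ) (i : Mobile M)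
    (p : Ω × Fading M L) : ℝ :=
  Real.logb 2 (1 + (L : ℝ) ^ (α / 2) *
    (((1 - s ^ 2 * Real.pi * lam * M) * (φ i p) ^ 2 * (N.r i i.1 p.1) ^ (-α)) /
      (s ^ (2 - α) * (2 * Real.pi * Pbar * lam / (α - 2)) + μ)))

/-! ### Power allocation -/

/-- An admissible power allocation: `φ j` is the amplitude allocated to mobile `j` by its BS. It may
depend in any way on the locations, on further randomness and on the channel state information
which the BSs have, that is, on the fading vectors between each BS `k` and the mobiles
of `𝓓_k ∪ 𝓜_k`; and the power of no BS exceeds `P`. -/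
structure IsPowerAllocation [MeasurableSpace Ω] (Pr : Measure Ω) (L : ℕ) (D P : ℝ)
    (φ : Mobile M → Ω × Fading M L → ℝ) : Prop where
  measurable : ∀ j, Measurable (φ j)
  csi : ∀ (ω : Ω) (g g' : Fading M L),
    (∀ (k : ℕ), ∀ i ∈ N.near D k ω ∪ served M k, ∀ n, g (i, k, n) = g' (i, k, n)) →
    ∀ j, φ j (ω, g) = φ j (ω, g')
  power_le : ∀ᵐ p ∂(jointLaw Pr M L), ∀ k, ∑ m : Fin M, (φ (k, m) p) ^ 2 ≤ P

end Deployment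

/-- The total power `∑_{i ∈ 𝓜_k} φ_{i,k}²` allocated by BS `k`. -/
def totalPower {M L : ℕ} {Ω : Type*} (φ : Mobile M → Ω × Fading M L → ℝ) (k : ℕ)
    (p : Ω × Fading M L) : ℝ :=
  ∑ m : Fin M, (φ (k, m) p) ^ 2

namespace Deployment

variable {M : ℕ} {Ω : Type*} (N : Deployment M Ω)

/-- `|E[∑_{i ∈ 𝓜_k} φ_{i,k}² | a_k = 1, r_{o,k}] - P̄| ≤ δ r_{o,k}^{-γ}` for each BS `k` other than
the one that serves the typical mobile `o`. -/
def MeanPowerCondition [MeasurableSpace Ω] (Pr : Measure Ω) (L : ℕ) (D Pbar δ γ : ℝ) (o : Mobile M)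
    (φ : Mobile M → Ω × Fading M L → ℝ) : Prop :=
  ∀ k : ℕ, k ≠ o.1 →
    ∀ᵐ p ∂(cond (jointLaw Pr M L) {p | N.Active L D k p.1}),
      |((cond (jointLaw Pr M L) {p | N.Active L D k p.1})[totalPower φ k |
          MeasurableSpace.comap (fun p : Ω × Fading M L => N.r o k p.1) inferInstance]) p - Pbar|
        ≤ δ * (N.r o k p.1) ^ (-γ)

/-- `|E[∑_{i ∈ 𝓜_k} φ_{i,k}² ∑_{j ∈ 𝓜_l} φ_{j,l}² | Φ_b, a_k = a_l = 1] - P̄²|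
≤ min {P², δ d^{-γ}}`, where `d` is the distance between the BSs `k` and `l` and `Φ_b` the locations
of all BSs, for any two BSs other than the one that serves the typical mobile `o`. -/
def PowerCorrelationCondition [MeasurableSpace Ω] (Pr : Measure Ω) (L : ℕ) (D P Pbar δ γ : ℝ)
    (o : Mobile M) (φ : Mobile M → Ω × Fading M L → ℝ) : Prop :=
  ∀ k l : ℕ, k ≠ o.1 → l ≠ o.1 → k ≠ l →
    ∀ᵐ p ∂(cond (jointLaw Pr M L) {p | N.Active L D k p.1 ∧ N.Active L D l p.1}),
      |((cond (jointLaw Pr M L) {p | N.Active L D k p.1 ∧ N.Active L D l p.1})[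
          fun p => totalPower φ k p * totalPower φ l p |
          MeasurableSpace.comap (fun (p : Ω × Fading M L) (n : ℕ) => N.bs n p.1) inferInstance]) p
          - Pbar ^ 2|
        ≤ min (P ^ 2) (δ * (dist (N.bs k p.1) (N.bs l p.1)) ^ (-γ))

end Deployment

end Cellular

end

set_option linter.unusedSectionVars false

noncomputable section

namespace Cellular

/-! ### Moments of the Poisson law -/

/-! Suppose that the serving BS is active. Write `A = L^(α/2) φ_i² r^(-α)`, `X = ‖Q g‖²/L` for the
scaled gain of the desired signal, `c = 1 - s²πλM`, `ζ = α/2 - 1`, `I` for the interference from the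
other BSs and `y` for the limit of `L^ζ I`. As `L^(α/2) = L^ζ L`, the rate is `log₂(1 + A X/(L^ζ I +
μ))`, and the claimed limit is `log₂(1 + A c/(y + μ))`. For every `A ≥ 0` the map `u ↦ log(1 + A
e^u)` is 1-Lipschitz (`abs_log_one_add_mul_sub_le`). Hence `A`, which grows with `L` and may depend
on all the randomness through `φ_i`, drops out, and the error is at most `(|log X - log c| + |L^ζ I
- y|/μ)/log 2`. It remains to show that `log X` and `L^ζ I` converge in mean square.

Signal (`tendsto_log_zfVec`). Given the locations, `Q` projects `g` onto an independent random
subspace of dimension `L - n`, where `n` is the number of other mobiles within `D` of the BS. The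
squared norm concentrates around the dimension. Up to bounded errors, `n` lies between `M` times the
Poisson counts in the discs of radii `D - 2R` and `D + 2R`, so `n/L` tends to `1 - c`. A bounded
moment of `‖Q g‖` of order `-1/2` carries the convergence over to the logarithm.

Interference (`tendsto_interference`). BSs closer than `D` are nulled. For a BS `k` at distance at
least `D`, the vector `g_{i,k}` enters neither the beams nor the powers, since it is not part of the
channel information; it may therefore be resampled and averaged out, which leaves the mean power
`a_k r^(-α) ∑ φ²`. For two distinct BSs both vectors are averaged out. Campbell's formulas for
points and for pairs of points, with the two power conditions, yield a lower bound on `E I` and an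
upper bound on `E I²` with matching leading terms. These one-sided bounds suffice, as `E(I - a)² = E
I² - 2a E I + a²` decreases in `E I` when `a ≥ 0`.

The lower bound loses the inactive BSs. Each of them has an overcrowded neighbourhood, and smoothing
over a small disc reduces their total path loss to Chebyshev's inequality for the number of points
in a fixed disc, so that no Palm distribution is needed.

If the serving BS is inactive, the rate is zero. The square of the limit is then at most of order
`√L + log² r`, while the probability of this event is `O(1/L)`. -/

lemma lintegral_poissonMeasure (r : ℝ≥0) (h : ℕ → ℝ≥0∞) :
    ∫⁻ n, h n ∂(poissonMeasure r) =
      ∑' n, ENNReal.ofReal (Real.exp (-r) * r ^ n / n.factorial) * h n := by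
  rw [poissonMeasure, lintegral_sum_measure]
  simp [lintegral_smul_measure, lintegral_dirac]

/-- The factor `n` cancels against `n!` and shifts the sum by one. The first two moments follow from
this single identity. -/
lemma lintegral_poissonMeasure_nat_mul (r : ℝ≥0) (h : ℕ → ℝ≥0∞) :
    ∫⁻ n, (n : ℝ≥0∞) * h n ∂(poissonMeasure r) =
      r * ∫⁻ n, h (n + 1) ∂(poissonMeasure r) := by
  rw [lintegral_poissonMeasure, lintegral_poissonMeasure, tsum_eq_zero_add' ENNReal.summable]
  simp only [Nat.cast_zero, zero_mul, mul_zero, zero_add]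
  rw [← ENNReal.tsum_mul_left]
  congr 1
  ext n
  rw [← mul_assoc, ← mul_assoc]
  congr 1
  rw [← ENNReal.ofReal_coe_nnreal, ← ENNReal.ofReal_natCast, ← ENNReal.ofReal_mul (by positivity),
    ← ENNReal.ofReal_mul (by positivity)]
  congr 1
  rw [Nat.factorial_succ]
  push_cast
  have : (n.factorial : ℝ) ≠ 0 := by positivity
  have : (n : ℝ) + 1 ≠ 0 := by positivity
  field_simp
  ring

lemma lintegral_poissonMeasure_id (r : ℝ≥0) :
    ∫⁻ n, (n : ℝ≥0∞) ∂(poissonMeasure r) = r := by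
  simpa using lintegral_poissonMeasure_nat_mul r (fun _ => 1)

lemma lintegral_poissonMeasure_sq (r : ℝ≥0) :
    ∫⁻ n, (n : ℝ≥0∞) ^ 2 ∂(poissonMeasure r) = r ^ 2 + r := by
  have h := lintegral_poissonMeasure_nat_mul r (fun n => (n : ℝ≥0∞))
  simp only [Nat.cast_add, Nat.cast_one] at h
  rw [lintegral_add_left (by fun_prop), lintegral_poissonMeasure_id] at h
  simp only [sq, h]
  simp
  ring

lemma lintegral_poissonMeasure_sub_sq (r : ℝ≥0) :
    ∫⁻ n : ℕ, ENNReal.ofReal (((n : ℝ) - r) ^ 2) ∂(poissonMeasure r) = r := by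
  have h : ∫⁻ n : ℕ, (ENNReal.ofReal (((n : ℝ) - r) ^ 2) + 2 * r * (n : ℝ≥0∞))
      ∂(poissonMeasure r) = ∫⁻ n : ℕ, ((n : ℝ≥0∞) ^ 2 + (r : ℝ≥0∞) ^ 2) ∂(poissonMeasure r) := by
    congr 1
    ext n
    rw [← ENNReal.ofReal_coe_nnreal, ← ENNReal.ofReal_natCast, ← ENNReal.ofReal_ofNat,
      ← ENNReal.ofReal_mul (by norm_num), ← ENNReal.ofReal_mul (by positivity),
      ← ENNReal.ofReal_add (by positivity) (by positivity), ← ENNReal.ofReal_pow (by positivity),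
      ← ENNReal.ofReal_pow (by positivity), ← ENNReal.ofReal_add (by positivity) (by positivity)]
    congr 1
    ring
  rw [lintegral_add_right _ (by fun_prop), lintegral_const_mul _ (by fun_prop),
    lintegral_poissonMeasure_id, lintegral_add_right _ (by fun_prop), lintegral_poissonMeasure_sq,
    lintegral_const, measure_univ, mul_one] at h
  have hfin : 2 * (r : ℝ≥0∞) * r ≠ ∞ := by finiteness
  refine (ENNReal.add_left_inj hfin).1 (h.trans ?_)
  ring

/-! ### First and second factorial moment measures of a Poisson point process -/

section Campbell

variable {Ω ι : Type*} {X : ι → Ω → Plane}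

lemma pointCount_union {A B : Set Plane} (h : Disjoint A B) (ω : Ω) :
    pointCount X (A ∪ B) ω = pointCount X A ω + pointCount X B ω := by
  unfold pointCount
  rw [← ENNReal.tsum_add]
  congr 1
  ext k
  rw [Set.indicator_union_of_disjoint h]

lemma pointCount_mono {A B : Set Plane} (h : A ⊆ B) (ω : Ω) :
    pointCount X A ω ≤ pointCount X B ω :=
  ENNReal.tsum_le_tsum fun _ => Set.indicator_le_indicator_of_subset h (fun _ => zero_le) _

variable [MeasurableSpace Ω] {Pr : Measure Ω} {lam : ℝ} [Countable ι]

lemma IsHPPP.measurable_pointCount (hX : IsHPPP Pr lam X) {B : Set Plane} (hB : MeasurableSet B) :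
    Measurable (pointCount X B) :=
  Measurable.tsum fun k => (measurable_const.indicator hB).comp (hX.measurable k)

lemma IsHPPP.lintegral_comp_pointCount (hX : IsHPPP Pr lam X) {B : Set Plane}
    (hB : MeasurableSet B) (hB' : volume B ≠ ∞) {f : ℝ≥0∞ → ℝ≥0∞} (hf : Measurable f) :
    ∫⁻ ω, f (pointCount X B ω) ∂Pr =
      ∫⁻ n : ℕ, f n ∂(poissonMeasure (lam * (volume B).toReal).toNNReal) := by
  rw [← lintegral_map hf (hX.measurable_pointCount hB), hX.poisson B hB hB',
    lintegral_map hf (by fun_prop)]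

lemma coe_toNNReal_mul_volume (hlam : 0 ≤ lam) {B : Set Plane} (hB' : volume B ≠ ∞) :
    (((lam * (volume B).toReal).toNNReal : ℝ≥0) : ℝ≥0∞) = ENNReal.ofReal lam * volume B := by
  change ENNReal.ofReal _ = _
  rw [ENNReal.ofReal_mul hlam, ENNReal.ofReal_toReal hB']

lemma IsHPPP.lintegral_pointCount (hX : IsHPPP Pr lam X) (hlam : 0 ≤ lam) {B : Set Plane}
    (hB : MeasurableSet B) (hB' : volume B ≠ ∞) :
    ∫⁻ ω, pointCount X B ω ∂Pr = ENNReal.ofReal lam * volume B := by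
  rw [hX.lintegral_comp_pointCount hB hB' (f := fun x => x) measurable_id,
    lintegral_poissonMeasure_id, coe_toNNReal_mul_volume hlam hB']

lemma IsHPPP.lintegral_pointCount_sq (hX : IsHPPP Pr lam X) (hlam : 0 ≤ lam) {B : Set Plane}
    (hB : MeasurableSet B) (hB' : volume B ≠ ∞) :
    ∫⁻ ω, pointCount X B ω ^ 2 ∂Pr =
      (ENNReal.ofReal lam * volume B) ^ 2 + ENNReal.ofReal lam * volume B := by
  rw [hX.lintegral_comp_pointCount hB hB' (f := fun x => x ^ 2) (by fun_prop)]
  rw [lintegral_poissonMeasure_sq, coe_toNNReal_mul_volume hlam hB']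

lemma IsHPPP.lintegral_pointCount_sub_sq (hX : IsHPPP Pr lam X) (hlam : 0 ≤ lam) {B : Set Plane}
    (hB : MeasurableSet B) (hB' : volume B ≠ ∞) :
    ∫⁻ ω, ENNReal.ofReal (((pointCount X B ω).toReal - lam * (volume B).toReal) ^ 2) ∂Pr =
      ENNReal.ofReal lam * volume B := by
  rw [hX.lintegral_comp_pointCount hB hB'
    (f := fun x => ENNReal.ofReal ((x.toReal - lam * (volume B).toReal) ^ 2)) (by fun_prop)]
  rw [← coe_toNNReal_mul_volume hlam hB', ← lintegral_poissonMeasure_sub_sq]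
  simp only [ENNReal.toReal_natCast]
  congr 1
  ext n
  rw [Real.coe_toNNReal _ (by positivity)]

/-- Chebyshev's inequality for the mean number of points in a region on the event that this
region is overcrowded. -/
lemma IsHPPP.lintegral_pointCount_indicator_le (hX : IsHPPP Pr lam X) (hlam : 0 ≤ lam)
    {B : Set Plane} (hB : MeasurableSet B) (hB' : volume B ≠ ∞) {t m : ℝ}
    (hm : m = lam * (volume B).toReal) (ht : m < t) :
    ∫⁻ ω, {ω | ENNReal.ofReal t ≤ pointCount X B ω}.indicator (pointCount X B) ω ∂Pr ≤
      ENNReal.ofReal ((1 / (t - m) + m / (t - m) ^ 2) * m) := by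
  have hm0 : 0 ≤ m := by rw [hm]; positivity
  have htm : 0 < t - m := by linarith
  have e : ENNReal.ofReal lam * volume B = ENNReal.ofReal m := by
    rw [hm, ENNReal.ofReal_mul hlam, ENNReal.ofReal_toReal hB']
  have hae : ∀ᵐ ω ∂Pr, pointCount X B ω < ∞ := by
    refine ae_lt_top (hX.measurable_pointCount hB) ?_
    rw [hX.lintegral_pointCount hlam hB hB', e]
    exact ENNReal.ofReal_ne_top
  rw [ENNReal.ofReal_mul (by positivity), ← e, ← hX.lintegral_pointCount_sub_sq hlam hB hB',
    ← lintegral_const_mul' _ _ ENNReal.ofReal_ne_top]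
  refine lintegral_mono_ae ?_
  filter_upwards [hae] with ω hω
  by_cases h : ENNReal.ofReal t ≤ pointCount X B ω
  · rw [Set.indicator_of_mem (show ω ∈ {ω | ENNReal.ofReal t ≤ pointCount X B ω} from h), ← hm,
      ← ENNReal.ofReal_mul (by positivity)]
    obtain ⟨n, hn⟩ : ∃ n : ℝ, n = (pointCount X B ω).toReal := ⟨_, rfl⟩
    have hle : t ≤ n := by rw [hn]; exact (ENNReal.ofReal_le_iff_le_toReal hω.ne).1 h
    rw [← ENNReal.ofReal_toReal hω.ne, ← hn, ENNReal.toReal_ofReal (by linarith)]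
    refine ENNReal.ofReal_le_ofReal ?_
    -- Split `n = (n - m) + m`. Since `n - m ≥ t - m > 0`, each summand is at most a multiple of `(n
    -- - m)²`, with the factors `1/(t - m)` and `m/(t - m)²`. The integral of `(n - m)²` is the
    -- Poisson variance `m`.
    have h1 : t - m ≤ n - m := by linarith
    have h2 : (t - m) * (n - m) ≤ (n - m) ^ 2 := by nlinarith
    have h3 : (t - m) ^ 2 ≤ (n - m) ^ 2 := by gcongr
    have h4 : n - m ≤ 1 / (t - m) * (n - m) ^ 2 := by
      rw [one_div, inv_mul_eq_div, le_div_iff₀ htm]; linarith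
    have h5 : m ≤ m / (t - m) ^ 2 * (n - m) ^ 2 := by
      rw [div_mul_eq_mul_div, le_div_iff₀ (by positivity)]
      exact mul_le_mul_of_nonneg_left h3 hm0
    linarith
  · rw [Set.indicator_of_notMem (show ω ∉ {ω | ENNReal.ofReal t ≤ pointCount X B ω} from h)]
    exact zero_le

lemma IsHPPP.sum_map_apply (hX : IsHPPP Pr lam X) {B : Set Plane} (hB : MeasurableSet B) :
    Measure.sum (fun k => Pr.map (X k)) B = ∫⁻ ω, pointCount X B ω ∂Pr := by
  rw [Measure.sum_apply _ hB]
  unfold pointCount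
  rw [lintegral_tsum (f := fun k ω => B.indicator (fun _ => (1 : ℝ≥0∞)) (X k ω)) fun k =>
    ((measurable_const.indicator hB).comp (hX.measurable k)).aemeasurable]
  congr 1
  ext k
  rw [Measure.map_apply (hX.measurable k) hB, ← lintegral_indicator_one (hX.measurable k hB)]
  rfl

lemma iUnion_ball_nat_eq_univ : ⋃ n : ℕ, Metric.ball (0 : Plane) n = Set.univ :=
  Metric.iUnion_ball_nat 0

/-- The Poisson law is prescribed on sets of finite area only, so the intensity measure is
identified on an exhausting sequence of discs. -/
lemma IsHPPP.sum_map_eq (hX : IsHPPP Pr lam X) (hlam : 0 ≤ lam) :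
    Measure.sum (fun k => Pr.map (X k)) = ENNReal.ofReal lam • (volume : Measure Plane) := by
  refine Measure.ext_of_iUnion_eq_univ iUnion_ball_nat_eq_univ fun n => ?_
  ext B hB
  have hfin : volume (B ∩ Metric.ball (0 : Plane) n) ≠ ∞ :=
    (measure_mono Set.inter_subset_right).trans_lt measure_ball_lt_top |>.ne
  rw [Measure.restrict_apply hB, Measure.restrict_apply hB,
    hX.sum_map_apply (hB.inter measurableSet_ball),
    hX.lintegral_pointCount hlam (hB.inter measurableSet_ball) hfin]
  rfl

/-- Campbell's formula. -/
lemma IsHPPP.tsum_lintegral (hX : IsHPPP Pr lam X) (hlam : 0 ≤ lam) {f : Plane → ℝ≥0∞}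
    (hf : Measurable f) :
    ∑' k, ∫⁻ ω, f (X k ω) ∂Pr = ENNReal.ofReal lam * ∫⁻ x, f x := by
  have h := congrArg (fun ν => ∫⁻ x, f x ∂ν) (hX.sum_map_eq hlam)
  simp only [lintegral_sum_measure, lintegral_smul_measure, smul_eq_mul] at h
  rw [← h]
  congr 1
  ext k
  rw [lintegral_map hf (hX.measurable k)]

lemma IsHPPP.lintegral_mul_pointCount_of_disjoint (hX : IsHPPP Pr lam X) (hlam : 0 ≤ lam)
    {A B : Set Plane} (hA : MeasurableSet A) (hA' : volume A ≠ ∞) (hB : MeasurableSet B)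
    (hB' : volume B ≠ ∞) (hAB : Disjoint A B) :
    ∫⁻ ω, pointCount X A ω * pointCount X B ω ∂Pr =
      (ENNReal.ofReal lam * volume A) * (ENNReal.ofReal lam * volume B) := by
  have hind := hX.indep 2 ![A, B] (by simp [Fin.forall_fin_two, hA, hB])
    (by simp [Fin.forall_fin_two, hA', hB'])
    (by
      intro j j' hjj'
      fin_cases j <;> fin_cases j' <;> simp_all [hAB.symm])
  have h01 := hind.indepFun (i := 0) (j := 1) (by simp)
  simp only [Matrix.cons_val_zero, Matrix.cons_val_one] at h01
  have := lintegral_mul_eq_lintegral_mul_lintegral_of_indepFun (hX.measurable_pointCount hA)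
    (hX.measurable_pointCount hB) h01
  simp only [Pi.mul_apply] at this
  rw [this, hX.lintegral_pointCount hlam hA hA', hX.lintegral_pointCount hlam hB hB']

/-- The counts in `A \ B`, `A ∩ B` and `B \ A` are independent in pairs, so only the square of the
count in `A ∩ B` fails to factorize; its variance is the additional term. -/
lemma IsHPPP.lintegral_mul_pointCount (hX : IsHPPP Pr lam X) (hlam : 0 ≤ lam)
    {A B : Set Plane} (hA : MeasurableSet A) (hA' : volume A ≠ ∞) (hB : MeasurableSet B)
    (hB' : volume B ≠ ∞) :
    ∫⁻ ω, pointCount X A ω * pointCount X B ω ∂Pr =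
      (ENNReal.ofReal lam * volume A) * (ENNReal.ofReal lam * volume B) +
        ENNReal.ofReal lam * volume (A ∩ B) := by
  have fin1 : volume (A \ B) ≠ ∞ := measure_ne_top_of_subset Set.sdiff_subset hA'
  have fin2 : volume (A ∩ B) ≠ ∞ := measure_ne_top_of_subset Set.inter_subset_left hA'
  have fin3 : volume (B \ A) ≠ ∞ := measure_ne_top_of_subset Set.sdiff_subset hB'
  have d1 : Disjoint (A \ B) (A ∩ B) := by
    rw [Set.disjoint_left]; rintro x ⟨_, h⟩ ⟨_, h'⟩; exact h h'
  have d2 : Disjoint (B \ A) (A ∩ B) := by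
    rw [Set.disjoint_left]; rintro x ⟨_, h⟩ ⟨h', _⟩; exact h h'
  have d3 : Disjoint (A \ B) (B \ A) := by
    rw [Set.disjoint_left]; rintro x ⟨h', _⟩ ⟨_, h⟩; exact h h'
  have eA : (A \ B) ∪ (A ∩ B) = A := by rw [Set.union_comm]; exact Set.inter_union_sdiff A B
  have eB : (B \ A) ∪ (A ∩ B) = B := by
    rw [Set.union_comm, Set.inter_comm]; exact Set.inter_union_sdiff B A
  have hm1 := hX.measurable_pointCount (hA.diff hB)
  have hm2 := hX.measurable_pointCount (hA.inter hB)
  have hm3 := hX.measurable_pointCount (hB.diff hA)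
  have key : ∀ ω, pointCount X A ω * pointCount X B ω =
      pointCount X (A \ B) ω * pointCount X (B \ A) ω +
      pointCount X (A \ B) ω * pointCount X (A ∩ B) ω +
      pointCount X (B \ A) ω * pointCount X (A ∩ B) ω + pointCount X (A ∩ B) ω ^ 2 := by
    intro ω
    have h1 := pointCount_union (X := X) d1 ω
    have h2 := pointCount_union (X := X) d2 ω
    rw [eA] at h1
    rw [eB] at h2
    rw [h1, h2]
    ring
  have vA : volume A = volume (A \ B) + volume (A ∩ B) := by
    conv_lhs => rw [← eA]
    exact measure_union d1 (hA.inter hB)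
  have vB : volume B = volume (B \ A) + volume (A ∩ B) := by
    conv_lhs => rw [← eB]
    exact measure_union d2 (hA.inter hB)
  simp_rw [key]
  rw [lintegral_add_right _ (by fun_prop), lintegral_add_right _ (by fun_prop),
    lintegral_add_right _ (by fun_prop),
    hX.lintegral_mul_pointCount_of_disjoint hlam (hA.diff hB) fin1 (hB.diff hA) fin3 d3,
    hX.lintegral_mul_pointCount_of_disjoint hlam (hA.diff hB) fin1 (hA.inter hB) fin2 d1,
    hX.lintegral_mul_pointCount_of_disjoint hlam (hB.diff hA) fin3 (hA.inter hB) fin2 d2,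
    hX.lintegral_pointCount_sq hlam (hA.inter hB) fin2, vA, vB]
  ring

/-- The second factorial moment measure: the intensity of the ordered pairs of points with
distinct labels. -/
def pairMeasure (Pr : Measure Ω) (X : ι → Ω → Plane) : Measure (Plane × Plane) :=
  Measure.sum fun q : {q : ι × ι // q.1 ≠ q.2} => Pr.map fun ω => (X q.1.1 ω, X q.1.2 ω)

/-- The product of the two counts runs over all pairs of labels. The diagonal pairs contribute the
count in `A ∩ B`, which is exactly the excess in the mean of the product. That excess is finite and
may be cancelled. -/
lemma IsHPPP.pairMeasure_prod (hX : IsHPPP Pr lam X) (hlam : 0 ≤ lam)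
    {A B : Set Plane} (hA : MeasurableSet A) (hA' : volume A ≠ ∞) (hB : MeasurableSet B)
    (hB' : volume B ≠ ∞) :
    pairMeasure Pr X (A ×ˢ B) =
      (ENNReal.ofReal lam * volume A) * (ENNReal.ofReal lam * volume B) := by
  have hfin : ENNReal.ofReal lam * volume (A ∩ B) ≠ ∞ :=
    ENNReal.mul_ne_top ENNReal.ofReal_ne_top (measure_ne_top_of_subset Set.inter_subset_left hA')
  refine (ENNReal.add_left_inj hfin).1 ?_
  rw [← hX.lintegral_mul_pointCount hlam hA hA' hB hB',
    ← hX.lintegral_pointCount hlam (hA.inter hB)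
      (measure_ne_top_of_subset Set.inter_subset_left hA')]
  have hmeas : ∀ k (C : Set Plane), MeasurableSet C →
      Measurable fun ω => C.indicator (fun _ => (1 : ℝ≥0∞)) (X k ω) := fun k C hC =>
    (measurable_const.indicator hC).comp (hX.measurable k)
  have hpair : pairMeasure Pr X (A ×ˢ B) =
      ∫⁻ ω, ∑' q : {q : ι × ι // q.1 ≠ q.2}, A.indicator (fun _ => (1 : ℝ≥0∞)) (X q.1.1 ω) *
        B.indicator (fun _ => (1 : ℝ≥0∞)) (X q.1.2 ω) ∂Pr := by
    rw [lintegral_tsum (f := fun (q : {q : ι × ι // q.1 ≠ q.2}) ω =>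
      A.indicator (fun _ => (1 : ℝ≥0∞)) (X q.1.1 ω) *
        B.indicator (fun _ => (1 : ℝ≥0∞)) (X q.1.2 ω))
      fun q => ((hmeas _ A hA).mul (hmeas _ B hB)).aemeasurable, pairMeasure,
      Measure.sum_apply _ (hA.prod hB)]
    congr 1
    ext q
    have hm : Measurable fun ω => (X q.1.1 ω, X q.1.2 ω) :=
      (hX.measurable _).prodMk (hX.measurable _)
    rw [Measure.map_apply hm (hA.prod hB), ← lintegral_indicator_one (hm (hA.prod hB))]
    congr 1
    ext ω
    by_cases h1 : X q.1.1 ω ∈ A <;> by_cases h2 : X q.1.2 ω ∈ B <;>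
      simp [h1, h2, Set.indicator]
  rw [hpair, ← lintegral_add_right _ (hX.measurable_pointCount (hA.inter hB))]
  congr 1
  ext ω
  unfold pointCount
  rw [← ENNReal.tsum_mul_right]
  simp_rw [← ENNReal.tsum_mul_left]
  rw [← ENNReal.tsum_prod (f := fun k l => A.indicator (fun _ => (1 : ℝ≥0∞)) (X k ω) *
    B.indicator (fun _ => (1 : ℝ≥0∞)) (X l ω)),
    ← ENNReal.summable.tsum_add_tsum_compl (s := {q : ι × ι | q.1 ≠ q.2}) ENNReal.summable]
  congr 1
  let e : ι ≃ ↥({q : ι × ι | q.1 ≠ q.2}ᶜ) :=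
    { toFun := fun k => ⟨(k, k), by simp⟩
      invFun := fun q => q.1.1
      left_inv := fun k => rfl
      right_inv := fun q => by
        obtain ⟨⟨a, b⟩, h⟩ := q
        simp at h
        subst h
        rfl }
  rw [← e.tsum_eq]
  congr 1
  ext k
  by_cases h1 : X k ω ∈ A <;> by_cases h2 : X k ω ∈ B <;> simp [e, h1, h2, Set.indicator]

/-- Both measures agree on rectangles of finite area; they are compared on products of discs, where
they are finite and rectangles determine them. -/
lemma IsHPPP.pairMeasure_eq (hX : IsHPPP Pr lam X) (hlam : 0 ≤ lam) :
    pairMeasure Pr X = (ENNReal.ofReal lam • (volume : Measure Plane)).prod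
      (ENNReal.ofReal lam • (volume : Measure Plane)) := by
  have hU : ⋃ n : ℕ, Metric.ball (0 : Plane) n ×ˢ Metric.ball (0 : Plane) n = Set.univ := by
    refine Set.eq_univ_of_forall fun x => Set.mem_iUnion.2 ?_
    obtain ⟨n, hn⟩ := exists_nat_gt (max ‖x.1‖ ‖x.2‖)
    exact ⟨n, by simpa using (max_lt_iff.1 hn)⟩
  refine Measure.ext_of_iUnion_eq_univ hU fun n => ?_
  have hb : ∀ A : Set Plane, volume (A ∩ Metric.ball (0 : Plane) n) ≠ ∞ := fun A =>
    (measure_mono Set.inter_subset_right).trans_lt measure_ball_lt_top |>.ne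
  have hfin : IsFiniteMeasure ((pairMeasure Pr X).restrict
      (Metric.ball (0 : Plane) n ×ˢ Metric.ball (0 : Plane) n)) := by
    constructor
    rw [Measure.restrict_apply_univ, hX.pairMeasure_prod hlam measurableSet_ball
      measure_ball_lt_top.ne measurableSet_ball measure_ball_lt_top.ne]
    exact ENNReal.mul_lt_top (ENNReal.mul_lt_top ENNReal.ofReal_lt_top measure_ball_lt_top)
      (ENNReal.mul_lt_top ENNReal.ofReal_lt_top measure_ball_lt_top)
  refine Measure.ext_prod fun {A B} hA hB => ?_
  rw [Measure.restrict_apply (hA.prod hB), Measure.restrict_apply (hA.prod hB), Set.prod_inter_prod,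
    hX.pairMeasure_prod hlam (hA.inter measurableSet_ball) (hb A) (hB.inter measurableSet_ball)
      (hb B), Measure.prod_prod]
  rfl

/-- Campbell's formula for pairs of points with distinct labels. -/
lemma IsHPPP.tsum_pair_lintegral (hX : IsHPPP Pr lam X) (hlam : 0 ≤ lam)
    {f : Plane → Plane → ℝ≥0∞} (hf : Measurable (Function.uncurry f)) :
    ∑' q : {q : ι × ι // q.1 ≠ q.2}, ∫⁻ ω, f (X q.1.1 ω) (X q.1.2 ω) ∂Pr =
      ENNReal.ofReal lam ^ 2 * ∫⁻ x, ∫⁻ y, f x y := by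
  have h := congrArg (fun ν => ∫⁻ x, Function.uncurry f x ∂ν) (hX.pairMeasure_eq hlam)
  simp only [pairMeasure, lintegral_sum_measure] at h
  rw [lintegral_prod _ hf.aemeasurable] at h
  simp only [lintegral_smul_measure, smul_eq_mul, Function.uncurry_apply_pair] at h
  rw [lintegral_const_mul _ (f := fun x => ∫⁻ y, f x y) hf.lintegral_prod_right', ← mul_assoc, ← sq] at h
  rw [← h]
  congr 1
  ext q
  rw [lintegral_map hf ((hX.measurable _).prodMk (hX.measurable _))]
  rfl

end Campbell

end Cellular

namespace Cellular

/-! ### Standard complex Gaussian vectors -/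

section Gaussian

open scoped InnerProductSpace

lemma charFun_stdComplexGaussian (t : ℂ) :
    charFun stdComplexGaussian t = Complex.exp (-(‖t‖ ^ 2 / 4 : ℝ)) := by
  have h : ∀ x : ℝ × ℝ, ((⟪Complex.measurableEquivRealProd.symm x, t⟫_ℝ : ℝ) : ℂ) * Complex.I =
      (x.1 * t.re : ℝ) * Complex.I + (x.2 * t.im : ℝ) * Complex.I := by
    intro x
    rw [← add_mul, ← Complex.ofReal_add]
    congr 2
    rw [Complex.inner]
    simp [Complex.measurableEquivRealProd, mul_comm]
  rw [charFun_apply, stdComplexGaussian, integral_map_equiv]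
  simp_rw [h, Complex.exp_add]
  rw [integral_prod_mul (fun x : ℝ => Complex.exp ((x * t.re : ℝ) * Complex.I))
    (fun x : ℝ => Complex.exp ((x * t.im : ℝ) * Complex.I))]
  have h1 := charFun_gaussianReal (μ := 0) (v := 1 / 2) t.re
  have h2 := charFun_gaussianReal (μ := 0) (v := 1 / 2) t.im
  rw [charFun_apply_real] at h1 h2
  push_cast
  have e1 : (∫ x : ℝ, Complex.exp (x * t.re * Complex.I) ∂gaussianReal 0 (1 / 2)) =
      Complex.exp (-(t.re ^ 2 / 4)) := by
    have e : (t.re : ℂ) * (0 : ℝ) * Complex.I - ((1 / 2 : ℝ≥0) : ℝ) * t.re ^ 2 / 2 =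
        -(t.re ^ 2 / 4) := by push_cast; ring
    rw [← e, ← h1]
    congr 1; ext x; congr 1; ring
  have e2 : (∫ x : ℝ, Complex.exp (x * t.im * Complex.I) ∂gaussianReal 0 (1 / 2)) =
      Complex.exp (-(t.im ^ 2 / 4)) := by
    have e : (t.im : ℂ) * (0 : ℝ) * Complex.I - ((1 / 2 : ℝ≥0) : ℝ) * t.im ^ 2 / 2 =
        -(t.im ^ 2 / 4) := by push_cast; ring
    rw [← e, ← h2]
    congr 1; ext x; congr 1; ring
  rw [e1, e2, ← Complex.exp_add]
  congr 1
  rw [← Complex.ofReal_pow ‖t‖, Complex.sq_norm, Complex.normSq_apply]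
  push_cast
  ring

/-- The law of a vector of independent `𝒞𝒩(0,1)` entries. -/
def gaussVec (ι : Type*) [Fintype ι] : Measure (EuclideanSpace ℂ ι) :=
  (Measure.pi fun _ => stdComplexGaussian).map (WithLp.toLp 2)

variable {ι κ : Type*} [Fintype ι] [Fintype κ]

instance : IsProbabilityMeasure (gaussVec ι) :=
  Measure.isProbabilityMeasure_map (by fun_prop)

/-- The dependence on `t` through its norm alone is what makes the Gaussian law invariant under
orthonormal changes of coordinates. -/
lemma charFun_gaussVec (t : EuclideanSpace ℂ ι) :
    charFun (gaussVec ι) t = Complex.exp (-(‖t‖ ^ 2 / 4 : ℝ)) := by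
  rw [gaussVec, charFun_pi]
  simp_rw [charFun_stdComplexGaussian]
  rw [← Complex.exp_sum, EuclideanSpace.norm_sq_eq, Finset.sum_neg_distrib, Finset.sum_div]
  push_cast
  rfl

lemma real_inner_eq_re (x y : EuclideanSpace ℂ ι) : ⟪x, y⟫_ℝ = (⟪x, y⟫_ℂ).re := by
  rw [PiLp.inner_apply, PiLp.inner_apply, Complex.re_sum]
  congr 1

/-- The coordinates of a standard Gaussian vector in an orthonormal family are i.i.d. -/
lemma map_inner_gaussVec {u : κ → EuclideanSpace ℂ ι} (hu : Orthonormal ℂ u) :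
    (gaussVec ι).map (fun v => (WithLp.toLp 2 fun m => ⟪u m, v⟫_ℂ : EuclideanSpace ℂ κ)) =
      gaussVec κ := by
  have hm : Measurable
      (fun v => (WithLp.toLp 2 fun m => ⟪u m, v⟫_ℂ : EuclideanSpace ℂ κ)) := by fun_prop
  have : IsProbabilityMeasure
    ((gaussVec ι).map (fun v => (WithLp.toLp 2 fun m => ⟪u m, v⟫_ℂ : EuclideanSpace ℂ κ))) :=
    Measure.isProbabilityMeasure_map hm.aemeasurable
  refine Measure.ext_of_charFun (funext fun t => ?_)
  -- The characteristic function of the image at `t` is that of the original law at `∑ t_m u_m`, a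
  -- vector with the norm of `t`.
  have hn : ‖∑ m, t m • u m‖ ^ 2 = ‖t‖ ^ 2 := by
    have := hu.inner_sum (fun m => t m) (fun m => t m) Finset.univ
    rw [← inner_self_eq_norm_sq (𝕜 := ℂ), this, map_sum, EuclideanSpace.norm_sq_eq t]
    refine Finset.sum_congr rfl fun m _ => ?_
    rw [RCLike.conj_mul, ← RCLike.ofReal_pow, RCLike.ofReal_re]
  rw [charFun_gaussVec, ← hn, ← charFun_gaussVec, charFun_apply, charFun_apply,
    integral_map hm.aemeasurable (by fun_prop)]
  congr 1
  ext v
  congr 3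
  rw [real_inner_eq_re, real_inner_eq_re, inner_sum, PiLp.inner_apply]
  congr 2
  ext m
  simp [inner_smul_right]

lemma map_eval_gaussVec (m : ι) :
    (gaussVec ι).map (fun x : EuclideanSpace ℂ ι => x m) = stdComplexGaussian := by
  rw [gaussVec, Measure.map_map (by fun_prop) (by fun_prop)]
  exact (measurePreserving_eval (fun _ : ι => stdComplexGaussian) m).map_eq

lemma map_inner_gaussVec_of_norm_eq_one {w : EuclideanSpace ℂ ι} (hw : ‖w‖ = 1) :
    (gaussVec ι).map (fun v => ⟪w, v⟫_ℂ) = stdComplexGaussian := by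
  have hu : Orthonormal ℂ (fun _ : Unit => w) := ⟨fun _ => hw, fun a b h => (h rfl).elim⟩
  have h := congrArg (Measure.map fun x : EuclideanSpace ℂ Unit => x ()) (map_inner_gaussVec hu)
  rw [Measure.map_map (by fun_prop) (by fun_prop), map_eval_gaussVec] at h
  exact h

/-! ### Moments -/

lemma lintegral_stdComplexGaussian {f : ℂ → ℝ≥0∞} (hf : Measurable f) :
    ∫⁻ z, f z ∂stdComplexGaussian =
      ∫⁻ x, ∫⁻ y, f ⟨x, y⟩ ∂(gaussianReal 0 (1 / 2)) ∂(gaussianReal 0 (1 / 2)) := by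
  rw [stdComplexGaussian, lintegral_map_equiv, lintegral_prod _ (by fun_prop)]
  rfl

lemma lintegral_sq_gaussianReal :
    ∫⁻ x, ENNReal.ofReal (x ^ 2) ∂(gaussianReal 0 (1 / 2)) = ENNReal.ofReal (1 / 2) := by
  have h := variance_fun_id_gaussianReal (μ := 0) (v := 1 / 2)
  rw [variance_eq_integral (by fun_prop)] at h
  simp only [integral_id_gaussianReal, sub_zero] at h
  rw [← ofReal_integral_eq_lintegral_ofReal (f := fun x => x ^ 2)
    ((memLp_id_gaussianReal 2).integrable_sq) (Eventually.of_forall fun x => sq_nonneg x), h]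
  norm_num

lemma lintegral_pow_four_gaussianReal_lt_top :
    ∫⁻ x, ENNReal.ofReal (x ^ 4) ∂(gaussianReal 0 (1 / 2)) < ∞ := by
  have h := (memLp_id_gaussianReal (μ := 0) (v := 1 / 2) 4).integrable_norm_pow (p := 4)
    (by norm_num)
  refine (lintegral_mono fun x => ?_).trans_lt h.2
  rw [← ofReal_norm]
  refine ENNReal.ofReal_le_ofReal ?_
  simp only [id, norm_pow, Real.norm_eq_abs, abs_abs]
  exact (le_abs_self _).trans_eq (abs_pow x 4)

/-- Outside `[-1, 1]` the integrand is at most 1; inside, the density is bounded and `|x|^(-1/2)` is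
integrable at 0. The resulting negative moment controls the logarithm of the desired signal near
zero. -/
lemma lintegral_rpow_neg_gaussianReal_lt_top :
    ∫⁻ x, ENNReal.ofReal (|x| ^ (-(1 / 2) : ℝ)) ∂(gaussianReal 0 (1 / 2)) < ∞ := by
  have hpt : ∀ x : ℝ, ENNReal.ofReal (|x| ^ (-(1 / 2) : ℝ)) ≤
      (Set.Icc (-1 : ℝ) 1).indicator (fun x => ENNReal.ofReal (|x| ^ (-(1 / 2) : ℝ))) x + 1 := by
    intro x
    by_cases hx : x ∈ Set.Icc (-1 : ℝ) 1
    · rw [Set.indicator_of_mem hx]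
      exact le_self_add
    · rw [Set.indicator_of_notMem hx, zero_add, ENNReal.ofReal_le_one]
      refine Real.rpow_le_one_of_one_le_of_nonpos ?_ (by norm_num)
      rw [Set.mem_Icc, ← abs_le] at hx
      exact (not_le.1 hx).le
  refine (lintegral_mono hpt).trans_lt ?_
  rw [lintegral_add_right _ measurable_const]
  refine ENNReal.add_lt_top.2 ⟨?_, by simp⟩
  rw [lintegral_indicator measurableSet_Icc, gaussianReal_of_var_ne_zero _ (by norm_num),
    restrict_withDensity measurableSet_Icc,
    lintegral_withDensity_eq_lintegral_mul _ (measurable_gaussianPDF _ _) (by fun_prop)]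
  -- The density with variance `1/2` has maximum `π^(-1/2) < 1`.
  have hb : ∀ x, gaussianPDF 0 (1 / 2) x ≤ 1 := by
    intro x
    rw [gaussianPDF, ENNReal.ofReal_le_one, gaussianPDFReal]
    refine mul_le_one₀ ?_ (Real.exp_nonneg _) ?_
    · refine inv_le_one_of_one_le₀ ?_
      rw [Real.one_le_sqrt]
      have := Real.pi_gt_three
      push_cast
      linarith
    · rw [Real.exp_le_one_iff]
      refine div_nonpos_of_nonpos_of_nonneg (by nlinarith [sq_nonneg (x - 0)]) (by positivity)
  refine (lintegral_mono fun x => mul_le_mul_left (hb x) _).trans_lt ?_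
  simp only [one_mul]
  have hint : IntervalIntegrable (fun x : ℝ => |x| ^ (-(1 / 2) : ℝ)) volume (-1 : ℝ) 1 := by
    have h1 : IntervalIntegrable (fun x : ℝ => |x| ^ (-(1 / 2) : ℝ)) volume (0 : ℝ) 1 := by
      refine (intervalIntegral.intervalIntegrable_rpow' (a := 0) (b := 1) (r := -(1 / 2))
        (by norm_num)).congr ?_
      intro x hx
      rw [Set.uIoc_of_le zero_le_one] at hx
      simp only [abs_of_pos hx.1]
    have h2 := (IntervalIntegrable.iff_comp_neg (f := fun x : ℝ => |x| ^ (-(1 / 2) : ℝ))).1 h1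
    simp only [abs_neg, neg_zero] at h2
    exact h2.symm.trans h1
  rw [intervalIntegrable_iff_integrableOn_Ioc_of_le (by norm_num),
    ← integrableOn_Icc_iff_integrableOn_Ioc] at hint
  refine (lintegral_mono fun x => ?_).trans_lt hint.2
  rw [← ofReal_norm]
  exact ENNReal.ofReal_le_ofReal (le_abs_self _)

lemma lintegral_norm_sq_stdComplexGaussian :
    ∫⁻ z, ENNReal.ofReal (‖z‖ ^ 2) ∂stdComplexGaussian = 1 := by
  rw [lintegral_stdComplexGaussian (by fun_prop)]
  have h : ∀ x y : ℝ, ENNReal.ofReal (‖(⟨x, y⟩ : ℂ)‖ ^ 2) =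
      ENNReal.ofReal (x ^ 2) + ENNReal.ofReal (y ^ 2) := by
    intro x y
    rw [← ENNReal.ofReal_add (by positivity) (by positivity), Complex.sq_norm,
      Complex.normSq_apply]
    congr 1
    ring
  simp_rw [h]
  simp_rw [lintegral_add_left measurable_const, lintegral_sq_gaussianReal, lintegral_const,
    measure_univ, mul_one]
  rw [lintegral_add_right _ measurable_const, lintegral_sq_gaussianReal, lintegral_const,
    measure_univ, mul_one, ← ENNReal.ofReal_add (by norm_num) (by norm_num)]
  norm_num

lemma lintegral_norm_pow_four_stdComplexGaussian_lt_top :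
    ∫⁻ z, ENNReal.ofReal (‖z‖ ^ 4) ∂stdComplexGaussian < ∞ := by
  rw [lintegral_stdComplexGaussian (by fun_prop)]
  have h : ∀ x y : ℝ, ENNReal.ofReal (‖(⟨x, y⟩ : ℂ)‖ ^ 4) ≤
      2 * (ENNReal.ofReal (x ^ 4) + ENNReal.ofReal (y ^ 4)) := by
    intro x y
    rw [← ENNReal.ofReal_add (by positivity) (by positivity), ← ENNReal.ofReal_ofNat,
      ← ENNReal.ofReal_mul (by norm_num)]
    refine ENNReal.ofReal_le_ofReal ?_
    have : ‖(⟨x, y⟩ : ℂ)‖ ^ 4 = (x ^ 2 + y ^ 2) ^ 2 := by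
      rw [show 4 = 2 * 2 by norm_num, pow_mul, Complex.sq_norm, Complex.normSq_apply]
      ring
    rw [this]
    nlinarith [sq_nonneg (x ^ 2 - y ^ 2)]
  refine (lintegral_mono fun x => lintegral_mono fun y => h x y).trans_lt ?_
  have hf := lintegral_pow_four_gaussianReal_lt_top.ne
  simp_rw [lintegral_const_mul' 2 _ (by norm_num : (2 : ℝ≥0∞) ≠ ∞),
    lintegral_add_left measurable_const, lintegral_const, measure_univ, mul_one]
  rw [lintegral_add_right _ measurable_const, lintegral_const, measure_univ, mul_one]
  finiteness

lemma lintegral_norm_rpow_neg_stdComplexGaussian_lt_top :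
    ∫⁻ z, ENNReal.ofReal (‖z‖ ^ (-(1 / 2) : ℝ)) ∂stdComplexGaussian < ∞ := by
  rw [lintegral_stdComplexGaussian (by fun_prop)]
  have h : ∀ᵐ x ∂(gaussianReal 0 (1 / 2)), ∫⁻ y, ENNReal.ofReal (‖(⟨x, y⟩ : ℂ)‖ ^ (-(1 / 2) : ℝ))
      ∂(gaussianReal 0 (1 / 2)) ≤ ENNReal.ofReal (|x| ^ (-(1 / 2) : ℝ)) := by
    have := nullSingletonClass_gaussianReal (μ := 0) (v := 1 / 2) (by norm_num)
    have h0 : ∀ᵐ x ∂(gaussianReal 0 (1 / 2)), x ≠ 0 := by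
      rw [ae_iff]
      simp only [ne_eq, not_not, Set.ofPred_eq_eq_singleton]
      exact measure_singleton 0
    filter_upwards [h0] with x hx
    calc _ ≤ ∫⁻ y, ENNReal.ofReal (|x| ^ (-(1 / 2) : ℝ)) ∂(gaussianReal 0 (1 / 2)) := by
          refine lintegral_mono fun y => ENNReal.ofReal_le_ofReal ?_
          exact Real.rpow_le_rpow_of_nonpos (abs_pos.2 hx) (Complex.abs_re_le_norm ⟨x, y⟩)
            (by norm_num)
      _ = _ := by simp
  exact (lintegral_mono_ae h).trans_lt lintegral_rpow_neg_gaussianReal_lt_top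

/-- The fourth absolute moment of `𝒞𝒩(0,1)`. -/
def fourthMoment : ℝ≥0∞ := ∫⁻ z, ENNReal.ofReal (‖z‖ ^ 4) ∂stdComplexGaussian

/-- The absolute moment of order `-1/2` of `𝒞𝒩(0,1)`. -/
def negMoment : ℝ≥0∞ := ∫⁻ z, ENNReal.ofReal (‖z‖ ^ (-(1 / 2) : ℝ)) ∂stdComplexGaussian

lemma lintegral_inner_gaussVec {w : EuclideanSpace ℂ ι} (hw : ‖w‖ = 1) {f : ℂ → ℝ≥0∞}
    (hf : Measurable f) :
    ∫⁻ v, f ⟪w, v⟫_ℂ ∂(gaussVec ι) = ∫⁻ z, f z ∂stdComplexGaussian := by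
  rw [← map_inner_gaussVec_of_norm_eq_one hw, lintegral_map hf (by fun_prop)]

lemma variance_norm_sq_stdComplexGaussian_le :
    ENNReal.ofReal (Var[fun z => ‖z‖ ^ 2; stdComplexGaussian]) ≤ fourthMoment := by
  refine (ENNReal.ofReal_le_ofReal (variance_le_expectation_sq (by fun_prop))).trans ?_
  refine (ENNReal.ofReal_le_of_le_toReal ?_)
  rw [fourthMoment, ← integral_eq_lintegral_of_nonneg_ae]
  · refine le_of_eq ?_
    congr 1
    ext z
    simp only [Pi.pow_apply]
    ring
  · exact Eventually.of_forall fun z => by positivity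
  · exact Measurable.aestronglyMeasurable (by fun_prop)

lemma memLp_norm_sq_stdComplexGaussian : MemLp (fun z : ℂ => ‖z‖ ^ 2) 2 stdComplexGaussian := by
  rw [memLp_two_iff_integrable_sq (by fun_prop)]
  refine ⟨by fun_prop, ?_⟩
  refine (lintegral_mono fun x => ?_).trans_lt lintegral_norm_pow_four_stdComplexGaussian_lt_top
  rw [← ofReal_norm]
  refine ENNReal.ofReal_le_ofReal (le_of_eq ?_)
  rw [Real.norm_of_nonneg (by positivity)]
  ring

lemma integral_norm_sq_stdComplexGaussian : ∫ z, ‖z‖ ^ 2 ∂stdComplexGaussian = 1 := by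
  rw [integral_eq_lintegral_of_nonneg_ae (Eventually.of_forall fun z => by positivity)
    (by fun_prop), lintegral_norm_sq_stdComplexGaussian, ENNReal.toReal_one]

/-- The squared norm of a `d`-dimensional projection of a standard Gaussian vector is concentrated
around `d`. -/
lemma lintegral_sum_norm_sq_inner_sub_sq_le {u : κ → EuclideanSpace ℂ ι} (hu : Orthonormal ℂ u) :
    ∫⁻ v, ENNReal.ofReal ((∑ m, ‖⟪u m, v⟫_ℂ‖ ^ 2 - Fintype.card κ) ^ 2) ∂(gaussVec ι) ≤
      fourthMoment * Fintype.card κ := by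
  have h1 : ∫⁻ v, ENNReal.ofReal ((∑ m, ‖⟪u m, v⟫_ℂ‖ ^ 2 - Fintype.card κ) ^ 2) ∂(gaussVec ι) =
      ∫⁻ z : κ → ℂ, ENNReal.ofReal ((∑ m, ‖z m‖ ^ 2 - Fintype.card κ) ^ 2)
        ∂(Measure.pi fun _ => stdComplexGaussian) := by
    have := map_inner_gaussVec hu
    rw [← lintegral_map (μ := Measure.pi fun _ => stdComplexGaussian)
      (f := fun x : EuclideanSpace ℂ κ =>
        ENNReal.ofReal ((∑ m, ‖x m‖ ^ 2 - Fintype.card κ) ^ 2)) (by fun_prop)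
        (g := WithLp.toLp 2) (by fun_prop), ← gaussVec, ← this, lintegral_map (by fun_prop) (by fun_prop)]
  rw [h1]
  have hv := variance_sum_pi (ι := κ) (μ := fun _ => stdComplexGaussian)
    (X := fun _ z => ‖z‖ ^ 2) (fun _ => memLp_norm_sq_stdComplexGaussian)
  have hmem : MemLp (∑ m : κ, fun z : κ → ℂ => ‖z m‖ ^ 2) 2
      (Measure.pi fun _ => stdComplexGaussian) :=
    memLp_finsetSum' _ fun m _ => memLp_norm_sq_stdComplexGaussian.comp_measurePreserving
      (measurePreserving_eval (fun _ : κ => stdComplexGaussian) m)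
  have hE : ∫ z : κ → ℂ, (∑ m : κ, fun z : κ → ℂ => ‖z m‖ ^ 2) z
      ∂(Measure.pi fun _ => stdComplexGaussian) = Fintype.card κ := by
    simp only [Finset.sum_apply]
    rw [integral_finsetSum]
    · have : ∀ m : κ, ∫ z : κ → ℂ, ‖z m‖ ^ 2 ∂(Measure.pi fun _ => stdComplexGaussian) = 1 := by
        intro m
        have h := (measurePreserving_eval (fun _ : κ => stdComplexGaussian) m).map_eq
        rw [← integral_norm_sq_stdComplexGaussian]
        conv_rhs => rw [← h]
        rw [integral_map (measurable_pi_apply m).aemeasurable (by fun_prop)]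
      simp [this]
    · intro m _
      exact (memLp_norm_sq_stdComplexGaussian.comp_measurePreserving
        (measurePreserving_eval (fun _ : κ => stdComplexGaussian) m)).integrable (by norm_num)
  rw [variance_eq_integral hmem.aestronglyMeasurable.aemeasurable, hE] at hv
  have h2 := ofReal_integral_eq_lintegral_ofReal (μ := Measure.pi fun _ : κ => stdComplexGaussian)
    (f := fun z => ((∑ m : κ, fun z : κ → ℂ => ‖z m‖ ^ 2) z - Fintype.card κ) ^ 2)
    ((hmem.sub (memLp_const _)).integrable_sq) (Eventually.of_forall fun z => sq_nonneg _)
  rw [hv] at h2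
  simp only [Finset.sum_apply] at h2
  rw [← h2]
  simp only [Finset.sum_const, Finset.card_univ, nsmul_eq_mul]
  rw [mul_comm, ENNReal.ofReal_mul (variance_nonneg _ _), ENNReal.ofReal_natCast]
  gcongr
  exact variance_norm_sq_stdComplexGaussian_le

end Gaussian

end Cellular

namespace Cellular

/-! ### Resampling one fading vector -/

/-- On a box the two independent copies contribute complementary groups of factors, which multiply
to the full product. Independence of one fading vector from the rest is used in this form
throughout: the vector is replaced by a fresh copy. -/
lemma map_ite_infinitePi {ι : Type*} {X : ι → Type*} [∀ i, MeasurableSpace (X i)]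
    (μ : ∀ i, Measure (X i)) [∀ i, IsProbabilityMeasure (μ i)] (T : ι → Prop) [DecidablePred T] :
    ((Measure.infinitePi μ).prod (Measure.infinitePi μ)).map
      (fun p i => if T i then p.2 i else p.1 i) = Measure.infinitePi μ := by
  have hm : Measurable (fun (p : (∀ i, X i) × (∀ i, X i)) i => if T i then p.2 i else p.1 i) := by
    refine measurable_pi_lambda _ fun i => ?_
    by_cases h : T i <;> simp only [h, if_true, if_false] <;> fun_prop
  refine Measure.eq_infinitePi μ fun s t ht => ?_
  rw [Measure.map_apply hm (MeasurableSet.pi s.countable_toSet fun i _ => ht i)]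
  have : (fun (p : (∀ i, X i) × (∀ i, X i)) i => if T i then p.2 i else p.1 i) ⁻¹' Set.pi s t =
      Set.pi (s.filter fun i => ¬ T i : Finset ι) t ×ˢ Set.pi (s.filter T : Finset ι) t := by
    ext p
    simp only [Set.mem_preimage, Set.mem_pi, Set.mem_prod, Finset.coe_filter, Set.mem_ofPred_eq,
      Finset.mem_coe]
    constructor
    · intro h
      refine ⟨fun i hi => ?_, fun i hi => ?_⟩
      · simpa [hi.2] using h i hi.1
      · simpa [hi.2] using h i hi.1
    · rintro ⟨h1, h2⟩ i hi
      by_cases h : T i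
      · simpa [h] using h2 i ⟨hi, h⟩
      · simpa [h] using h1 i ⟨hi, h⟩
  rw [this, Measure.prod_prod, Measure.infinitePi_pi _ (fun i _ => ht i),
    Measure.infinitePi_pi _ (fun i _ => ht i), mul_comm, Finset.prod_filter_mul_prod_filter_not]

variable {M L : ℕ}

@[fun_prop]
lemma measurable_fadingVec (j : Mobile M) (k : ℕ) :
    Measurable fun g : Fading M L => fadingVec g j k := by
  unfold fadingVec
  fun_prop

lemma map_fadingVec (j : Mobile M) (k : ℕ) :
    (fadingLaw M L).map (fun g => fadingVec g j k) = gaussVec (Fin L) := by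
  have h : (fadingLaw M L).map (fun g (n : Fin L) => g (j, k, n)) =
      Measure.pi fun _ => stdComplexGaussian := by
    refine (Measure.pi_eq fun t ht => ?_).symm
    rw [Measure.map_apply (by fun_prop) (MeasurableSet.univ_pi ht)]
    let e : Fin L ↪ Mobile M × ℕ × Fin L := ⟨fun n => (j, k, n), fun a b h => by simpa using h⟩
    have : (fun (g : Fading M L) (n : Fin L) => g (j, k, n)) ⁻¹' Set.univ.pi t =
        Set.pi (Finset.univ.map e : Finset _) (fun x => t x.2.2) := by
      ext g
      simp only [Set.mem_preimage, Set.mem_pi, Set.mem_univ, true_imp_iff, Finset.coe_map,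
        Finset.coe_univ, Set.image_univ, Set.forall_mem_range]
      rfl
    rw [this, fadingLaw, Measure.infinitePi_pi _ (fun x _ => ht x.2.2), Finset.prod_map]
    rfl
  rw [gaussVec, ← h, Measure.map_map (by fun_prop) (by fun_prop)]
  rfl

/-- The fading coefficients `g` with the vector between mobile `j` and BS `k` replaced by `v`. -/
def refresh (g : Fading M L) (j : Mobile M) (k : ℕ) (v : EuclideanSpace ℂ (Fin L)) :
    Fading M L :=
  fun x => if x.1 = j ∧ x.2.1 = k then v x.2.2 else g x

lemma measurable_refresh (j : Mobile M) (k : ℕ) :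
    Measurable fun p : Fading M L × EuclideanSpace ℂ (Fin L) => refresh p.1 j k p.2 := by
  refine measurable_pi_lambda _ fun x => ?_
  unfold refresh
  by_cases h : x.1 = j ∧ x.2.1 = k
  · simp only [if_pos h]; fun_prop
  · simp only [if_neg h]; fun_prop

@[simp]
lemma fadingVec_refresh_self (g : Fading M L) (j : Mobile M) (k : ℕ)
    (v : EuclideanSpace ℂ (Fin L)) : fadingVec (refresh g j k v) j k = v := by
  ext n
  simp [fadingVec, refresh]

lemma fadingVec_refresh_of_ne (g : Fading M L) {j j' : Mobile M} {k k' : ℕ}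
    (v : EuclideanSpace ℂ (Fin L)) (h : j' ≠ j ∨ k' ≠ k) :
    fadingVec (refresh g j k v) j' k' = fadingVec g j' k' := by
  ext n
  simp only [fadingVec, refresh]
  rw [if_neg]
  tauto

/-- Averages over the fading may be computed after one fading vector has been resampled. -/
lemma lintegral_fadingLaw_refresh (j : Mobile M) (k : ℕ) {F : Fading M L → ℝ≥0∞}
    (hF : Measurable F) :
    ∫⁻ g, F g ∂(fadingLaw M L) =
      ∫⁻ g, ∫⁻ v, F (refresh g j k v) ∂(gaussVec (Fin L)) ∂(fadingLaw M L) := by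
  classical
  have h := map_ite_infinitePi (fun _ : Mobile M × ℕ × Fin L => stdComplexGaussian)
    (fun x => x.1 = j ∧ x.2.1 = k)
  have e : (fun (p : Fading M L × Fading M L) x => if x.1 = j ∧ x.2.1 = k then p.2 x else p.1 x) =
      fun p => refresh p.1 j k (fadingVec p.2 j k) := by
    ext p ⟨j', k', n⟩
    simp only [refresh, fadingVec]
    split_ifs with h
    · obtain ⟨rfl, rfl⟩ := h; rfl
    · rfl
  change ((fadingLaw M L).prod (fadingLaw M L)).map _ = fadingLaw M L at h
  rw [e] at h
  have hr := measurable_refresh (L := L) j k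
  have hm : Measurable fun p : Fading M L × Fading M L => refresh p.1 j k (fadingVec p.2 j k) :=
    hr.comp (by fun_prop : Measurable fun p : Fading M L × Fading M L => (p.1, fadingVec p.2 j k))
  conv_lhs => rw [← h, lintegral_map hF hm, lintegral_prod (fun p => F (refresh p.1 j k (fadingVec p.2 j k)))
    (hF.comp hm).aemeasurable]
  congr 1
  ext g
  rw [← map_fadingVec j k, lintegral_map _ (by fun_prop)]
  exact hF.comp ((measurable_refresh j k).comp measurable_prodMk_left)

/-! ### Linear independence of fading vectors -/

/-- A proper subspace lies in the kernel of the inner product with some unit vector, and this inner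
product has the law `𝒞𝒩(0,1)`, which has no atom at 0. -/
lemma gaussVec_submodule_eq_zero {K : Submodule ℂ (EuclideanSpace ℂ (Fin L))} (hK : K ≠ ⊤) :
    gaussVec (Fin L) K = 0 := by
  obtain ⟨w, hw, hw0⟩ : ∃ w ∈ Kᗮ, w ≠ 0 := by
    have : Kᗮ ≠ ⊥ := by rwa [Ne, Submodule.orthogonal_eq_bot_iff]
    exact Submodule.exists_mem_ne_zero_of_ne_bot this
  have hw1 : ‖((‖w‖⁻¹ : ℝ) : ℂ) • w‖ = 1 := by
    rw [norm_smul]; simp [hw0]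
  have h := map_inner_gaussVec_of_norm_eq_one hw1
  have h0 : stdComplexGaussian {0} = 0 := by
    have := nullSingletonClass_gaussianReal (μ := 0) (v := 1 / 2) (by norm_num)
    rw [stdComplexGaussian, Measure.map_apply Complex.measurableEquivRealProd.symm.measurable
      (measurableSet_singleton 0)]
    refine measure_mono_null (t := {0} ×ˢ Set.univ) ?_ ?_
    · intro p hp
      have : Complex.measurableEquivRealProd.symm p = 0 := hp
      have := congrArg Complex.re this
      simpa using this
    · rw [Measure.prod_prod, measure_singleton, zero_mul]
  rw [← h, Measure.map_apply (by fun_prop) (measurableSet_singleton 0)] at h0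
  refine measure_mono_null (fun v hv => ?_) h0
  simp only [Set.mem_preimage, Set.mem_singleton_iff]
  rw [inner_smul_left, Submodule.inner_left_of_mem_orthogonal hv hw, mul_zero]

lemma measurableSet_linearIndepOn (S : Finset (Mobile M)) (k : ℕ) :
    MeasurableSet {g : Fading M L | LinearIndepOn ℂ (fun j => fadingVec g j k) (S : Set _)} := by
  have h := isOpen_setOfPred_linearIndependent (𝕜 := ℂ) (E := EuclideanSpace ℂ (Fin L))
    (ι := (S : Set (Mobile M)))
  exact (measurable_pi_lambda _ fun j : (S : Set (Mobile M)) =>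
    measurable_fadingVec (L := L) j.1 k) h.measurableSet

/-- Induction on `S`: the vector of a new mobile is resampled given the others, which are fewer than
`L` and span a proper subspace, and almost surely avoids that span. -/
lemma ae_linearIndepOn (S : Finset (Mobile M)) (hS : S.card ≤ L) (k : ℕ) :
    ∀ᵐ g ∂(fadingLaw M L), LinearIndepOn ℂ (fun j => fadingVec g j k) (S : Set (Mobile M)) := by
  classical
  induction S using Finset.induction_on with
  | empty => simp
  | insert j S hj ih =>
    rw [Finset.card_insert_of_notMem hj] at hS
    have hmeas := measurableSet_linearIndepOn (L := L) (insert j S) k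
    rw [ae_iff]
    change fadingLaw M L {g | LinearIndepOn ℂ (fun j => fadingVec g j k) _}ᶜ = 0
    rw [← lintegral_indicator_one hmeas.compl,
      lintegral_fadingLaw_refresh j k (measurable_one.indicator hmeas.compl)]
    refine (lintegral_congr_ae ?_).trans lintegral_zero
    filter_upwards [ih (by omega)] with g hg
    set K := Submodule.span ℂ ((fun l => fadingVec g l k) '' (S : Set (Mobile M))) with hK
    have hKtop : K ≠ ⊤ := by
      intro h
      have h1 := finrank_span_finset_le_card (R := ℂ) (S.image fun l => fadingVec g l k)
      rw [Finset.coe_image, Set.finrank, ← hK, h, finrank_top, finrank_euclideanSpace,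
        Fintype.card_fin] at h1
      have := Finset.card_image_le (s := S) (f := fun l => fadingVec g l k)
      omega
    refine (lintegral_congr_ae ?_).trans lintegral_zero
    have h0 : ∀ᵐ v ∂(gaussVec (Fin L)), v ∉ K := by
      rw [ae_iff]
      simpa using gaussVec_submodule_eq_zero hKtop
    filter_upwards [h0] with v hv
    refine Set.indicator_of_notMem ?_ _
    simp only [Set.mem_compl_iff, not_not, Set.mem_ofPred_eq, Finset.coe_insert]
    have hcongr : Set.EqOn (fun l => fadingVec (refresh g j k v) l k) (fun l => fadingVec g l k)
        (S : Set (Mobile M)) := fun l hl =>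
      fadingVec_refresh_of_ne g v (Or.inl fun h => hj (h ▸ hl))
    rw [linearIndepOn_insert (by simpa using hj), Set.image_congr hcongr]
    refine ⟨hg.congr hcongr.symm, ?_⟩
    simpa using hv

/-- The event that any at most `L` fading vectors at the same BS are linearly independent. -/
def GeneralPosition (g : Fading M L) : Prop :=
  ∀ (k : ℕ) (S : Finset (Mobile M)), S.card ≤ L →
    LinearIndepOn ℂ (fun j => fadingVec g j k) (S : Set (Mobile M))

lemma ae_generalPosition : ∀ᵐ g ∂(fadingLaw M L), GeneralPosition g := by
  unfold GeneralPosition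
  simp_rw [ae_all_iff]
  exact fun k S hS => ae_linearIndepOn S hS k

/-! ### The zero-forcing projection -/

/-- The span of the fading vectors between BS `k` and the mobiles of `S`. -/
def fadingSpan (g : Fading M L) (S : Set (Mobile M)) (k : ℕ) :
    Submodule ℂ (EuclideanSpace ℂ (Fin L)) :=
  Submodule.span ℂ ((fun l => fadingVec g l k) '' S)

open scoped ComplexOrder in
-- Linear independence of the columns makes `Gᴴ G` positive definite, so that its matrix inverse is
-- a true inverse. Then `Gᴴ Q = 0`, hence `Q v` is orthogonal to the columns, while `v - Q v` lies
-- in the range of `G`. From here on only the geometry of the projection matters.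
lemma zfProj_mulVec_eq_starProjection {g : Fading M L} {S : Set (Mobile M)} (hS : S.Finite) {k : ℕ}
    (hg : LinearIndepOn ℂ (fun j => fadingVec g j k) S) (v : EuclideanSpace ℂ (Fin L)) :
    (WithLp.toLp 2 (zfProj g S k *ᵥ v.ofLp) : EuclideanSpace ℂ (Fin L)) =
      (fadingSpan g S k)ᗮ.starProjection v := by
  classical
  let _ : Fintype S := hS.fintype
  rw [zfProj, dif_pos hS]
  set G := fadingMat g S k with hG
  have hcol : ∀ w : S → ℂ, (WithLp.toLp 2 (G *ᵥ w) : EuclideanSpace ℂ (Fin L)) =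
      ∑ j, w j • fadingVec g j.1 k := by
    intro w
    ext n
    simp only [Matrix.mulVec, dotProduct, hG, fadingMat, Matrix.of_apply, WithLp.ofLp_sum,
      WithLp.ofLp_smul, Finset.sum_apply, Pi.smul_apply, smul_eq_mul, fadingVec]
    exact Finset.sum_congr rfl fun j _ => mul_comm _ _
  have hinj : Function.Injective G.mulVec := by
    have hli : LinearIndependent ℂ (fun j : S => fadingVec g j.1 k) := hg
    rw [Fintype.linearIndependent_iff] at hli
    intro w w' h
    have h' : G *ᵥ (w - w') = 0 := by rw [Matrix.mulVec_sub]; exact sub_eq_zero.2 h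
    have := hli (w - w') (by rw [← hcol, h']; rfl)
    ext j
    exact sub_eq_zero.1 (this j)
  have hdet : IsUnit (Gᴴ * G).det :=
    (Matrix.isUnit_iff_isUnit_det _).1 (Matrix.PosDef.conjTranspose_mul_self G hinj).isUnit
  symm
  refine Submodule.eq_starProjection_of_mem_orthogonal ?_ ?_
  · rw [fadingSpan, Submodule.mem_orthogonal]
    intro x hx
    refine Submodule.span_induction (p := fun x _ => inner ℂ x _ = (0 : ℂ)) ?_ (by simp) ?_ ?_ hx
    · rintro _ ⟨l, hl, rfl⟩
      have h0 : Gᴴ *ᵥ ((1 - G * (Gᴴ * G)⁻¹ * Gᴴ) *ᵥ v.ofLp) = 0 := by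
        rw [Matrix.mulVec_mulVec, Matrix.mul_sub, Matrix.mul_one, ← Matrix.mul_assoc,
          ← Matrix.mul_assoc, Matrix.mul_nonsing_inv _ hdet, Matrix.one_mul, sub_self,
          Matrix.zero_mulVec]
      have := congrFun h0 ⟨l, hl⟩
      rw [PiLp.inner_apply]
      simpa [Matrix.mulVec, dotProduct, hG, fadingMat, fadingVec, mul_comm] using this
    · intro x y _ _ hx hy; rw [inner_add_left, hx, hy, add_zero]
    · intro a x _ hx; rw [inner_smul_left, hx, mul_zero]
  · rw [Submodule.orthogonal_orthogonal]
    have : v - WithLp.toLp 2 ((1 - G * (Gᴴ * G)⁻¹ * Gᴴ) *ᵥ v.ofLp) =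
        WithLp.toLp 2 (G *ᵥ (((Gᴴ * G)⁻¹ * Gᴴ) *ᵥ v.ofLp)) := by
      rw [Matrix.mulVec_mulVec, Matrix.sub_mulVec, Matrix.one_mulVec, Matrix.mul_assoc]
      ext n
      simp
    rw [this, hcol]
    exact Submodule.sum_mem _ fun j _ =>
      Submodule.smul_mem _ _ (Submodule.subset_span ⟨j.1, j.2, rfl⟩)

lemma finrank_fadingSpan_orthogonal {g : Fading M L} {S : Finset (Mobile M)} {k : ℕ}
    (hg : LinearIndepOn ℂ (fun j => fadingVec g j k) (S : Set (Mobile M))) :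
    Module.finrank ℂ (fadingSpan g (S : Set (Mobile M)) k)ᗮ + S.card = L := by
  have h := Submodule.finrank_add_finrank_orthogonal (fadingSpan g (S : Set (Mobile M)) k)
  have h2 : Module.finrank ℂ (fadingSpan g (S : Set (Mobile M)) k) = S.card := by
    have hli : LinearIndependent ℂ (fun j : (S : Set (Mobile M)) => fadingVec g j.1 k) := hg
    have := finrank_span_eq_card hli
    rw [fadingSpan, Set.image_eq_range]
    simpa using this
  rw [finrank_euclideanSpace, Fintype.card_fin] at h
  omega

section Projection

open scoped InnerProductSpace

variable (K : Submodule ℂ (EuclideanSpace ℂ (Fin L)))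

lemma norm_sq_starProjection_eq_sum (v : EuclideanSpace ℂ (Fin L)) :
    ‖K.starProjection v‖ ^ 2 =
      ∑ m, ‖⟪((stdOrthonormalBasis ℂ K m : K) : EuclideanSpace ℂ (Fin L)), v⟫_ℂ‖ ^ 2 := by
  have h := (stdOrthonormalBasis ℂ K).sum_sq_norm_inner_right (K.orthogonalProjectionOnto v)
  rw [Submodule.starProjection_apply, ← Submodule.coe_norm, ← h]
  refine Finset.sum_congr rfl fun m _ => ?_
  rw [Submodule.inner_orthogonalProjectionOnto_eq_of_mem_left]

lemma lintegral_norm_sq_starProjection_sub_sq_le :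
    ∫⁻ v, ENNReal.ofReal ((‖K.starProjection v‖ ^ 2 - Module.finrank ℂ K) ^ 2)
      ∂(gaussVec (Fin L)) ≤ fourthMoment * Module.finrank ℂ K := by
  have hu : Orthonormal ℂ
      (fun m => ((stdOrthonormalBasis ℂ K m : K) : EuclideanSpace ℂ (Fin L))) :=
    (stdOrthonormalBasis ℂ K).orthonormal.comp_linearIsometry K.subtypeₗᵢ
  have h := lintegral_sum_norm_sq_inner_sub_sq_le hu
  simp_rw [norm_sq_starProjection_eq_sum]
  simpa using h

/-- For a unit vector `w` in `K`, `‖K v‖ ≥ |⟪w, v⟫|`, so one coordinate already bounds the negative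
moment, uniformly in `L` and `K`. -/
lemma lintegral_norm_starProjection_rpow_le (hK : 1 ≤ Module.finrank ℂ K) :
    ∫⁻ v, ENNReal.ofReal (‖K.starProjection v‖ ^ (-(1 / 2) : ℝ)) ∂(gaussVec (Fin L)) ≤
      negMoment := by
  obtain ⟨u, hu, hu0⟩ : ∃ u ∈ K, u ≠ 0 := by
    refine Submodule.exists_mem_ne_zero_of_ne_bot ?_
    rintro rfl
    simp at hK
  set w := ((‖u‖⁻¹ : ℝ) : ℂ) • u with hw
  have hwK : w ∈ K := K.smul_mem _ hu
  have hw1 : ‖w‖ = 1 := by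
    rw [hw, norm_smul]; simp [hu0]
  rw [negMoment, ← lintegral_inner_gaussVec hw1 (by fun_prop)]
  refine lintegral_mono_ae ?_
  -- As `0 ^ (-1/2)` is the default value 0, the comparison of negative powers needs `⟪w, v⟫ ≠ 0`.
  have h0 : ∀ᵐ v ∂(gaussVec (Fin L)), v ∉ (ℂ ∙ w)ᗮ := by
    rw [ae_iff]
    have : (ℂ ∙ w)ᗮ ≠ ⊤ := by
      rw [Ne, Submodule.orthogonal_eq_top_iff, Submodule.span_singleton_eq_bot]
      rintro h
      simp [h] at hw1
    simpa using gaussVec_submodule_eq_zero this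
  filter_upwards [h0] with v hv
  refine ENNReal.ofReal_le_ofReal (Real.rpow_le_rpow_of_nonpos ?_ ?_ (by norm_num))
  · rw [norm_pos_iff]
    rwa [Submodule.mem_orthogonal_singleton_iff_inner_right] at hv
  · have : ⟪w, v⟫_ℂ = ⟪w, K.starProjection v⟫_ℂ := by
      have := Submodule.inner_starProjection_left_eq_right K w v
      rwa [Submodule.starProjection_eq_self_iff.2 hwK] at this
    rw [this]
    exact (norm_inner_le_norm _ _).trans_eq (by rw [hw1, one_mul])

end Projection

end Cellular

namespace Cellular

variable {M L : ℕ}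

/-! ### Measurability -/

section Measurability

lemma measurable_zfProj_apply {S : Set (Mobile M)} (hS : S.Finite) (k : ℕ) (n n' : Fin L) :
    Measurable fun g : Fading M L => zfProj g S k n n' := by
  classical
  let _ : Fintype S := hS.fintype
  have hG : Continuous fun g : Fading M L => fadingMat g S k := by
    refine continuous_matrix fun n j => ?_
    simp only [fadingMat, Matrix.of_apply]
    fun_prop
  have hGe : ∀ n j, Measurable fun g : Fading M L => fadingMat g S k n j :=
    fun n j => (hG.matrix_elem n j).measurable
  have hGG : Continuous fun g : Fading M L => (fadingMat g S k)ᴴ * fadingMat g S k :=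
    hG.matrix_conjTranspose.matrix_mul hG
  have hinv : ∀ a b, Measurable fun g : Fading M L =>
      ((fadingMat g S k)ᴴ * fadingMat g S k)⁻¹ a b := by
    intro a b
    simp only [Matrix.inv_def, Ring.inverse_eq_inv', Matrix.smul_apply, smul_eq_mul]
    exact hGG.matrix_det.measurable.inv.mul (hGG.matrix_adjugate.matrix_elem a b).measurable
  simp only [zfProj, dif_pos hS]
  simp only [Matrix.sub_apply, Matrix.mul_apply, Matrix.conjTranspose_apply] at hinv ⊢
  refine measurable_const.sub (Finset.measurable_sum _ fun a _ => ?_)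
  refine (Finset.measurable_sum _ fun b _ => (hGe n b).mul (hinv b a)).mul ?_
  exact continuous_star.measurable.comp (hGe n' a)

/-- A function of a random set and of the fading is measurable if it is so for every finite set and
if it is constant on the infinite sets. -/
lemma measurable_comp_randomSet {Ω E κ : Type*} [Countable κ] [MeasurableSpace Ω]
    [MeasurableSpace E] {Γ : Type*} [MeasurableSpace Γ]
    {S : Ω → Set κ} (hS : ∀ j, MeasurableSet {ω | j ∈ S ω})
    {F : Set κ → Γ → E} (c : E) (hF : ∀ T : Set κ, T.Finite → Measurable (F T))
    (hF' : ∀ (T : Set κ), ¬ T.Finite → ∀ g, F T g = c) :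
    Measurable fun p : Ω × Γ => F (S p.1) p.2 := by
  classical
  have hT : ∀ T : Finset κ, MeasurableSet {ω | S ω = T} := by
    intro T
    have : {ω | S ω = T} = ⋂ j, {ω | j ∈ S ω ↔ j ∈ T} := by
      ext ω
      simp [Set.ext_iff]
    rw [this]
    refine MeasurableSet.iInter fun j => ?_
    by_cases h : j ∈ T
    · simpa [h] using hS j
    · simp only [h, iff_false]
      exact (hS j).compl
  -- The finite subsets of a countable type are countable in number. With all infinite sets sent to
  -- `none`, the random set becomes a discrete variable with countably many values.
  let _ : MeasurableSpace (Option (Finset κ)) := ⊤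
  let τ : Ω → Option (Finset κ) := fun ω => if h : (S ω).Finite then some h.toFinset else none
  have hsome : ∀ T : Finset κ, τ ⁻¹' {some T} = {ω | S ω = T} := by
    intro T
    ext ω
    simp only [τ, Set.mem_preimage, Set.mem_singleton_iff, Set.mem_ofPred_eq]
    constructor
    · intro h
      split_ifs at h with hfin
      rw [← Option.some_inj.1 h, hfin.coe_toFinset]
    · intro h
      have hfin : (S ω).Finite := h ▸ T.finite_toSet
      rw [dif_pos hfin]
      congr 1
      ext j
      simp [h]
  have hτ : Measurable τ := by
    refine measurable_to_countable' fun o => ?_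
    rcases o with _ | T
    · have : τ ⁻¹' {none} = (⋃ T : Finset κ, τ ⁻¹' {some T})ᶜ := by
        ext ω
        simp only [Set.mem_preimage, Set.mem_singleton_iff, Set.mem_compl_iff, Set.mem_iUnion]
        rcases τ ω with _ | T <;> simp
      rw [this]
      exact (MeasurableSet.iUnion fun T => by rw [hsome]; exact hT T).compl
    · rw [hsome]; exact hT T
  let G : Option (Finset κ) × Γ → E := fun q => match q.1 with
    | some T => F T q.2
    | none => c
  have hG : Measurable G := by
    refine measurable_from_prod_countable_right fun o => ?_
    rcases o with _ | T
    · exact measurable_const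
    · exact hF T T.finite_toSet
  have : (fun p : Ω × Γ => F (S p.1) p.2) = G ∘ fun p => (τ p.1, p.2) := by
    ext p
    simp only [Function.comp, G, τ]
    split_ifs with h
    · simp
    · exact hF' _ h _
  rw [this]
  exact hG.comp ((hτ.comp measurable_fst).prodMk measurable_snd)

variable {Ω : Type*} [MeasurableSpace Ω] {N : Deployment M Ω}

namespace Deployment

/-- All locations are measurable. -/
def IsMeasurable (N : Deployment M Ω) : Prop :=
  (∀ k, Measurable (N.bs k)) ∧ ∀ j, Measurable (N.mob j)

lemma IsMeasurable.r (hN : N.IsMeasurable) (j : Mobile M) (k : ℕ) : Measurable (N.r j k) := by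
  have h1 := hN.1 k
  have h2 := hN.2 j
  unfold Deployment.r
  fun_prop

lemma IsMeasurable.mem_near (hN : N.IsMeasurable) (D : ℝ) (k : ℕ) (j : Mobile M) :
    MeasurableSet {ω | j ∈ N.near D k ω} :=
  measurableSet_lt (hN.r j k) measurable_const

lemma encard_eq_tsum {κ : Type*} (S : Set κ) :
    (S.encard : ℝ≥0∞) = ∑' j, S.indicator (fun _ => (1 : ℝ≥0∞)) j := by
  rw [← tsum_subtype, ENNReal.tsum_set_one]

lemma measurable_encard {κ : Type*} [Countable κ] {S : Ω → Set κ}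
    (hS : ∀ j, MeasurableSet {ω | j ∈ S ω}) :
    Measurable fun ω => ((S ω).encard : ℝ≥0∞) := by
  simp_rw [encard_eq_tsum]
  exact Measurable.tsum fun j => measurable_const.indicator (hS j)

lemma IsMeasurable.active (hN : N.IsMeasurable) (L : ℕ) (D : ℝ) (k : ℕ) :
    MeasurableSet {ω | N.Active L D k ω} := by
  have h1 := measurable_encard (hN.mem_near D k)
  have h2 : Measurable fun ω => (((N.near D k ω ∪ served M k).encard : ℕ∞) : ℝ≥0∞) := by
    refine measurable_encard fun j => ?_
    by_cases h : j ∈ served M k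
    · simp [h]
    · simpa [h] using hN.mem_near D k j
  have : {ω | N.Active L D k ω} =
      {ω | ((N.near D k ω).encard : ℝ≥0∞) < (L : ℝ≥0∞)} ∪
        {ω | (((N.near D k ω ∪ served M k).encard : ℕ∞) : ℝ≥0∞) ≤ (L : ℝ≥0∞)} := by
    ext ω
    simp only [Active, Set.mem_ofPred_eq, Set.mem_union]
    rw [← ENat.toENNReal_coe L, ENat.toENNReal_lt, ENat.toENNReal_le]
  rw [this]
  exact (measurableSet_lt h1 measurable_const).union (measurableSet_le h2 measurable_const)

lemma IsMeasurable.zfVec (hN : N.IsMeasurable) (D : ℝ) (j : Mobile M) :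
    Measurable (N.zfVec L D j) := by
  have hS : ∀ l, MeasurableSet {ω | l ∈ N.near D j.1 ω \ {j}} := by
    intro l
    by_cases h : l = j
    · simp [h]
    · simpa [h] using hN.mem_near D j.1 l
  have h : ∀ n n', Measurable fun p : Ω × Fading M L =>
      zfProj p.2 (N.near D j.1 p.1 \ {j}) j.1 n n' := by
    intro n n'
    refine measurable_comp_randomSet (F := fun T g => zfProj (L := L) g T j.1 n n') hS 0
      (fun T hT => measurable_zfProj_apply hT _ _ _) fun T hT g => ?_
    rw [zfProj, dif_neg hT]
    rfl
  unfold Deployment.zfVec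
  refine (by fun_prop : Measurable (WithLp.toLp 2)).comp (measurable_pi_lambda _ fun n => ?_)
  simp only [Matrix.mulVec, dotProduct]
  refine Finset.measurable_sum _ fun n' _ => (h n n').mul ?_
  fun_prop

lemma IsMeasurable.beam (hN : N.IsMeasurable) (D : ℝ) (j : Mobile M) :
    Measurable (N.beam L D j) := by
  have h := hN.zfVec (L := L) D j
  unfold Deployment.beam
  fun_prop

lemma IsMeasurable.channel (hN : N.IsMeasurable) (α : ℝ) (j : Mobile M) (k : ℕ) :
    Measurable (N.channel L α j k) := by
  have h := hN.r j k
  unfold Deployment.channel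
  fun_prop

lemma IsMeasurable.rxPower (hN : N.IsMeasurable) (D α : ℝ) {φ : Mobile M → Ω × Fading M L → ℝ}
    (hφ : ∀ j, Measurable (φ j)) (i j : Mobile M) :
    Measurable (N.rxPower L D α φ i j) := by
  classical
  have h1 := hN.beam (L := L) D j
  have h2 := hN.channel (L := L) α i j.1
  have h3 := hφ j
  have h4 : Measurable fun p : Ω × Fading M L => if N.Active L D j.1 p.1 then (1 : ℂ) else 0 :=
    Measurable.ite (measurable_fst (hN.active L D j.1)) measurable_const measurable_const
  unfold Deployment.rxPower
  refine Measurable.pow_const (Measurable.norm (Measurable.mul (Measurable.mul ?_ ?_) ?_)) 2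
  · convert h4
  · fun_prop
  · exact h2.inner h1

lemma IsMeasurable.sinr (hN : N.IsMeasurable) (D α σ2 : ℝ) {φ : Mobile M → Ω × Fading M L → ℝ}
    (hφ : ∀ j, Measurable (φ j)) (i : Mobile M) :
    Measurable (N.sinr L D α σ2 φ i) := by
  unfold Deployment.sinr
  refine (hN.rxPower D α hφ i i).div (Measurable.add_const ?_ σ2)
  exact Measurable.tsum fun j => hN.rxPower D α hφ i j

lemma IsMeasurable.rate (hN : N.IsMeasurable) (D α σ2 : ℝ) {φ : Mobile M → Ω × Fading M L → ℝ}
    (hφ : ∀ j, Measurable (φ j)) (i : Mobile M) :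
    Measurable (N.rate L D α σ2 φ i) := by
  have h := hN.sinr D α σ2 hφ i
  unfold Deployment.rate Real.logb
  fun_prop

lemma IsMeasurable.asympRate (hN : N.IsMeasurable) (α s lam μ Pbar : ℝ)
    {φ : Mobile M → Ω × Fading M L → ℝ} (hφ : ∀ j, Measurable (φ j)) (i : Mobile M) :
    Measurable (N.asympRate L α s lam μ Pbar φ i) := by
  have h := hN.r i i.1
  have h2 := hφ i
  unfold Deployment.asympRate Real.logb
  fun_prop

end Deployment

end Measurability

/-! ### Pathwise properties of partial zero forcing -/

section Pathwise

open scoped InnerProductSpace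

lemma zfProj_congr {g g' : Fading M L} {S : Set (Mobile M)} {k : ℕ}
    (h : ∀ l ∈ S, ∀ n, g (l, k, n) = g' (l, k, n)) : zfProj g S k = zfProj g' S k := by
  have : fadingMat g S k = fadingMat g' S k := by
    ext n l
    exact h l.1 l.2 n
  unfold zfProj
  rw [this]

namespace Deployment

variable {Ω : Type*} {N : Deployment M Ω} {D : ℝ} {ω : Ω} {g : Fading M L}

/-- Either clause of activity leaves one dimension free: in the first, `𝓓_k` itself has fewer than
`L` elements; in the second, `j` is one of the at most `L` elements of `𝓓_k ∪ 𝓜_k` and is removed.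
Hence the zero-forcing projection for `j` is nontrivial. -/
lemma Active.exists_finset {j : Mobile M} (h : N.Active L D j.1 ω) :
    ∃ S : Finset (Mobile M), (S : Set (Mobile M)) = N.near D j.1 ω \ {j} ∧ S.card + 1 ≤ L := by
  have key : (N.near D j.1 ω \ {j}).encard + 1 ≤ (L : ℕ∞) := by
    rcases h with h | h
    · refine le_trans ?_ (Order.add_one_le_of_lt h)
      gcongr
      exact Set.sdiff_subset
    · have hj : j ∈ N.near D j.1 ω ∪ served M j.1 := Or.inr rfl
      rw [← Set.encard_sdiff_singleton_add_one hj] at h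
      refine le_trans ?_ h
      gcongr
      exact Set.subset_union_left
  have hfin : (N.near D j.1 ω \ {j}).Finite := by
    rw [← Set.encard_lt_top_iff]
    exact lt_of_le_of_lt (le_self_add.trans key) (ENat.natCast_lt_top L)
  refine ⟨hfin.toFinset, hfin.coe_toFinset, ?_⟩
  rw [hfin.encard_eq_coe_toFinset_card] at key
  exact_mod_cast key

lemma zfVec_eq_starProjection {j : Mobile M} (h : N.Active L D j.1 ω) (hg : GeneralPosition g) :
    N.zfVec L D j (ω, g) =
      (fadingSpan g (N.near D j.1 ω \ {j}) j.1)ᗮ.starProjection (fadingVec g j j.1) := by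
  obtain ⟨S, hS, hcard⟩ := h.exists_finset
  rw [← zfProj_mulVec_eq_starProjection (hS ▸ S.finite_toSet) (hS ▸ hg j.1 S (by omega))]
  rfl

lemma zfVec_ne_zero {j : Mobile M} (h : N.Active L D j.1 ω) (hg : GeneralPosition g) :
    N.zfVec L D j (ω, g) ≠ 0 := by
  classical
  obtain ⟨S, hS, hcard⟩ := h.exists_finset
  rw [zfVec_eq_starProjection h hg, Ne, Submodule.starProjection_apply_eq_zero_iff,
    Submodule.orthogonal_orthogonal]
  have hj : j ∉ (S : Set (Mobile M)) := by rw [hS]; simp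
  have h1 := hg j.1 (insert j S) (by rw [Finset.card_insert_of_notMem (by simpa using hj)]; omega)
  rw [Finset.coe_insert, linearIndepOn_insert hj] at h1
  rw [fadingSpan, ← hS]
  exact h1.2

lemma norm_beam_le (j : Mobile M) (p : Ω × Fading M L) : ‖N.beam L D j p‖ ≤ 1 := by
  rw [beam, norm_smul]
  simp only [Complex.norm_real, norm_inv, norm_norm]
  exact inv_mul_le_one

lemma norm_beam {j : Mobile M} (h : N.Active L D j.1 ω) (hg : GeneralPosition g) :
    ‖N.beam L D j (ω, g)‖ = 1 := by
  rw [beam, norm_smul]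
  simp only [Complex.norm_real, norm_inv, norm_norm]
  exact inv_mul_cancel₀ (norm_ne_zero_iff.2 (zfVec_ne_zero h hg))

lemma inner_beam_eq_zero {j i : Mobile M} (h : N.Active L D j.1 ω) (hg : GeneralPosition g)
    (hi : i ∈ N.near D j.1 ω) (hij : j ≠ i) :
    ⟪fadingVec g i j.1, N.beam L D j (ω, g)⟫_ℂ = 0 := by
  rw [beam, inner_smul_right, zfVec_eq_starProjection h hg,
    Submodule.inner_right_of_mem_orthogonal (K := fadingSpan g (N.near D j.1 ω \ {j}) j.1),
    mul_zero]
  · exact Submodule.subset_span ⟨i, ⟨hi, fun h => hij h.symm⟩, rfl⟩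
  · exact Submodule.starProjection_apply_mem _ _

/-- A projection is self-adjoint and idempotent, so `⟪g, Q g⟫ = ‖Q g‖²`; the normalization of the
beam divides by `‖Q g‖`. -/
lemma norm_inner_beam_self {j : Mobile M} (h : N.Active L D j.1 ω) (hg : GeneralPosition g) :
    ‖⟪fadingVec g j j.1, N.beam L D j (ω, g)⟫_ℂ‖ = ‖N.zfVec L D j (ω, g)‖ := by
  have h0 := norm_ne_zero_iff.2 (zfVec_ne_zero h hg)
  set K := fadingSpan g (N.near D j.1 ω \ {j}) j.1
  have h1 : ⟪fadingVec g j j.1, Kᗮ.starProjection (fadingVec g j j.1)⟫_ℂ =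
      ⟪Kᗮ.starProjection (fadingVec g j j.1), Kᗮ.starProjection (fadingVec g j j.1)⟫_ℂ := by
    rw [← Submodule.inner_starProjection_left_eq_right Kᗮ (Kᗮ.starProjection _),
      Submodule.starProjection_eq_self_iff.2 (Submodule.starProjection_apply_mem _ _),
      Submodule.inner_starProjection_left_eq_right]
  rw [beam, inner_smul_right]
  conv_lhs => rw [zfVec_eq_starProjection h hg, h1, ← zfVec_eq_starProjection h hg]
  rw [inner_self_eq_norm_sq_to_K]
  simp only [norm_mul, Complex.norm_real, norm_inv, norm_norm, norm_pow, Complex.coe_algebraMap]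
  field_simp

open Classical in
lemma rxPower_eq (α : ℝ) (φ : Mobile M → Ω × Fading M L → ℝ) (i j : Mobile M) :
    N.rxPower L D α φ i j (ω, g) = if N.Active L D j.1 ω then
      N.r i j.1 ω ^ (-α) * φ j (ω, g) ^ 2 * ‖⟪fadingVec g i j.1, N.beam L D j (ω, g)⟫_ℂ‖ ^ 2
      else 0 := by
  have hr : 0 ≤ N.r i j.1 ω := dist_nonneg
  rw [rxPower, channel, inner_smul_left]
  split_ifs with h
  · simp only [one_mul, norm_mul, Complex.norm_real, RCLike.norm_conj, mul_pow,
      Real.norm_eq_abs, sq_abs]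
    rw [← Real.rpow_mul_natCast hr]
    push_cast
    rw [show -(α / 2) * 2 = -α by ring]
    ring
  · simp

lemma rxPower_nonneg (α : ℝ) (φ : Mobile M → Ω × Fading M L → ℝ) (i j : Mobile M)
    (p : Ω × Fading M L) : 0 ≤ N.rxPower L D α φ i j p := by
  unfold rxPower
  positivity

lemma rxPower_eq_zero (α : ℝ) (φ : Mobile M → Ω × Fading M L → ℝ) {i j : Mobile M}
    (hg : GeneralPosition g) (hi : i ∈ N.near D j.1 ω) (hij : j ≠ i) :
    N.rxPower L D α φ i j (ω, g) = 0 := by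
  rw [rxPower_eq]
  split_ifs with h
  · rw [inner_beam_eq_zero h hg hi hij]; simp
  · rfl

lemma rxPower_self (α : ℝ) (φ : Mobile M → Ω × Fading M L → ℝ) {i : Mobile M}
    (hg : GeneralPosition g) (h : N.Active L D i.1 ω) :
    N.rxPower L D α φ i i (ω, g) =
      N.r i i.1 ω ^ (-α) * φ i (ω, g) ^ 2 * ‖N.zfVec L D i (ω, g)‖ ^ 2 := by
  rw [rxPower_eq, if_pos h, norm_inner_beam_self h hg]

lemma rxPower_le (α : ℝ) (φ : Mobile M → Ω × Fading M L → ℝ) (i j : Mobile M) :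
    N.rxPower L D α φ i j (ω, g) ≤
      N.r i j.1 ω ^ (-α) * φ j (ω, g) ^ 2 * ‖fadingVec g i j.1‖ ^ 2 := by
  have hr : 0 ≤ N.r i j.1 ω := dist_nonneg
  rw [rxPower_eq]
  split_ifs with h
  · gcongr
    refine (norm_inner_le_norm _ _).trans ?_
    exact mul_le_of_le_one_right (norm_nonneg _) (norm_beam_le _ _)
  · positivity

/-- The beamforming vectors do not depend on the fading vector between BS `k` and a mobile which
is neither served by `k` nor close to `k`. -/
lemma beam_refresh {i : Mobile M} {k : ℕ} (hi : i ∉ N.near D k ω) (hik : i.1 ≠ k)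
    (v : EuclideanSpace ℂ (Fin L)) (j : Mobile M) :
    N.beam L D j (ω, refresh g i k v) = N.beam L D j (ω, g) := by
  have h : N.zfVec L D j (ω, refresh g i k v) = N.zfVec L D j (ω, g) := by
    have hent : ∀ l n, l ∈ N.near D j.1 ω ∨ l = j →
        refresh g i k v (l, j.1, n) = g (l, j.1, n) := by
      intro l n hl
      simp only [refresh]
      rw [if_neg]
      rintro ⟨rfl, rfl⟩
      rcases hl with hl | rfl
      · exact hi hl
      · exact hik rfl
    unfold zfVec
    rw [zfProj_congr (g' := g) fun l hl n => hent l n (Or.inl hl.1)]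
    simp only [hent j _ (Or.inr rfl)]
  rw [beam, beam, h]

/-- The restriction on the channel state information enters the proof here only: the vector from BS
`k` to a mobile outside `𝓓_k ∪ 𝓜_k` is unknown to the allocation and may be resampled without
changing any power. -/
lemma IsPowerAllocation.refresh_eq [MeasurableSpace Ω] {Pr : Measure Ω} {P : ℝ}
    {φ : Mobile M → Ω × Fading M L → ℝ} (hφ : N.IsPowerAllocation Pr L D P φ) {i : Mobile M} {k : ℕ}
    (hi : i ∉ N.near D k ω) (hik : i.1 ≠ k) (v : EuclideanSpace ℂ (Fin L)) (j : Mobile M) :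
    φ j (ω, refresh g i k v) = φ j (ω, g) := by
  refine hφ.csi ω _ _ (fun k' l hl n => ?_) j
  simp only [refresh]
  rw [if_neg]
  rintro ⟨rfl, rfl⟩
  rcases hl with hl | hl
  · exact hi hl
  · exact hik hl

end Deployment

end Pathwise

end Cellular

namespace Cellular

/-! ### The path loss function -/

/-- Path loss `‖x‖^{-α}` outside of the disc of radius `D`. -/
def pathLoss (α D : ℝ) (x : Plane) : ℝ≥0∞ :=
  {x : Plane | D ≤ ‖x‖}.indicator (fun x => ENNReal.ofReal (‖x‖ ^ (-α))) x

lemma measurableSet_le_norm (D : ℝ) : MeasurableSet {x : Plane | D ≤ ‖x‖} :=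
  measurableSet_le measurable_const measurable_norm

@[fun_prop]
lemma measurable_pathLoss (α D : ℝ) : Measurable (pathLoss α D) := by
  unfold pathLoss
  exact Measurable.indicator (by fun_prop) (measurableSet_le_norm D)

lemma pathLoss_of_le {α D : ℝ} {x : Plane} (h : D ≤ ‖x‖) :
    pathLoss α D x = ENNReal.ofReal (‖x‖ ^ (-α)) :=
  Set.indicator_of_mem (s := {x : Plane | D ≤ ‖x‖}) h _

lemma pathLoss_of_lt {α D : ℝ} {x : Plane} (h : ‖x‖ < D) : pathLoss α D x = 0 :=
  Set.indicator_of_notMem (s := {x : Plane | D ≤ ‖x‖}) (not_le.2 h) _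

lemma pathLoss_le {α D : ℝ} (hα : 0 ≤ α) (hD : 0 < D) (x : Plane) :
    pathLoss α D x ≤ ENNReal.ofReal (D ^ (-α)) := by
  rcases le_or_gt D ‖x‖ with h | h
  · rw [pathLoss_of_le h]
    exact ENNReal.ofReal_le_ofReal (Real.rpow_le_rpow_of_nonpos hD h (by linarith))
  · rw [pathLoss_of_lt h]
    exact zero_le

/-- In polar coordinates this is `2π ∫_D^∞ r^(1-α) dr`, which converges as `α > 2`. -/
lemma lintegral_pathLoss {α D : ℝ} (hα : 2 < α) (hD : 0 < D) :
    ∫⁻ x, pathLoss α D x = ENNReal.ofReal (2 * Real.pi / (α - 2) * D ^ (2 - α)) := by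
  set f : ℝ → ℝ := (Set.Ici D).indicator fun y => y ^ (-α) with hf
  have hpt : ∀ x : Plane, pathLoss α D x = ENNReal.ofReal (f ‖x‖) := by
    intro x
    rcases le_or_gt D ‖x‖ with h | h
    · rw [pathLoss_of_le h, hf, Set.indicator_of_mem (Set.mem_Ici.2 h)]
    · rw [pathLoss_of_lt h, hf, Set.indicator_of_notMem (by simpa using h), ENNReal.ofReal_zero]
  have hf0 : ∀ y, 0 ≤ f y := fun y => Set.indicator_nonneg
    (fun z hz => Real.rpow_nonneg (hD.le.trans hz) _) y
  have e1 : ∀ y : ℝ, y ^ (Module.finrank ℝ Plane - 1) • f y =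
      (Set.Ici D).indicator (fun y => y ^ (1 - α)) y := by
    intro y
    by_cases hy : y ∈ Set.Ici D
    · have hy0 : 0 < y := hD.trans_le hy
      rw [hf, Set.indicator_of_mem hy, Set.indicator_of_mem hy, smul_eq_mul,
        finrank_euclideanSpace, Fintype.card_fin, Real.rpow_sub hy0, Real.rpow_neg hy0.le]
      simp [div_eq_mul_inv]
    · rw [hf, Set.indicator_of_notMem hy, Set.indicator_of_notMem hy, smul_zero]
  have hIci : Set.Ioi (0 : ℝ) ∩ Set.Ici D = Set.Ici D :=
    Set.inter_eq_right.2 fun y hy => hD.trans_le hy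
  have hint : Integrable (fun x : Plane => f ‖x‖) := by
    rw [integrable_fun_norm_addHaar]
    simp_rw [e1]
    rw [IntegrableOn, integrable_indicator_iff measurableSet_Ici, IntegrableOn,
      Measure.restrict_restrict measurableSet_Ici, Set.inter_comm, hIci]
    exact (integrableOn_Ici_iff_integrableOn_Ioi (by simp)).2
      (integrableOn_Ioi_rpow_of_lt (by linarith) hD)
  simp_rw [hpt]
  rw [← ofReal_integral_eq_lintegral_ofReal hint (Eventually.of_forall fun x => hf0 _),
    integral_fun_norm_addHaar]
  simp_rw [e1]
  rw [integral_indicator measurableSet_Ici, Measure.restrict_restrict measurableSet_Ici,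
    Set.inter_comm, hIci, integral_Ici_eq_integral_Ioi,
    integral_Ioi_rpow_of_lt (by linarith) hD, measureReal_def,
    EuclideanSpace.volume_ball_fin_two, finrank_euclideanSpace, Fintype.card_fin]
  congr 1
  have h2 : (1 : ℝ) - α + 1 = 2 - α := by ring
  have h3 : (2 : ℝ) - α ≠ 0 := by linarith
  have h4 : α - 2 ≠ 0 := by linarith
  have h5 : (ENNReal.ofReal Real.pi).toReal = Real.pi := ENNReal.toReal_ofReal Real.pi_pos.le
  rw [h2]
  simp [h5]
  field_simp
  ring

lemma volume_ball_plane (x : Plane) {ρ : ℝ} (hρ : 0 ≤ ρ) :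
    volume (Metric.ball x ρ) = ENNReal.ofReal (Real.pi * ρ ^ 2) := by
  rw [EuclideanSpace.volume_ball_fin_two, mul_comm Real.pi, ENNReal.ofReal_mul (by positivity),
    ENNReal.ofReal_pow hρ]

/-! ### Numbers of mobiles in discs -/

lemma tsum_eq_add_tsum_ne {κ : Type*} [DecidableEq κ] (a : κ) (f : κ → ℝ≥0∞) :
    ∑' k, f k = f a + ∑' k : {k // k ≠ a}, f k := by
  rw [← ENNReal.summable.tsum_add_tsum_compl (s := {a}) ENNReal.summable, tsum_singleton]
  rfl

variable {M : ℕ} {Ω : Type*} [MeasurableSpace Ω] {Pr : Measure Ω} {N : Deployment M Ω}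
  {lam R : ℝ} {i : Mobile M}

namespace Deployment

/-- The locations of the BSs other than the one that serves mobile `i`. -/
def others (N : Deployment M Ω) (i : Mobile M) (k : {k : ℕ // k ≠ i.1}) : Ω → Plane := N.bs k

/-- The configurations in which the typical mobile is at the origin and the mobiles are near to the
BSs that serve them. -/
def Regular (N : Deployment M Ω) (R : ℝ) (i : Mobile M) (ω : Ω) : Prop :=
  N.mob i ω = 0 ∧ ∀ j : Mobile M, N.r j j.1 ω ≤ R

lemma IsTypical.isMeasurable (hN : N.IsTypical Pr lam R i) : N.IsMeasurable :=
  ⟨hN.measurable_bs, hN.measurable_mob⟩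

lemma IsTypical.ae_regular (hN : N.IsTypical Pr lam R i) : ∀ᵐ ω ∂Pr, N.Regular R i ω := by
  filter_upwards [hN.origin, hN.dist_le] with ω h1 h2
  exact ⟨h1, h2⟩

lemma Regular.r_eq {ω : Ω} (h : N.Regular R i ω) (k : ℕ) : N.r i k ω = ‖N.bs k ω‖ := by
  rw [r, h.1, dist_zero_left]

lemma encard_near_eq (D : ℝ) (k : ℕ) (ω : Ω) :
    ((N.near D k ω).encard : ℝ≥0∞) =
      ∑' l, ∑ m : Fin M, (N.near D k ω).indicator (fun _ => (1 : ℝ≥0∞)) (l, m) := by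
  rw [encard_eq_tsum, ENNReal.tsum_prod']
  simp_rw [tsum_fintype]

/-- A mobile within `D` of BS `k` is served by a BS within `D + R` of it, and each BS serves `M`
mobiles. The summand 1 stands for the BS of mobile `i`, which is not part of the Poisson process. -/
lemma Regular.encard_near_le {ω : Ω} (h : N.Regular R i ω) (D : ℝ) (k : ℕ) :
    ((N.near D k ω).encard : ℝ≥0∞) ≤
      M * (1 + pointCount (N.others i) (Metric.ball (N.bs k ω) (D + R)) ω) := by
  have sum_indicator_le : ∀ l : ℕ,
      ∑ m : Fin M, (N.near D k ω).indicator (fun _ => (1 : ℝ≥0∞)) (l, m) ≤ M := by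
    intro l
    refine (Finset.sum_le_sum (g := fun _ => (1 : ℝ≥0∞)) fun m _ => ?_).trans (by simp)
    exact Set.indicator_apply_le' (fun _ => le_rfl) (fun _ => zero_le)
  rw [encard_near_eq, tsum_eq_add_tsum_ne i.1, mul_add, mul_one, pointCount,
    ← ENNReal.tsum_mul_left]
  refine add_le_add ?_ (ENNReal.tsum_le_tsum fun l => ?_)
  · exact sum_indicator_le i.1
  · by_cases hl : N.others i l ω ∈ Metric.ball (N.bs k ω) (D + R)
    · rw [Set.indicator_of_mem hl]
      rw [mul_one]
      exact sum_indicator_le l.1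
    · rw [Set.indicator_of_notMem hl, mul_zero]
      refine (Finset.sum_eq_zero fun m _ => Set.indicator_of_notMem (fun hm => hl ?_) _).le
      have h1 : dist (N.mob (l, m) ω) (N.bs k ω) < D := hm
      have h2 : dist (N.mob (l, m) ω) (N.bs l ω) ≤ R := h.2 (l, m)
      rw [Metric.mem_ball, others]
      have := dist_triangle_left (N.bs l ω) (N.bs k ω) (N.mob (l, m) ω)
      linarith

/-- The path from a mobile to its BS, to the origin and to the BS of mobile `i` costs at most `R` at
either end, whence the margin `2R`. -/
lemma Regular.le_encard_near {ω : Ω} (h : N.Regular R i ω) (D : ℝ) :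
    M * pointCount (N.others i) (Metric.ball 0 (D - 2 * R)) ω ≤
      ((N.near D i.1 ω).encard : ℝ≥0∞) := by
  rw [encard_near_eq, tsum_eq_add_tsum_ne i.1, pointCount, ← ENNReal.tsum_mul_left]
  refine le_trans (ENNReal.tsum_le_tsum fun l => ?_) le_add_self
  by_cases hl : N.others i l ω ∈ Metric.ball 0 (D - 2 * R)
  · rw [Set.indicator_of_mem hl]
    have : ∀ m : Fin M, (l.1, m) ∈ N.near D i.1 ω := by
      intro m
      have h2 : dist (N.mob (l, m) ω) (N.bs l ω) ≤ R := h.2 (l, m)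
      have h3 : dist (N.mob i ω) (N.bs i.1 ω) ≤ R := h.2 i
      rw [h.1] at h3
      rw [Metric.mem_ball, others] at hl
      have h4 := dist_triangle4 (N.mob (l, m) ω) (N.bs l ω) 0 (N.bs i.1 ω)
      change dist (N.mob (l, m) ω) (N.bs i.1 ω) < D
      linarith
    simp [Set.indicator_of_mem (this _)]
  · rw [Set.indicator_of_notMem hl, mul_zero]
    exact zero_le

lemma encard_near_le_of_not_active {L : ℕ} {D : ℝ} {k : ℕ} {ω : Ω} (h : ¬ N.Active L D k ω) :
    (L : ℝ≥0∞) ≤ ((N.near D k ω).encard : ℝ≥0∞) := by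
  rw [Active, not_or, not_lt] at h
  rw [← ENat.toENNReal_coe L]
  exact ENat.toENNReal_le.2 h.1

/-- The number of mobiles other than `i` at distance less than `D` of the BS that serves `i`. -/
def nearCount (N : Deployment M Ω) (D : ℝ) (i : Mobile M) (ω : Ω) : ℝ :=
  ((N.near D i.1 ω \ {i}).encard : ℝ≥0∞).toReal

lemma IsMeasurable.nearCount (hN : N.IsMeasurable) (D : ℝ) (i : Mobile M) :
    Measurable (N.nearCount D i) := by
  refine ENNReal.measurable_toReal.comp (measurable_encard fun l => ?_)
  by_cases h : l = i
  · simp [h]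
  · simpa [h] using hN.mem_near D i.1 l

lemma encard_near_le_add_one (D : ℝ) (i : Mobile M) (ω : Ω) :
    ((N.near D i.1 ω).encard : ℝ≥0∞) ≤ ((N.near D i.1 ω \ {i}).encard : ℝ≥0∞) + 1 := by
  have h : (N.near D i.1 ω).encard ≤ (N.near D i.1 ω \ {i}).encard + 1 := by
    refine (Set.encard_le_encard (t := insert i (N.near D i.1 ω \ {i})) ?_).trans
      (Set.encard_insert_le _ _)
    intro j hj
    by_cases h : j = i
    · exact Or.inl h
    · exact Or.inr ⟨hj, h⟩
  exact_mod_cast ENat.toENNReal_le.2 h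

/-- Recentring the discs from the BS of mobile `i` to the origin costs another `R` in the upper
bound; the `-1` in the lower bound accounts for mobile `i` itself. Finiteness ensures that
`nearCount` is a true cardinality and not the default value of `toReal`. -/
lemma Regular.nearCount_bounds {ω : Ω} (h : N.Regular R i ω) {D : ℝ}
    (h1 : pointCount (N.others i) (Metric.ball 0 (D + 2 * R)) ω ≠ ∞) :
    (N.near D i.1 ω \ {i}).Finite ∧
    N.nearCount D i ω ≤
      M * (1 + (pointCount (N.others i) (Metric.ball 0 (D + 2 * R)) ω).toReal) ∧
    M * (pointCount (N.others i) (Metric.ball 0 (D - 2 * R)) ω).toReal - 1 ≤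
      N.nearCount D i ω := by
  have h3 : dist (N.mob i ω) (N.bs i.1 ω) ≤ R := h.2 i
  rw [h.1] at h3
  have hsub : Metric.ball (N.bs i.1 ω) (D + R) ⊆ Metric.ball 0 (D + 2 * R) := by
    refine Metric.ball_subset_ball' ?_
    rw [dist_comm]
    linarith
  have hle : ((N.near D i.1 ω \ {i}).encard : ℝ≥0∞) ≤
      M * (1 + pointCount (N.others i) (Metric.ball 0 (D + 2 * R)) ω) := by
    calc ((N.near D i.1 ω \ {i}).encard : ℝ≥0∞) ≤ ((N.near D i.1 ω).encard : ℝ≥0∞) :=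
          ENat.toENNReal_le.2 (Set.encard_le_encard Set.sdiff_subset)
      _ ≤ _ := h.encard_near_le D i.1
      _ ≤ _ := by gcongr; exact pointCount_mono hsub ω
  have hfin : (M : ℝ≥0∞) * (1 + pointCount (N.others i) (Metric.ball 0 (D + 2 * R)) ω) ≠ ∞ := by
    finiteness
  have hfin2 : ((N.near D i.1 ω \ {i}).encard : ℝ≥0∞) ≠ ∞ := ne_top_of_le_ne_top hfin hle
  refine ⟨?_, ?_, ?_⟩
  · rw [← Set.encard_lt_top_iff, lt_top_iff_ne_top]
    rintro h
    simp [h] at hfin2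
  · have := ENNReal.toReal_mono hfin hle
    rw [ENNReal.toReal_mul, ENNReal.toReal_add (by simp) h1] at this
    simpa [nearCount] using this
  · have hge := (h.le_encard_near D).trans (encard_near_le_add_one D i ω)
    have := ENNReal.toReal_mono (by finiteness) hge
    rw [ENNReal.toReal_mul, ENNReal.toReal_add hfin2 (by simp)] at this
    simp only [ENNReal.toReal_natCast, ENNReal.toReal_one] at this
    rw [nearCount]
    linarith

end Deployment

end Cellular

/-! ### Fluctuations of the number of mobiles near the serving base station -/

namespace Cellular

variable {M : ℕ} {Ω : Type*} [MeasurableSpace Ω] {Pr : Measure Ω} {N : Deployment M Ω}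
  {lam R : ℝ} {i : Mobile M}

namespace Deployment

lemma IsTypical.radius_nonneg [IsProbabilityMeasure Pr] (hN : N.IsTypical Pr lam R i) : 0 ≤ R := by
  obtain ⟨ω, hω⟩ := hN.dist_le.exists
  exact dist_nonneg.trans (hω i)

lemma IsTypical.isHPPP (hN : N.IsTypical Pr lam R i) : IsHPPP Pr lam (N.others i) := hN.hppp

lemma IsTypical.ae_pointCount_ne_top (hN : N.IsTypical Pr lam R i) (hlam : 0 ≤ lam) (ρ : ℝ) :
    ∀ᵐ ω ∂Pr, pointCount (N.others i) (Metric.ball 0 ρ) ω ≠ ∞ := by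
  have h := ae_lt_top (hN.isHPPP.measurable_pointCount (B := Metric.ball 0 ρ) measurableSet_ball) (by
    rw [hN.isHPPP.lintegral_pointCount hlam measurableSet_ball measure_ball_lt_top.ne]
    exact ENNReal.mul_ne_top ENNReal.ofReal_ne_top measure_ball_lt_top.ne)
  filter_upwards [h] with ω hω using hω.ne

/-- The count is squeezed between affine functions of the Poisson counts in discs of radii `D - 2R`
and `D + 2R`. Their variances are `O(D²)`, and their means differ from the target by `O(D)`, because
an annulus of fixed width has area `O(D)`. -/
lemma IsTypical.exists_lintegral_nearCount_le [IsProbabilityMeasure Pr]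
    (hN : N.IsTypical Pr lam R i) (hlam : 0 ≤ lam) :
    ∃ K : ℝ, 0 ≤ K ∧ ∀ D : ℝ, 1 ≤ D → 2 * R ≤ D →
      ∫⁻ ω, ENNReal.ofReal ((N.nearCount D i ω - lam * Real.pi * M * D ^ 2) ^ 2) ∂Pr ≤
        ENNReal.ofReal (K * D ^ 2) := by
  have hR := hN.radius_nonneg
  set q := lam * Real.pi with hq
  have hq0 : 0 ≤ q := by positivity
  set B := (M : ℝ) + 1 + M * q * (4 * R + 4 * R ^ 2) with hB
  have hB0 : 0 ≤ B := by positivity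
  -- The three summands bound the two Poisson variances and the squared offset of the means, which
  -- is at most `(B D)²`; the 3 comes from `(x + y + z)² ≤ 3(x² + y² + z²)`.
  refine ⟨3 * (M ^ 2 * (q * (1 + 2 * R) ^ 2) + M ^ 2 * q + B ^ 2), by positivity,
    fun D hD1 hD2 => ?_⟩
  set b₁ := Metric.ball (0 : Plane) (D + 2 * R)
  set b₂ := Metric.ball (0 : Plane) (D - 2 * R)
  have hv1 : lam * (volume b₁).toReal = q * (D + 2 * R) ^ 2 := by
    rw [volume_ball_plane _ (by positivity), ENNReal.toReal_ofReal (by positivity)]; ring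
  have hv2 : lam * (volume b₂).toReal = q * (D - 2 * R) ^ 2 := by
    rw [volume_ball_plane _ (by linarith), ENNReal.toReal_ofReal (by positivity)]; ring
  have hE1 := hN.isHPPP.lintegral_pointCount_sub_sq hlam (B := b₁) measurableSet_ball
    measure_ball_lt_top.ne
  have hE2 := hN.isHPPP.lintegral_pointCount_sub_sq hlam (B := b₂) measurableSet_ball
    measure_ball_lt_top.ne
  rw [← ENNReal.ofReal_toReal (a := volume b₁) measure_ball_lt_top.ne, ← ENNReal.ofReal_mul hlam,
    ENNReal.toReal_ofReal ENNReal.toReal_nonneg, hv1] at hE1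
  rw [← ENNReal.ofReal_toReal (a := volume b₂) measure_ball_lt_top.ne, ← ENNReal.ofReal_mul hlam,
    ENNReal.toReal_ofReal ENNReal.toReal_nonneg, hv2] at hE2
  have hm1 := hN.isHPPP.measurable_pointCount (B := b₁) measurableSet_ball
  have hm2 := hN.isHPPP.measurable_pointCount (B := b₂) measurableSet_ball
  have hpt : ∀ᵐ ω ∂Pr,
      ENNReal.ofReal ((N.nearCount D i ω - q * M * D ^ 2) ^ 2) ≤
      ENNReal.ofReal (3 * M ^ 2) * ENNReal.ofReal
        (((pointCount (N.others i) b₁ ω).toReal - q * (D + 2 * R) ^ 2) ^ 2) +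
      ENNReal.ofReal (3 * M ^ 2) * ENNReal.ofReal
        (((pointCount (N.others i) b₂ ω).toReal - q * (D - 2 * R) ^ 2) ^ 2) +
      ENNReal.ofReal (3 * (B * D) ^ 2) := by
    filter_upwards [hN.ae_regular, hN.ae_pointCount_ne_top hlam (D + 2 * R)] with ω hω h1
    obtain ⟨-, hle, hge⟩ := hω.nearCount_bounds h1
    rw [← ENNReal.ofReal_mul (by positivity), ← ENNReal.ofReal_mul (by positivity),
      ← ENNReal.ofReal_add (by positivity) (by positivity),
      ← ENNReal.ofReal_add (by positivity) (by positivity)]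
    refine ENNReal.ofReal_le_ofReal ?_
    set V₁ := (pointCount (N.others i) b₁ ω).toReal
    set V₂ := (pointCount (N.others i) b₂ ω).toReal
    set n := N.nearCount D i ω
    set x := M * (V₁ - q * (D + 2 * R) ^ 2)
    set y := M * (V₂ - q * (D - 2 * R) ^ 2)
    have hMq : 0 ≤ M * q := by positivity
    have hBD : (M : ℝ) + 1 + M * q * (4 * R * D + 4 * R ^ 2) ≤ B * D := by
      have h1 : (M : ℝ) + 1 ≤ (M + 1) * D := le_mul_of_one_le_right (by positivity) hD1
      have h2 : M * q * (4 * R ^ 2) ≤ M * q * (4 * R ^ 2) * D :=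
        le_mul_of_one_le_right (by positivity) hD1
      rw [hB]
      nlinarith
    have hMqR : 0 ≤ M * q * (4 * R ^ 2) := by positivity
    have hu : n - q * M * D ^ 2 ≤ x + B * D := by
      have : x = M * V₁ - M * q * D ^ 2 - M * q * (4 * R * D + 4 * R ^ 2) := by
        simp only [x]; ring
      rw [this]
      linarith
    have hl : y - B * D ≤ n - q * M * D ^ 2 := by
      have : y = M * V₂ - M * q * D ^ 2 + M * q * (4 * R * D + 4 * R ^ 2) - 
          2 * (M * q * (4 * R ^ 2)) := by
        simp only [y]; ring
      rw [this]
      linarith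
    have habs : |n - q * M * D ^ 2| ≤ |x| + |y| + |B * D| := by
      rw [abs_le]
      constructor
      · have := neg_abs_le y; have := abs_nonneg x; have := le_abs_self (B * D); linarith
      · have := le_abs_self x; have := abs_nonneg y; have := le_abs_self (B * D); linarith
    have hsq : (n - q * M * D ^ 2) ^ 2 ≤ 3 * (x ^ 2 + y ^ 2 + (B * D) ^ 2) := by
      rw [← sq_abs (n - _), ← sq_abs x, ← sq_abs y, ← sq_abs (B * D)]
      have h3 : |n - q * M * D ^ 2| ^ 2 ≤ (|x| + |y| + |B * D|) ^ 2 := by gcongr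
      nlinarith [sq_nonneg (|x| - |y|), sq_nonneg (|x| - |B * D|), sq_nonneg (|y| - |B * D|)]
    refine hsq.trans (le_of_eq ?_)
    simp only [x, y]
    ring
  refine (lintegral_mono_ae hpt).trans ?_
  rw [lintegral_add_right _ measurable_const, lintegral_add_right _ (by fun_prop),
    lintegral_const_mul _ (by fun_prop), lintegral_const_mul _ (by fun_prop), hE1, hE2,
    lintegral_const, measure_univ, mul_one, ← ENNReal.ofReal_mul (by positivity),
      ← ENNReal.ofReal_mul (by positivity), ← ENNReal.ofReal_add (by positivity) (by positivity),
      ← ENNReal.ofReal_add (by positivity) (by positivity)]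
  refine ENNReal.ofReal_le_ofReal ?_
  have h1 : D + 2 * R ≤ (1 + 2 * R) * D := by nlinarith
  have h2 : (D + 2 * R) ^ 2 ≤ ((1 + 2 * R) * D) ^ 2 := by gcongr
  have h3 : (D - 2 * R) ^ 2 ≤ D ^ 2 := pow_le_pow_left₀ (by linarith) (by linarith) 2
  calc _ ≤ 3 * (M : ℝ) ^ 2 * (q * ((1 + 2 * R) * D) ^ 2) + 3 * M ^ 2 * (q * D ^ 2) +
        3 * (B * D) ^ 2 := by gcongr
    _ = _ := by ring

/-- A BS which is near to the typical mobile is active with high probability. -/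
lemma IsTypical.measure_not_active_le [IsProbabilityMeasure Pr]
    (hN : N.IsTypical Pr lam R i) (hlam : 0 ≤ lam) {D c : ℝ} {L : ℕ}
    (hL : lam * Real.pi * M * D ^ 2 = (1 - c) * L) (hL2 : 2 ≤ c * L) :
    Pr {ω | ¬ N.Active L D i.1 ω} ≤ ENNReal.ofReal (4 / (c * L) ^ 2) *
      ∫⁻ ω, ENNReal.ofReal ((N.nearCount D i ω - lam * Real.pi * M * D ^ 2) ^ 2) ∂Pr := by
  have hset : MeasurableSet {ω | ¬ N.Active L D i.1 ω} :=
    (hN.isMeasurable.active L D i.1).compl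
  rw [← lintegral_indicator_one hset, ← lintegral_const_mul' _ _ ENNReal.ofReal_ne_top]
  refine lintegral_mono_ae ?_
  filter_upwards [hN.ae_regular, hN.ae_pointCount_ne_top hlam (D + 2 * R)] with ω hω h1
  by_cases h : N.Active L D i.1 ω
  · rw [Set.indicator_of_notMem (by simpa using h)]
    exact zero_le
  · obtain ⟨hfin, -, -⟩ := hω.nearCount_bounds h1
    rw [Set.indicator_of_mem (by simpa using h), ← ENNReal.ofReal_mul (by positivity)]
    have h3 := (encard_near_le_of_not_active h).trans (encard_near_le_add_one D i ω)
    have hne : ((N.near D i.1 ω \ {i}).encard : ℝ≥0∞) ≠ ∞ := by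
      simpa using hfin
    have h4 := ENNReal.toReal_mono (by finiteness) h3
    rw [ENNReal.toReal_add hne (by simp), ENNReal.toReal_natCast, ENNReal.toReal_one] at h4
    have h5 : (L : ℝ) ≤ N.nearCount D i ω + 1 := h4
    simp only [Pi.one_apply, ENNReal.one_le_ofReal]
    rw [hL]
    -- Inactivity forces at least `L - 1` other mobiles nearby, which exceeds `(1 - c) L` by `c L -
    -- 1 ≥ c L / 2`. Chebyshev's inequality then has the factor `4/(c L)²`.
    have h6 : c * L / 2 ≤ N.nearCount D i ω - (1 - c) * L := by linarith
    have h7 : (c * L / 2) ^ 2 ≤ (N.nearCount D i ω - (1 - c) * L) ^ 2 := by gcongr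
    have h8 : 0 < c * L := by linarith
    rw [div_mul_eq_mul_div, le_div_iff₀ (by positivity)]
    linarith

/-! ### Inactive base stations -/

/-- A shift by less than `D / 2` at most doubles the norm of a point outside the disc of radius `D`,
and leaves the point outside the disc of radius `D / 2`. -/
lemma pathLoss_le_of_dist_lt {α D : ℝ} (hα : 0 ≤ α) (hD : 0 < D) {x y : Plane}
    (h : dist x y < D / 2) :
    pathLoss α D x ≤ ENNReal.ofReal (2 ^ α) * pathLoss α (D / 2) y := by
  rcases le_or_gt D ‖x‖ with hx | hx
  · have h1 : ‖y‖ ≤ 2 * ‖x‖ ∧ D / 2 ≤ ‖y‖ := by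
      rw [dist_eq_norm] at h
      have h2 := norm_sub_norm_le x y
      have h3 := norm_sub_norm_le y x
      rw [norm_sub_rev] at h3
      constructor <;> linarith
    rw [pathLoss_of_le hx, pathLoss_of_le h1.2, ← ENNReal.ofReal_mul (by positivity)]
    refine ENNReal.ofReal_le_ofReal ?_
    have hy : 0 < ‖y‖ := by linarith [h1.2]
    calc ‖x‖ ^ (-α) ≤ (‖y‖ / 2) ^ (-α) :=
          Real.rpow_le_rpow_of_nonpos (by positivity) (by linarith [h1.1]) (by linarith)
      _ = _ := by
          rw [Real.div_rpow hy.le (by norm_num), Real.rpow_neg (by norm_num : (0 : ℝ) ≤ 2),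
            div_inv_eq_mul, mul_comm]
  · rw [pathLoss_of_lt hx]
    exact zero_le

lemma measurable_indicator_ball {Y : Ω → Plane} (hY : Measurable Y) (ρ : ℝ) :
    Measurable fun p : Ω × Plane =>
      (Metric.ball p.2 ρ).indicator (fun _ => (1 : ℝ≥0∞)) (Y p.1) := by
  have : (fun p : Ω × Plane => (Metric.ball p.2 ρ).indicator (fun _ => (1 : ℝ≥0∞)) (Y p.1)) =
      {p : Ω × Plane | dist (Y p.1) p.2 < ρ}.indicator (fun _ => 1) := by
    ext p
    by_cases h : dist (Y p.1) p.2 < ρ <;> simp [Set.indicator, h]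
  rw [this]
  refine measurable_const.indicator (measurableSet_lt ?_ measurable_const)
  fun_prop

lemma measurable_pointCount_ball {ι : Type*} [Countable ι] {X : ι → Ω → Plane}
    (hX : ∀ k, Measurable (X k)) (ρ : ℝ) :
    Measurable fun p : Ω × Plane => pointCount X (Metric.ball p.2 ρ) p.1 :=
  Measurable.tsum fun k => measurable_indicator_ball (hX k) ρ

/-- The event that the disc of radius `b` around `y` has at least `t` points. -/
def overcrowded {ι : Type*} (X : ι → Ω → Plane) (t b : ℝ) (y : Plane) : Set Ω :=
  {ω | ENNReal.ofReal t ≤ pointCount X (Metric.ball y b) ω}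

lemma measurable_indicator_overcrowded {ι : Type*} [Countable ι] {X : ι → Ω → Plane}
    (hX : ∀ k, Measurable (X k)) (t b : ℝ) :
    Measurable fun p : Ω × Plane => (overcrowded X t b p.2).indicator (fun _ => (1 : ℝ≥0∞)) p.1 := by
  have h : MeasurableSet
      {p : Ω × Plane | ENNReal.ofReal t ≤ pointCount X (Metric.ball p.2 b) p.1} :=
    measurableSet_le measurable_const (measurable_pointCount_ball hX b)
  have e : (fun p : Ω × Plane => (overcrowded X t b p.2).indicator (fun _ => (1 : ℝ≥0∞)) p.1) =
      {p : Ω × Plane | ENNReal.ofReal t ≤ pointCount X (Metric.ball p.2 b) p.1}.indicator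
        (fun _ => 1) := by
    ext p
    simp only [Set.indicator, overcrowded, Set.mem_ofPred_eq]
    congr
  rw [e]
  exact measurable_const.indicator h

/-- The path loss to an overcrowded point, as an average over the points close to it. -/
lemma indicator_overcrowded_le {ι : Type*} {X : ι → Ω → Plane} {α D ρ b t : ℝ} (hα : 0 ≤ α)
    (hD : 0 < D) (hρ : 0 < ρ) (hρD : ρ ≤ D / 2) (x : Plane) (ω : Ω) :
    (overcrowded X t b x).indicator (fun _ => pathLoss α D x) ω ≤
      (ENNReal.ofReal (Real.pi * ρ ^ 2))⁻¹ * ENNReal.ofReal (2 ^ α) *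
        ∫⁻ y, pathLoss α (D / 2) y * ((overcrowded X t (b + ρ) y).indicator (fun _ => 1) ω *
          (Metric.ball y ρ).indicator (fun _ => (1 : ℝ≥0∞)) x) := by
  by_cases h : ω ∈ overcrowded X t b x
  · have hball : ENNReal.ofReal (Real.pi * ρ ^ 2) ≠ 0 := by
      rw [Ne, ENNReal.ofReal_eq_zero, not_le]
      have := Real.pi_pos
      positivity
    have h2α : ENNReal.ofReal ((2 : ℝ) ^ α) ≠ 0 := by
      rw [Ne, ENNReal.ofReal_eq_zero, not_le]; positivity
    -- The path loss at `x` is rewritten as the average of a constant over the disc of radius `ρ`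
    -- around `x`; the integrand is then compared pointwise with quantities centred at `y`.
    have hid : pathLoss α D x =
        (ENNReal.ofReal (Real.pi * ρ ^ 2))⁻¹ * ENNReal.ofReal (2 ^ α) *
        ∫⁻ y, (Metric.ball x ρ).indicator
          (fun _ => (ENNReal.ofReal (2 ^ α))⁻¹ * pathLoss α D x) y := by
      rw [lintegral_indicator_const measurableSet_ball, volume_ball_plane _ hρ.le]
      have e : ∀ a b p : ℝ≥0∞, a⁻¹ * b * (b⁻¹ * p * a) = (a⁻¹ * a) * (b * b⁻¹) * p := by
        intros; ring
      rw [e, ENNReal.inv_mul_cancel hball ENNReal.ofReal_ne_top,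
        ENNReal.mul_inv_cancel h2α ENNReal.ofReal_ne_top, one_mul, one_mul]
    rw [Set.indicator_of_mem h]
    conv_lhs => rw [hid]
    refine mul_le_mul_right (lintegral_mono fun y => ?_) _
    by_cases hy : y ∈ Metric.ball x ρ
    · have hy' : x ∈ Metric.ball y ρ := Metric.mem_ball_comm.1 hy
      -- The disc of radius `b + ρ` around `y` contains the disc of radius `b` around `x`.
      have hmem : ω ∈ overcrowded X t (b + ρ) y := by
        refine le_trans h (pointCount_mono (Metric.ball_subset_ball' ?_) ω)
        have := Metric.mem_ball.1 hy'
        linarith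
      rw [Set.indicator_of_mem hy, Set.indicator_of_mem hmem, Set.indicator_of_mem hy',
        mul_one, mul_one, mul_comm, ← div_eq_mul_inv]
      exact ENNReal.div_le_of_le_mul'
        (pathLoss_le_of_dist_lt hα hD ((Metric.mem_ball.1 hy').trans_le hρD))
    · rw [Set.indicator_of_notMem hy]
      exact zero_le
  · rw [Set.indicator_of_notMem h]
    exact zero_le

/-- The mean path loss to the BSs whose neighbourhood is overcrowded. -/
lemma lintegral_pathLoss_overcrowded_le {ι : Type*} [Countable ι] {X : ι → Ω → Plane} [SFinite Pr]
    (hX : IsHPPP Pr lam X) (hlam : 0 ≤ lam) {α D ρ b t m : ℝ} (hα : 2 < α) (hD : 0 < D)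
    (hρ : 0 < ρ) (hρD : ρ ≤ D / 2) (hb : 0 ≤ b) (hm : m = lam * Real.pi * (b + ρ) ^ 2)
    (ht : m < t) :
    ∑' k, ∫⁻ ω, (overcrowded X t b (X k ω)).indicator (fun _ => pathLoss α D (X k ω)) ω ∂Pr ≤
      ENNReal.ofReal ((1 / (t - m) + m / (t - m) ^ 2) * m * 2 ^ α *
        (2 * Real.pi / (α - 2) * (D / 2) ^ (2 - α)) / (Real.pi * ρ ^ 2)) := by
  have hm0 : 0 ≤ m := by rw [hm]; positivity
  have hpi := Real.pi_pos
  have hα2 : 0 < α - 2 := by linarith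
  set κ : ℝ≥0∞ := (ENNReal.ofReal (Real.pi * ρ ^ 2))⁻¹ * ENNReal.ofReal (2 ^ α) with hκ
  have hball : ENNReal.ofReal (Real.pi * ρ ^ 2) ≠ 0 := by
    rw [Ne, ENNReal.ofReal_eq_zero, not_le]
    positivity
  have hκtop : κ ≠ ∞ := ENNReal.mul_ne_top (ENNReal.inv_ne_top.2 hball) ENNReal.ofReal_ne_top
  -- For fixed `y`, summation over `k` turns the last indicator into the number of points in the
  -- disc around `y`. The mean over BSs of a functional of the process seen from the BS thus becomes
  -- a mean over discs with deterministic centre.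
  let F : ι → Ω → Plane → ℝ≥0∞ := fun k ω y =>
    pathLoss α (D / 2) y * ((overcrowded X t (b + ρ) y).indicator (fun _ => 1) ω *
      (Metric.ball y ρ).indicator (fun _ => (1 : ℝ≥0∞)) (X k ω))
  have hFm : ∀ k, Measurable fun p : Ω × Plane => F k p.1 p.2 := by
    intro k
    have h1 : Measurable fun p : Ω × Plane =>
        (overcrowded X t (b + ρ) p.2).indicator (fun _ => (1 : ℝ≥0∞)) p.1 :=
      measurable_indicator_overcrowded hX.measurable t (b + ρ)
    have h2 : Measurable fun p : Ω × Plane =>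
        (Metric.ball p.2 ρ).indicator (fun _ => (1 : ℝ≥0∞)) (X k p.1) :=
      measurable_indicator_ball (hX.measurable k) ρ
    have h3 : Measurable fun p : Ω × Plane => pathLoss α (D / 2) p.2 := by fun_prop
    exact h3.mul (h1.mul h2)
  have hinner : ∀ y, ∑' k, ∫⁻ ω, F k ω y ∂Pr ≤
      pathLoss α (D / 2) y * ENNReal.ofReal ((1 / (t - m) + m / (t - m) ^ 2) * m) := by
    intro y
    rw [← lintegral_tsum (f := fun k ω => F k ω y)
      fun k => ((hFm k).comp measurable_prodMk_right).aemeasurable]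
    simp only [F]
    simp_rw [ENNReal.tsum_mul_left]
    rw [lintegral_const_mul' _ _ (ne_top_of_le_ne_top ENNReal.ofReal_ne_top
      (pathLoss_le (by linarith) (by positivity) y))]
    gcongr
    -- The count in the disc of radius `ρ` is enlarged to radius `b + ρ`, so that the count and the
    -- overcrowding event refer to the same Poisson variable.
    refine le_trans (lintegral_mono fun ω => ?_)
      (hX.lintegral_pointCount_indicator_le hlam (B := Metric.ball y (b + ρ)) measurableSet_ball
        measure_ball_lt_top.ne (t := t) (m := m) ?_ ht)
    · change _ ≤ (overcrowded X t (b + ρ) y).indicator _ ω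
      by_cases hω : ω ∈ overcrowded X t (b + ρ) y
      · rw [Set.indicator_of_mem hω, Set.indicator_of_mem hω, one_mul]
        exact pointCount_mono (Metric.ball_subset_ball (by linarith)) ω
      · rw [Set.indicator_of_notMem hω, zero_mul]
        exact zero_le
    · rw [hm, volume_ball_plane _ (by positivity), ENNReal.toReal_ofReal (by positivity)]
      ring
  calc _ ≤ ∑' k, ∫⁻ ω, (κ * ∫⁻ y, F k ω y) ∂Pr :=
        ENNReal.tsum_le_tsum fun k => lintegral_mono fun ω =>
          indicator_overcrowded_le (by linarith) hD hρ hρD (X k ω) ω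
    _ = κ * ∫⁻ y : Plane, ∑' k, ∫⁻ ω, F k ω y ∂Pr := by
        rw [lintegral_tsum (f := fun k (y : Plane) => ∫⁻ ω, F k ω y ∂Pr)
            (fun k => (hFm k).lintegral_prod_left'.aemeasurable),
          ← ENNReal.tsum_mul_left]
        congr 1
        ext k
        rw [lintegral_const_mul' _ _ hκtop, lintegral_lintegral_swap (hFm k).aemeasurable]
    _ ≤ κ * ∫⁻ y, pathLoss α (D / 2) y *
          ENNReal.ofReal ((1 / (t - m) + m / (t - m) ^ 2) * m) := by
        gcongr with y; exact hinner y
    _ = ENNReal.ofReal ((1 / (t - m) + m / (t - m) ^ 2) * m * 2 ^ α *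
        (2 * Real.pi / (α - 2) * (D / 2) ^ (2 - α)) / (Real.pi * ρ ^ 2)) := by
        have ht' : 0 < t - m := by linarith
        rw [lintegral_mul_const' _ _ ENNReal.ofReal_ne_top, lintegral_pathLoss hα (by positivity),
          hκ, ← ENNReal.ofReal_inv_of_pos (by positivity),
          ← ENNReal.ofReal_mul (by positivity), ← ENNReal.ofReal_mul (by positivity),
          ← ENNReal.ofReal_mul (by positivity)]
        congr 1
        rw [div_eq_mul_inv]
        ring

end Deployment

end Cellular

/-! ### The zero-forcing radius and the rarity of inactive base stations -/

namespace Cellular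

/-- The zero-forcing radius `s √L`. -/
def zfRadius (s : ℝ) (L : ℕ) : ℝ := s * (L : ℝ) ^ (1 / 2 : ℝ)

lemma zfRadius_sq (s : ℝ) (L : ℕ) : zfRadius s L ^ 2 = s ^ 2 * L := by
  rw [zfRadius, mul_pow, ← Real.rpow_mul_natCast (by positivity)]
  norm_num

lemma zfRadius_pos {s : ℝ} (hs : 0 < s) {L : ℕ} (hL : 1 ≤ L) : 0 < zfRadius s L := by
  have : (0 : ℝ) < L := by exact_mod_cast hL
  unfold zfRadius; positivity

lemma tendsto_zfRadius {s : ℝ} (hs : 0 < s) : Tendsto (zfRadius s) atTop atTop :=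
  ((tendsto_rpow_atTop (by norm_num)).comp tendsto_natCast_atTop_atTop).const_mul_atTop hs

variable {M : ℕ} {Ω : Type*} [MeasurableSpace Ω] {Pr : Measure Ω} {N : Deployment M Ω}
  {lam R s : ℝ} {i : Mobile M}

namespace Deployment

lemma IsTypical.exists_lintegral_nearCount_zfRadius_le [IsProbabilityMeasure Pr]
    (hN : N.IsTypical Pr lam R i) (hlam : 0 ≤ lam) (hs : 0 < s) :
    ∃ C : ℝ, 0 ≤ C ∧ ∀ᶠ L : ℕ in atTop,
      ∫⁻ ω, ENNReal.ofReal
        ((N.nearCount (zfRadius s L) i ω - s ^ 2 * Real.pi * lam * M * L) ^ 2) ∂Pr ≤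
        ENNReal.ofReal (C * L) := by
  obtain ⟨K, hK, h⟩ := hN.exists_lintegral_nearCount_le hlam
  refine ⟨K * s ^ 2, by positivity, ?_⟩
  filter_upwards [(tendsto_zfRadius hs).eventually_ge_atTop 1,
    (tendsto_zfRadius hs).eventually_ge_atTop (2 * R)] with L h1 h2
  have := h _ h1 h2
  rw [zfRadius_sq] at this
  rw [mul_assoc K, show s ^ 2 * Real.pi * lam * M * L = lam * Real.pi * M * (s ^ 2 * L) by ring]
  exact this

lemma IsTypical.exists_measure_not_active_le [IsProbabilityMeasure Pr]
    (hN : N.IsTypical Pr lam R i) (hlam : 0 ≤ lam) (hs : 0 < s)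
    (hload : s ^ 2 * Real.pi * lam * M < 1) :
    ∃ C : ℝ, 0 ≤ C ∧ ∀ᶠ L : ℕ in atTop,
      Pr {ω | ¬ N.Active L (zfRadius s L) i.1 ω} ≤ ENNReal.ofReal (C / L) := by
  obtain ⟨K, hK, h⟩ := hN.exists_lintegral_nearCount_zfRadius_le hlam hs
  set c := 1 - s ^ 2 * Real.pi * lam * M with hc
  have hc0 : 0 < c := by linarith
  refine ⟨4 * K / c ^ 2, by positivity, ?_⟩
  filter_upwards [h, (tendsto_natCast_atTop_atTop.const_mul_atTop hc0).eventually_ge_atTop 2,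
    eventually_ge_atTop 1] with L h1 h2 h3
  have hL0 : (0 : ℝ) < L := by exact_mod_cast h3
  have e : lam * Real.pi * M * zfRadius s L ^ 2 = s ^ 2 * Real.pi * lam * M * L := by
    rw [zfRadius_sq]; ring
  have := hN.measure_not_active_le hlam (D := zfRadius s L) (c := c) (L := L)
    (by rw [e, hc]; ring) h2
  rw [e] at this
  refine this.trans ((mul_le_mul_right h1 _).trans ?_)
  rw [← ENNReal.ofReal_mul (by positivity)]
  refine ENNReal.ofReal_le_ofReal (le_of_eq ?_)
  field_simp

/-- On average, the path loss to the inactive BSs is negligible. -/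
lemma IsTypical.exists_tsum_lintegral_not_active_le [IsProbabilityMeasure Pr]
    (hN : N.IsTypical Pr lam R i) (hlam : 0 ≤ lam) (hs : 0 < s)
    (hload : s ^ 2 * Real.pi * lam * M < 1) {α : ℝ} (hα : 2 < α) :
    ∃ C : ℝ, 0 ≤ C ∧ ∀ᶠ L : ℕ in atTop,
      ∑' k : {k : ℕ // k ≠ i.1}, ∫⁻ ω, {ω | ¬ N.Active L (zfRadius s L) k ω}.indicator
        (fun ω => pathLoss α (zfRadius s L) (N.bs k ω)) ω ∂Pr ≤
        ENNReal.ofReal (C * zfRadius s L ^ (-α)) := by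
  have hpi := Real.pi_pos
  have hα2 : 0 < α - 2 := by linarith
  have hM : (0 : ℝ) < M := by exact_mod_cast i.2.pos
  set A := s ^ 2 * Real.pi * lam * M with hA
  have hA0 : 0 ≤ A := by positivity
  -- The load condition leaves room to enlarge the radius by the factor `1 + 2ε`, half for the
  -- offset `R` and half for the smoothing disc, while the mean number `q L` of BSs stays below `L /
  -- M`.
  set ε := (1 - A) / 16 with hε
  have hε0 : 0 < ε := by rw [hε]; linarith
  have hε1 : ε ≤ 1 / 16 := by rw [hε]; linarith
  set q := lam * Real.pi * (1 + 2 * ε) ^ 2 * s ^ 2 with hq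
  have hq0 : 0 ≤ q := by positivity
  have hqM : q * M < 1 := by
    have e : q * M = A * (1 + 2 * ε) ^ 2 := by rw [hq, hA]; ring
    have h1 : (1 + 2 * ε) ^ 2 ≤ 1 + 8 * ε := by nlinarith
    have h2 : A * (1 + 2 * ε) ^ 2 ≤ A * (1 + 8 * ε) := mul_le_mul_of_nonneg_left h1 hA0
    have h3 : A * (8 * ε) ≤ 1 * (8 * ε) := mul_le_mul_of_nonneg_right hload.le (by positivity)
    rw [e]
    linarith
  set η := (1 / M - q) / 2 with hη
  have hη0 : 0 < η := by
    have : q < 1 / M := by rwa [lt_div_iff₀ hM]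
    rw [hη]; linarith
  set C0 := q / η + q ^ 2 / η ^ 2 with hC0
  set C := C0 * 2 ^ α * (2 * Real.pi / (α - 2) * (1 / 2) ^ (2 - α)) / (Real.pi * ε ^ 2) with hC
  refine ⟨C, by positivity, ?_⟩
  filter_upwards [(tendsto_zfRadius hs).eventually_ge_atTop (R / ε), eventually_ge_atTop 1,
    (tendsto_natCast_atTop_atTop.const_mul_atTop hη0).eventually_ge_atTop 1] with L hL1 hL2 hL3
  have hL0 : (0 : ℝ) < L := by exact_mod_cast hL2
  set D := zfRadius s L with hDdef
  have hD : 0 < D := zfRadius_pos hs hL2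
  rw [div_le_iff₀ hε0] at hL1
  -- An inactive BS has at least `L` mobiles nearby, hence at least `L / M` BSs, of which the one
  -- that serves mobile `i` does not count.
  set t := (L : ℝ) / M - 1 with ht
  set m := lam * Real.pi * ((1 + ε) * D + ε * D) ^ 2 with hm
  have hmq : m = q * L := by
    have := zfRadius_sq s L
    rw [← hDdef] at this
    rw [hm, hq, show (1 + ε) * D + ε * D = (1 + 2 * ε) * D by ring, mul_pow, this]
    ring
  have htm : η * L ≤ t - m := by
    have : t - m = 2 * (η * L) - 1 := by rw [hmq, ht, hη]; ring
    rw [this]; linarith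
  have hηL : 0 < η * L := by positivity
  have hbase := lintegral_pathLoss_overcrowded_le hN.isHPPP hlam (D := D) (ρ := ε * D)
    (b := (1 + ε) * D) (t := t) (m := m) hα hD (by positivity) (by nlinarith) (by positivity) hm
    (by linarith)
  have hle : ∑' k : {k : ℕ // k ≠ i.1}, ∫⁻ ω, {ω | ¬ N.Active L D k ω}.indicator
        (fun ω => pathLoss α D (N.bs k ω)) ω ∂Pr ≤ ∑' k, ∫⁻ ω, (overcrowded (N.others i) t
        ((1 + ε) * D) (N.others i k ω)).indicator
        (fun _ => pathLoss α D (N.others i k ω)) ω ∂Pr := by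
    refine ENNReal.tsum_le_tsum fun k => lintegral_mono_ae ?_
    filter_upwards [hN.ae_regular] with ω hω
    by_cases h : N.Active L D k ω
    · rw [Set.indicator_of_notMem (s := {ω | ¬ N.Active L D k ω}) (not_not.2 h)]
      exact zero_le
    · have hcount := (encard_near_le_of_not_active h).trans (hω.encard_near_le D k)
      have hsub : pointCount (N.others i) (Metric.ball (N.bs k ω) (D + R)) ω ≤
          pointCount (N.others i) (Metric.ball (N.bs k ω) ((1 + ε) * D)) ω :=
        pointCount_mono (Metric.ball_subset_ball (by linarith)) ω
      have hmem : ω ∈ overcrowded (N.others i) t ((1 + ε) * D) (N.others i k ω) := by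
        change ENNReal.ofReal t ≤
          pointCount (N.others i) (Metric.ball (N.bs k ω) ((1 + ε) * D)) ω
        refine le_trans ?_ hsub
        rw [ht, ENNReal.ofReal_sub _ zero_le_one, ENNReal.ofReal_div_of_pos hM,
          ENNReal.ofReal_natCast, ENNReal.ofReal_natCast, ENNReal.ofReal_one]
        refine tsub_le_iff_left.2 (ENNReal.div_le_of_le_mul' hcount)
      rw [Set.indicator_of_mem (s := {ω | ¬ N.Active L D k ω}) h, Set.indicator_of_mem hmem]
      rfl
  refine hle.trans (hbase.trans (ENNReal.ofReal_le_ofReal ?_))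
  have hm0 : 0 ≤ m := by rw [hmq]; positivity
  -- The mean `m` and the gap `t - m` are both of order `L`, so the mean count on the overcrowding
  -- event is `O(1)` instead of `O(L)`. Division by the area of the smoothing disc, of order `D²`,
  -- turns `D^(2-α)` into `D^(-α)`.
  have h1 : (1 / (t - m) + m / (t - m) ^ 2) * m ≤ C0 := by
    calc (1 / (t - m) + m / (t - m) ^ 2) * m ≤ (1 / (η * L) + m / (η * L) ^ 2) * m := by gcongr
      _ = C0 := by rw [hmq, hC0]; field_simp
  have h2 : (D / 2) ^ (2 - α) = (1 / 2) ^ (2 - α) * (D ^ 2 * D ^ (-α)) := by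
    rw [div_eq_mul_one_div, Real.mul_rpow hD.le (by norm_num), mul_comm, sub_eq_add_neg,
      Real.rpow_add hD, Real.rpow_ofNat]
  calc (1 / (t - m) + m / (t - m) ^ 2) * m * 2 ^ α *
      (2 * Real.pi / (α - 2) * (D / 2) ^ (2 - α)) / (Real.pi * (ε * D) ^ 2) ≤
      C0 * 2 ^ α * (2 * Real.pi / (α - 2) * (D / 2) ^ (2 - α)) / (Real.pi * (ε * D) ^ 2) := by
        gcongr
    _ = C * D ^ (-α) := by
        rw [h2, hC, mul_pow]
        have : D ^ 2 ≠ 0 := by positivity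
        field_simp

end Deployment

end Cellular

namespace Cellular

variable {M L : ℕ} {Ω : Type*} [MeasurableSpace Ω] {Pr : Measure Ω} {N : Deployment M Ω}
  {lam R : ℝ} {i : Mobile M}

/-! ### Averaging over one fading vector -/

instance [IsProbabilityMeasure Pr] : IsProbabilityMeasure (jointLaw Pr M L) := by
  unfold jointLaw; infer_instance

lemma ae_jointLaw_fst {p : Ω → Prop} (h : ∀ᵐ ω ∂Pr, p ω) : ∀ᵐ x ∂(jointLaw Pr M L), p x.1 :=
  Measure.quasiMeasurePreserving_fst.ae h

lemma ae_jointLaw_generalPosition [SFinite Pr] :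
    ∀ᵐ x ∂(jointLaw Pr M L), GeneralPosition x.2 :=
  Measure.quasiMeasurePreserving_snd.ae ae_generalPosition

lemma lintegral_jointLaw_fst [SFinite Pr] {f : Ω → ℝ≥0∞} (hf : Measurable f) :
    ∫⁻ p, f p.1 ∂(jointLaw Pr M L) = ∫⁻ ω, f ω ∂Pr := by
  rw [jointLaw, lintegral_prod _ (by fun_prop)]
  simp

/-- Averages may be computed after one fading vector has been resampled. -/
lemma lintegral_jointLaw_refresh [SFinite Pr] (j : Mobile M) (k : ℕ)
    {F : Ω × Fading M L → ℝ≥0∞} (hF : Measurable F) :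
    ∫⁻ p, F p ∂(jointLaw Pr M L) =
      ∫⁻ p, ∫⁻ v, F (p.1, refresh p.2 j k v) ∂(gaussVec (Fin L)) ∂(jointLaw Pr M L) := by
  have hm : Measurable fun q : (Ω × Fading M L) × EuclideanSpace ℂ (Fin L) =>
      F (q.1.1, refresh q.1.2 j k q.2) := by
    refine hF.comp (Measurable.prodMk (by fun_prop) ?_)
    exact (measurable_refresh j k).comp (by fun_prop :
      Measurable fun q : (Ω × Fading M L) × EuclideanSpace ℂ (Fin L) => (q.1.2, q.2))
  rw [jointLaw, lintegral_prod _ hF.aemeasurable, lintegral_prod _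
    (Measurable.lintegral_prod_right hm).aemeasurable]
  congr 1
  ext ω
  exact lintegral_fadingLaw_refresh j k (hF.comp measurable_prodMk_left)

/-- Averages may be computed after one fading vector has been resampled, at the locations where the
integrand does not vanish. -/
lemma lintegral_jointLaw_indicator_refresh [SFinite Pr] (j : Mobile M) (k : ℕ)
    {F : Ω × Fading M L → ℝ≥0∞} (hF : Measurable F) {A : Set Ω} (hA : MeasurableSet A)
    (h0 : ∀ᵐ p ∂(jointLaw Pr M L), p.1 ∉ A → F p = 0) :
    ∫⁻ p, F p ∂(jointLaw Pr M L) =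
      ∫⁻ p, A.indicator (fun _ => ∫⁻ v, F (p.1, refresh p.2 j k v) ∂(gaussVec (Fin L))) p.1
        ∂(jointLaw Pr M L) := by
  classical
  have hc : Measurable fun p : Ω × Fading M L => A.indicator (fun _ => (1 : ℝ≥0∞)) p.1 :=
    (measurable_const.indicator hA).comp measurable_fst
  have h1 : ∫⁻ p, F p ∂(jointLaw Pr M L) =
      ∫⁻ p, A.indicator (fun _ => (1 : ℝ≥0∞)) p.1 * F p ∂(jointLaw Pr M L) := by
    refine lintegral_congr_ae ?_
    filter_upwards [h0] with p hp
    by_cases h : p.1 ∈ A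
    · simp [Set.indicator_of_mem h]
    · simp [Set.indicator_of_notMem h, hp h]
  have hm : Measurable fun p : Ω × Fading M L => A.indicator (fun _ => (1 : ℝ≥0∞)) p.1 * F p :=
    hc.mul hF
  rw [h1, lintegral_jointLaw_refresh j k hm]
  congr 1
  ext p
  by_cases h : p.1 ∈ A
  · simp [Set.indicator_of_mem h]
  · simp [Set.indicator_of_notMem h]

open scoped InnerProductSpace

lemma lintegral_norm_sq_inner_gaussVec {w : EuclideanSpace ℂ (Fin L)} (hw : ‖w‖ = 1) :
    ∫⁻ v, ENNReal.ofReal (‖⟪v, w⟫_ℂ‖ ^ 2) ∂(gaussVec (Fin L)) = 1 := by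
  simp_rw [norm_inner_symm _ w]
  rw [lintegral_inner_gaussVec hw (f := fun z => ENNReal.ofReal (‖z‖ ^ 2)) (by fun_prop),
    lintegral_norm_sq_stdComplexGaussian]

lemma lintegral_norm_pow_four_inner_gaussVec {w : EuclideanSpace ℂ (Fin L)} (hw : ‖w‖ = 1) :
    ∫⁻ v, ENNReal.ofReal (‖⟪v, w⟫_ℂ‖ ^ 4) ∂(gaussVec (Fin L)) = fourthMoment := by
  simp_rw [norm_inner_symm _ w]
  rw [lintegral_inner_gaussVec hw (f := fun z => ENNReal.ofReal (‖z‖ ^ 4)) (by fun_prop),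
    fourthMoment]

/-- Path loss as a function of the distance. -/
def pathLossReal (α D x : ℝ) : ℝ := (Set.Ici D).indicator (fun x => x ^ (-α)) x

lemma measurable_pathLossReal (α D : ℝ) : Measurable (pathLossReal α D) := by
  unfold pathLossReal
  exact Measurable.indicator (by fun_prop) measurableSet_Ici

lemma pathLossReal_nonneg {α D : ℝ} (hD : 0 < D) (x : ℝ) : 0 ≤ pathLossReal α D x :=
  Set.indicator_nonneg (fun _ hx => Real.rpow_nonneg (hD.le.trans hx) _) x

lemma pathLoss_eq_ofReal (α D : ℝ) (x : Plane) :
    pathLoss α D x = ENNReal.ofReal (pathLossReal α D ‖x‖) := by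
  rcases le_or_gt D ‖x‖ with h | h
  · rw [pathLoss_of_le h, pathLossReal, Set.indicator_of_mem (Set.mem_Ici.2 h)]
  · rw [pathLoss_of_lt h, pathLossReal, Set.indicator_of_notMem (by simpa using h),
      ENNReal.ofReal_zero]

lemma pathLossReal_le {α D : ℝ} (hα : 0 ≤ α) (hD : 0 < D) (x : ℝ) :
    pathLossReal α D x ≤ D ^ (-α) := by
  refine Set.indicator_apply_le' (fun h => ?_) (fun _ => by positivity)
  exact Real.rpow_le_rpow_of_nonpos hD h (by linarith)

/-! ### Mean powers received from one cell and from two cells -/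

namespace Deployment

/-- Power received at mobile `i` from BS `k`. -/
def cellPower (N : Deployment M Ω) (L : ℕ) (D α : ℝ) (φ : Mobile M → Ω × Fading M L → ℝ)
    (i : Mobile M) (k : ℕ) (p : Ω × Fading M L) : ℝ≥0∞ :=
  ∑ m : Fin M, ENNReal.ofReal (N.rxPower L D α φ i (k, m) p)

/-- Mean power received at the typical mobile from BS `k`, given the locations and the allocated
powers. -/
def meanCellPower (N : Deployment M Ω) (L : ℕ) (D α : ℝ) (φ : Mobile M → Ω × Fading M L → ℝ)
    (k : ℕ) (p : Ω × Fading M L) : ℝ≥0∞ :=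
  {ω | N.Active L D k ω}.indicator (fun ω => pathLoss α D (N.bs k ω)) p.1 *
    ENNReal.ofReal (totalPower φ k p)

variable {D α : ℝ} {φ : Mobile M → Ω × Fading M L → ℝ}

lemma totalPower_nonneg (k : ℕ) (p : Ω × Fading M L) : 0 ≤ totalPower φ k p :=
  Finset.sum_nonneg fun _ _ => sq_nonneg _

lemma measurable_totalPower (hφ : ∀ j, Measurable (φ j)) (k : ℕ) : Measurable (totalPower φ k) := by
  unfold totalPower
  fun_prop

lemma IsMeasurable.cellPower (hN : N.IsMeasurable) (hφ : ∀ j, Measurable (φ j)) (k : ℕ) :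
    Measurable (N.cellPower L D α φ i k) := by
  have h := fun j => hN.rxPower (L := L) D α hφ i j
  unfold Deployment.cellPower
  fun_prop

lemma IsMeasurable.meanCellPower (hN : N.IsMeasurable) (hφ : ∀ j, Measurable (φ j)) (k : ℕ) :
    Measurable (N.meanCellPower L D α φ k) := by
  have h1 := measurable_totalPower hφ k
  have h2 : Measurable fun ω => {ω | N.Active L D k ω}.indicator
      (fun ω => pathLoss α D (N.bs k ω)) ω :=
    ((measurable_pathLoss α D).comp (hN.1 k)).indicator (hN.active L D k)
  unfold Deployment.meanCellPower
  exact (h2.comp measurable_fst).mul h1.ennreal_ofReal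

lemma cellPower_eq_zero {ω : Ω} {g : Fading M L} (hg : GeneralPosition g) {k : ℕ} (hk : k ≠ i.1)
    (hr : N.r i k ω < D) : N.cellPower L D α φ i k (ω, g) = 0 := by
  refine Finset.sum_eq_zero fun m _ => ?_
  rw [rxPower_eq_zero α φ hg (j := (k, m)) hr (fun h => hk (congrArg Prod.fst h)),
    ENNReal.ofReal_zero]

open Classical in
lemma IsPowerAllocation.cellPower_refresh {P : ℝ} (hφ : N.IsPowerAllocation Pr L D P φ) {k : ℕ}
    (hk : k ≠ i.1) {ω : Ω} (hr : D ≤ N.r i k ω) (g : Fading M L) (v : EuclideanSpace ℂ (Fin L)) :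
    N.cellPower L D α φ i k (ω, refresh g i k v) = if N.Active L D k ω then
      ∑ m : Fin M, ENNReal.ofReal (N.r i k ω ^ (-α) * φ (k, m) (ω, g) ^ 2) *
        ENNReal.ofReal (‖⟪v, N.beam L D (k, m) (ω, g)⟫_ℂ‖ ^ 2) else 0 := by
  have hi : i ∉ N.near D k ω := not_lt.2 hr
  have hr0 : 0 ≤ N.r i k ω := dist_nonneg
  unfold cellPower
  simp_rw [rxPower_eq, beam_refresh hi hk.symm, hφ.refresh_eq hi hk.symm, fadingVec_refresh_self]
  split_ifs with h
  · refine Finset.sum_congr rfl fun m _ => ?_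
    rw [← ENNReal.ofReal_mul (by positivity)]
  · simp

lemma IsPowerAllocation.cellPower_refresh_of_ne {P : ℝ} (hφ : N.IsPowerAllocation Pr L D P φ)
    {k l : ℕ} (hk : k ≠ i.1) (hkl : l ≠ k) {ω : Ω} (hr : D ≤ N.r i k ω) (g : Fading M L)
    (v : EuclideanSpace ℂ (Fin L)) :
    N.cellPower L D α φ i l (ω, refresh g i k v) = N.cellPower L D α φ i l (ω, g) := by
  have hi : i ∉ N.near D k ω := not_lt.2 hr
  unfold cellPower
  simp_rw [rxPower_eq, beam_refresh hi hk.symm, hφ.refresh_eq hi hk.symm,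
    fadingVec_refresh_of_ne g v (Or.inr hkl)]

lemma IsPowerAllocation.meanCellPower_refresh {P : ℝ} (hφ : N.IsPowerAllocation Pr L D P φ)
    {k : ℕ} (l : ℕ) (hk : k ≠ i.1) {ω : Ω} (hr : D ≤ N.r i k ω) (g : Fading M L)
    (v : EuclideanSpace ℂ (Fin L)) :
    N.meanCellPower L D α φ l (ω, refresh g i k v) = N.meanCellPower L D α φ l (ω, g) := by
  have hi : i ∉ N.near D k ω := not_lt.2 hr
  unfold meanCellPower totalPower
  simp_rw [hφ.refresh_eq hi hk.symm]

/-- The fading vector between the typical mobile and BS `k` may be averaged out. -/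
lemma lintegral_mul_cellPower [IsProbabilityMeasure Pr] (hN : N.IsTypical Pr lam R i) {P : ℝ}
    (hφ : N.IsPowerAllocation Pr L D P φ) {k : ℕ} (hk : k ≠ i.1)
    {H : Ω × Fading M L → ℝ≥0∞} (hH : Measurable H)
    (hH' : ∀ ω g v, D ≤ N.r i k ω → H (ω, refresh g i k v) = H (ω, g)) :
    ∫⁻ p, H p * N.cellPower L D α φ i k p ∂(jointLaw Pr M L) =
      ∫⁻ p, H p * N.meanCellPower L D α φ k p ∂(jointLaw Pr M L) := by
  classical
  have hfar : MeasurableSet {ω | D ≤ N.r i k ω} :=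
    measurableSet_le measurable_const (hN.isMeasurable.r i k)
  have hmeas : Measurable fun p => H p * N.cellPower L D α φ i k p :=
    hH.mul (hN.isMeasurable.cellPower hφ.measurable k)
  rw [lintegral_jointLaw_indicator_refresh i k hmeas hfar (by
    filter_upwards [ae_jointLaw_generalPosition (Pr := Pr)] with p hg h
    rw [← Prod.mk.eta (p := p), cellPower_eq_zero hg hk (not_le.1 h), mul_zero])]
  refine lintegral_congr_ae ?_
  filter_upwards [ae_jointLaw_generalPosition (Pr := Pr), ae_jointLaw_fst hN.ae_regular]
    with ⟨ω, g⟩ hg hω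
  simp only at hg hω
  by_cases h : D ≤ N.r i k ω
  · have hr0 : 0 ≤ N.r i k ω := dist_nonneg
    -- After resampling, beams, powers and `H` are frozen, and `v` enters only through `|⟪v, w⟫|²`
    -- with unit vectors `w`, each of mean 1.
    have e : ∀ v, H (ω, refresh g i k v) * N.cellPower L D α φ i k (ω, refresh g i k v) =
        H (ω, g) * if N.Active L D k ω then
      ∑ m : Fin M, ENNReal.ofReal (N.r i k ω ^ (-α) * φ (k, m) (ω, g) ^ 2) *
        ENNReal.ofReal (‖⟪v, N.beam L D (k, m) (ω, g)⟫_ℂ‖ ^ 2) else 0 := by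
      intro v
      rw [hH' _ _ _ h, hφ.cellPower_refresh hk h]
    rw [Set.indicator_of_mem (s := {ω | D ≤ N.r i k ω}) h]
    simp_rw [e]
    by_cases ha : N.Active L D k ω
    · simp only [if_pos ha]
      rw [lintegral_const_mul _ (by fun_prop), lintegral_finsetSum _ (fun m _ => by fun_prop)]
      congr 1
      simp_rw [lintegral_const_mul' _ _ ENNReal.ofReal_ne_top]
      have hb : ∀ m : Fin M, ‖N.beam L D (k, m) (ω, g)‖ = 1 := fun m => norm_beam ha hg
      simp_rw [lintegral_norm_sq_inner_gaussVec (hb _), mul_one]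
      rw [meanCellPower, Set.indicator_of_mem (s := {ω | N.Active L D k ω}) ha,
        pathLoss_of_le (by rwa [← hω.r_eq]), ← hω.r_eq, totalPower,
        ← ENNReal.ofReal_mul (by positivity), Finset.mul_sum,
        ENNReal.ofReal_sum_of_nonneg fun m _ => by positivity]
    · simp only [if_neg ha, mul_zero, lintegral_zero]
      rw [meanCellPower, Set.indicator_of_notMem (s := {ω | N.Active L D k ω}) ha, zero_mul,
        mul_zero]
  · rw [Set.indicator_of_notMem (s := {ω | D ≤ N.r i k ω}) h]
    -- The cut-off of the path loss at `D` mirrors the nulling of the nearby BSs.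
    have hz : pathLoss α D (N.bs k ω) = 0 := pathLoss_of_lt (by rw [← hω.r_eq]; exact not_le.1 h)
    have : {ω | N.Active L D k ω}.indicator (fun ω => pathLoss α D (N.bs k ω)) ω = 0 := by
      rw [Set.indicator_apply, hz, ite_self]
    simp [meanCellPower, this]

lemma lintegral_cellPower [IsProbabilityMeasure Pr] (hN : N.IsTypical Pr lam R i) {P : ℝ}
    (hφ : N.IsPowerAllocation Pr L D P φ) {k : ℕ} (hk : k ≠ i.1) :
    ∫⁻ p, N.cellPower L D α φ i k p ∂(jointLaw Pr M L) =
      ∫⁻ p, N.meanCellPower L D α φ k p ∂(jointLaw Pr M L) := by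
  simpa using lintegral_mul_cellPower (α := α) hN hφ hk (H := fun _ => 1) measurable_const
    (fun _ _ _ _ => rfl)

/-- The vector from BS `l` is averaged out first, with the power from BS `k` as a passive factor,
and then the vector from BS `k`. Neither passive factor depends on the vector being resampled. -/
lemma lintegral_cellPower_mul_cellPower [IsProbabilityMeasure Pr] (hN : N.IsTypical Pr lam R i)
    {P : ℝ} (hφ : N.IsPowerAllocation Pr L D P φ) {k l : ℕ} (hk : k ≠ i.1) (hl : l ≠ i.1)
    (hkl : k ≠ l) :
    ∫⁻ p, N.cellPower L D α φ i k p * N.cellPower L D α φ i l p ∂(jointLaw Pr M L) =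
      ∫⁻ p, N.meanCellPower L D α φ k p * N.meanCellPower L D α φ l p ∂(jointLaw Pr M L) := by
  rw [lintegral_mul_cellPower hN hφ hl (hN.isMeasurable.cellPower hφ.measurable k)
    (fun ω g v h => hφ.cellPower_refresh_of_ne hl hkl h g v)]
  simp_rw [mul_comm (N.cellPower L D α φ i k _)]
  rw [lintegral_mul_cellPower hN hφ hk (hN.isMeasurable.meanCellPower hφ.measurable l)
    (fun ω g v h => hφ.meanCellPower_refresh l hk h g v)]
  simp_rw [mul_comm (N.meanCellPower L D α φ l _)]

lemma sq_sum_mul_le (c x : Fin M → ℝ) (hc : ∀ m, 0 ≤ c m) :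
    (∑ m, c m * x m) ^ 2 ≤ (∑ m, c m) * ∑ m, c m * x m ^ 2 :=
  Finset.sum_sq_le_sum_mul_sum_of_sq_le_mul _ (fun m _ => hc m)
    (fun m _ => mul_nonneg (hc m) (sq_nonneg _)) fun m _ => le_of_eq (by ring)

/-- Cauchy–Schwarz with the weights `r^(-α) φ²`, whose sum is at most `r^(-α) P`, reduces the square
to fourth moments along single beams, so the joint law of the gains of the beams of one cell is not
needed. -/
lemma lintegral_cellPower_sq_le [IsProbabilityMeasure Pr] (hN : N.IsTypical Pr lam R i) {P : ℝ}
    (hφ : N.IsPowerAllocation Pr L D P φ) {k : ℕ} (hk : k ≠ i.1) :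
    ∫⁻ p, N.cellPower L D α φ i k p ^ 2 ∂(jointLaw Pr M L) ≤
      fourthMoment * ENNReal.ofReal (P ^ 2) * ∫⁻ ω, pathLoss α D (N.bs k ω) ^ 2 ∂Pr := by
  classical
  have hfar : MeasurableSet {ω | D ≤ N.r i k ω} :=
    measurableSet_le measurable_const (hN.isMeasurable.r i k)
  have hmeas : Measurable fun p => N.cellPower L D α φ i k p ^ 2 :=
    (hN.isMeasurable.cellPower hφ.measurable k).pow_const 2
  rw [lintegral_jointLaw_indicator_refresh i k hmeas hfar (by
    filter_upwards [ae_jointLaw_generalPosition (Pr := Pr)] with p hg h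
    rw [← Prod.mk.eta (p := p), cellPower_eq_zero hg hk (not_le.1 h)]
    simp)]
  have hu : Measurable fun ω => pathLoss α D (N.bs k ω) ^ 2 :=
    ((measurable_pathLoss α D).comp (hN.isMeasurable.1 k)).pow_const 2
  have hu' : Measurable fun p : Ω × Fading M L => pathLoss α D (N.bs k p.1) ^ 2 :=
    hu.comp measurable_fst
  rw [← lintegral_jointLaw_fst (M := M) (L := L) hu, ← lintegral_const_mul _ hu']
  refine lintegral_mono_ae ?_
  filter_upwards [ae_jointLaw_generalPosition (Pr := Pr), ae_jointLaw_fst hN.ae_regular,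
    hφ.power_le] with ⟨ω, g⟩ hg hω hP
  simp only at hg hω
  by_cases h : D ≤ N.r i k ω
  · have hr0 : 0 ≤ N.r i k ω := dist_nonneg
    have e : ∀ v, N.cellPower L D α φ i k (ω, refresh g i k v) ^ 2 =
        (if N.Active L D k ω then
      ∑ m : Fin M, ENNReal.ofReal (N.r i k ω ^ (-α) * φ (k, m) (ω, g) ^ 2) *
        ENNReal.ofReal (‖⟪v, N.beam L D (k, m) (ω, g)⟫_ℂ‖ ^ 2) else 0) ^ 2 := by
      intro v
      rw [hφ.cellPower_refresh hk h]
    rw [Set.indicator_of_mem (s := {ω | D ≤ N.r i k ω}) h]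
    simp_rw [e]
    by_cases ha : N.Active L D k ω
    · simp only [if_pos ha]
      have hb : ∀ m : Fin M, ‖N.beam L D (k, m) (ω, g)‖ = 1 := fun m => norm_beam ha hg
      set c : Fin M → ℝ := fun m => N.r i k ω ^ (-α) * φ (k, m) (ω, g) ^ 2 with hc
      have hc0 : ∀ m, 0 ≤ c m := fun m => by simp only [hc]; positivity
      have hsum : ∑ m, c m ≤ N.r i k ω ^ (-α) * P := by
        simp only [hc]
        rw [← Finset.mul_sum]
        gcongr
        exact hP k
      have hpt : ∀ v, (∑ m : Fin M, ENNReal.ofReal (c m) *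
          ENNReal.ofReal (‖⟪v, N.beam L D (k, m) (ω, g)⟫_ℂ‖ ^ 2)) ^ 2 ≤
          ENNReal.ofReal (∑ m, c m) * ∑ m, ENNReal.ofReal (c m) *
            ENNReal.ofReal (‖⟪v, N.beam L D (k, m) (ω, g)⟫_ℂ‖ ^ 4) := by
        intro v
        simp_rw [← ENNReal.ofReal_mul (hc0 _)]
        rw [← ENNReal.ofReal_sum_of_nonneg fun m _ => mul_nonneg (hc0 m) (by positivity),
          ← ENNReal.ofReal_sum_of_nonneg fun m _ => mul_nonneg (hc0 m) (by positivity),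
          ← ENNReal.ofReal_pow (Finset.sum_nonneg fun m _ => mul_nonneg (hc0 m) (by positivity)),
          ← ENNReal.ofReal_mul (Finset.sum_nonneg fun m _ => hc0 m)]
        refine ENNReal.ofReal_le_ofReal ((sq_sum_mul_le c _ hc0).trans (le_of_eq ?_))
        congr 1
        refine Finset.sum_congr rfl fun m _ => ?_
        ring
      refine (lintegral_mono hpt).trans ?_
      rw [lintegral_const_mul _ (by fun_prop), lintegral_finsetSum _ (fun m _ => by fun_prop)]
      simp_rw [lintegral_const_mul' _ _ ENNReal.ofReal_ne_top,
        lintegral_norm_pow_four_inner_gaussVec (hb _)]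
      rw [← Finset.sum_mul, ← ENNReal.ofReal_sum_of_nonneg fun m _ => hc0 m,
        pathLoss_of_le (by rwa [← hω.r_eq]), ← hω.r_eq]
      have hle : ENNReal.ofReal (∑ m, c m) * ENNReal.ofReal (∑ m, c m) ≤
          ENNReal.ofReal (P ^ 2) * ENNReal.ofReal (N.r i k ω ^ (-α)) ^ 2 := by
        rw [← ENNReal.ofReal_mul (Finset.sum_nonneg fun m _ => hc0 m),
          ← ENNReal.ofReal_pow (by positivity), ← ENNReal.ofReal_mul (by positivity)]
        refine ENNReal.ofReal_le_ofReal ?_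
        rw [← sq, ← mul_pow, mul_comm P]
        exact pow_le_pow_left₀ (Finset.sum_nonneg fun m _ => hc0 m) hsum 2
      calc ENNReal.ofReal (∑ m, c m) * (ENNReal.ofReal (∑ m, c m) * fourthMoment)
          = fourthMoment * (ENNReal.ofReal (∑ m, c m) * ENNReal.ofReal (∑ m, c m)) := by ring
        _ ≤ _ := mul_le_mul_right hle _
        _ = _ := by ring
    · simp [if_neg ha]
  · rw [Set.indicator_of_notMem (s := {ω | D ≤ N.r i k ω}) h]
    exact zero_le

end Deployment

end Cellular

namespace Cellular

/-! ### Integrals of conditional expectations -/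

lemma integral_mul_condExp {X : Type*} {m m0 : MeasurableSpace X} {C : Measure X}
    [IsFiniteMeasure C] (hm : m ≤ m0) {f T : X → ℝ} {B B' : ℝ} (hf : StronglyMeasurable[m] f)
    (hfB : ∀ x, |f x| ≤ B) (hT : Measurable T) (hTB : ∀ᵐ x ∂C, |T x| ≤ B') :
    Integrable (fun x => f x * (C[T | m]) x) C ∧ Integrable (fun x => f x * T x) C ∧
      ∫ x, f x * (C[T | m]) x ∂C = ∫ x, f x * T x ∂C := by
  have hTi : Integrable T C := Integrable.of_bound hT.aestronglyMeasurable B' hTB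
  have h1 : Integrable (fun x => f x * T x) C :=
    hTi.bdd_mul (c := B) (hf.mono hm).aestronglyMeasurable (.of_forall hfB)
  have h2 : Integrable (fun x => f x * (C[T | m]) x) C :=
    integrable_condExp.bdd_mul (c := B) (hf.mono hm).aestronglyMeasurable (.of_forall hfB)
  refine ⟨h2, h1, ?_⟩
  have h3 := condExp_mul_of_stronglyMeasurable_left hf h1 hTi
  rw [← integral_condExp hm (f := fun x => f x * T x)]
  exact (integral_congr_ae h3).symm

lemma integral_cond {X : Type*} [MeasurableSpace X] (μ : Measure X) {E : Set X} (f : X → ℝ) :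
    ∫ x, f x ∂(cond μ E) = ((μ E)⁻¹).toReal * ∫ x in E, f x ∂μ := by
  rw [ProbabilityTheory.cond, integral_smul_measure, smul_eq_mul]

/-- Bounds on conditional expectations given an event yield bounds on expectations. -/
lemma setIntegral_mul_le_of_abs_condExp_sub_le {X : Type*} {m m0 : MeasurableSpace X}
    {μ : Measure X} [IsFiniteMeasure μ] (hm : m ≤ m0) {E : Set X}
    {f T b : X → ℝ} {B B' c : ℝ}
    (hf : StronglyMeasurable[m] f) (hf0 : ∀ x, 0 ≤ f x) (hfB : ∀ x, f x ≤ B) (hT : Measurable T)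
    (hTB : ∀ᵐ x ∂μ, |T x| ≤ B') (hb : Integrable (fun x => f x * b x) (cond μ E))
    (h : ∀ᵐ x ∂(cond μ E), |((cond μ E)[T | m]) x - c| ≤ b x) :
    c * ∫ x in E, f x ∂μ ≤ ∫ x in E, f x * T x ∂μ + ∫ x in E, f x * b x ∂μ ∧
    ∫ x in E, f x * T x ∂μ ≤ c * ∫ x in E, f x ∂μ + ∫ x in E, f x * b x ∂μ := by
  -- For a null event `cond μ E` carries no information, but both set integrals vanish; otherwise
  -- the normalization cancels.
  rcases eq_or_ne (μ E) 0 with h0 | h0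
  · simp [Measure.restrict_eq_zero.2 h0]
  have hC := integral_mul_condExp (C := cond μ E) hm hf (fun x => by
    rw [abs_of_nonneg (hf0 x)]; exact hfB x) hT (cond_absolutelyContinuous.ae_le hTB)
  have hfi : Integrable f (cond μ E) :=
    Integrable.of_bound (hf.mono hm).aestronglyMeasurable B (.of_forall fun x => by
      rw [Real.norm_eq_abs, abs_of_nonneg (hf0 x)]; exact hfB x)
  have key1 : c * ∫ x, f x ∂(cond μ E) ≤
      ∫ x, f x * T x ∂(cond μ E) + ∫ x, f x * b x ∂(cond μ E) := by
    rw [← hC.2.2, ← integral_add hC.1 hb, ← integral_const_mul]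
    refine integral_mono_ae (hfi.const_mul c) (hC.1.add hb) ?_
    filter_upwards [h] with x hx
    have := (abs_le.1 hx).1
    nlinarith [hf0 x]
  have key2 : ∫ x, f x * T x ∂(cond μ E) ≤
      c * ∫ x, f x ∂(cond μ E) + ∫ x, f x * b x ∂(cond μ E) := by
    rw [← hC.2.2, ← integral_const_mul, ← integral_add (hfi.const_mul c) hb]
    refine integral_mono_ae hC.1 ((hfi.const_mul c).add hb) ?_
    filter_upwards [h] with x hx
    have := (abs_le.1 hx).2
    nlinarith [hf0 x]
  have hpos : 0 < ((μ E)⁻¹).toReal :=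
    ENNReal.toReal_pos (ENNReal.inv_ne_zero.2 (measure_ne_top _ _)) (ENNReal.inv_ne_top.2 h0)
  simp only [integral_cond] at key1 key2
  constructor <;> refine le_of_mul_le_mul_left ?_ hpos
  · linarith
  · linarith

/-- Version of the bounds for integrals with values in `[0, ∞]`. -/
lemma setLIntegral_mul_le_of_abs_condExp_sub_le {X : Type*} {m m0 : MeasurableSpace X}
    {μ : Measure X} [IsFiniteMeasure μ] (hm : m ≤ m0) {E : Set X}
    {f T b : X → ℝ} {B B' B'' c : ℝ} (hc : 0 ≤ c)
    (hf : StronglyMeasurable[m] f) (hf0 : ∀ x, 0 ≤ f x) (hfB : ∀ x, f x ≤ B) (hT : Measurable T)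
    (hT0 : ∀ x, 0 ≤ T x) (hTB : ∀ᵐ x ∂μ, |T x| ≤ B') (hb : Measurable b) (hb0 : ∀ x, 0 ≤ b x)
    (hbB : ∀ x, f x * b x ≤ B'')
    (h : ∀ᵐ x ∂(cond μ E), |((cond μ E)[T | m]) x - c| ≤ b x) :
    ENNReal.ofReal c * ∫⁻ x in E, ENNReal.ofReal (f x) ∂μ ≤
      ∫⁻ x in E, ENNReal.ofReal (f x * T x) ∂μ + ∫⁻ x in E, ENNReal.ofReal (f x * b x) ∂μ ∧
    ∫⁻ x in E, ENNReal.ofReal (f x * T x) ∂μ ≤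
      ENNReal.ofReal c * ∫⁻ x in E, ENNReal.ofReal (f x) ∂μ +
        ∫⁻ x in E, ENNReal.ofReal (f x * b x) ∂μ := by
  have hfm := hf.mono hm
  have hbi : ∀ ν : Measure X, IsFiniteMeasure ν → Integrable (fun x => f x * b x) ν := by
    intro ν _
    refine Integrable.of_bound (hfm.measurable.mul hb).aestronglyMeasurable B''
      (.of_forall fun x => ?_)
    rw [Real.norm_eq_abs, abs_of_nonneg (mul_nonneg (hf0 x) (hb0 x))]
    exact hbB x
  have key := setIntegral_mul_le_of_abs_condExp_sub_le hm hf hf0 hfB hT hTB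
    (hbi _ inferInstance) h
  have hfi : Integrable f (μ.restrict E) :=
    Integrable.of_bound hfm.aestronglyMeasurable B (.of_forall fun x => by
      rw [Real.norm_eq_abs, abs_of_nonneg (hf0 x)]; exact hfB x)
  have hTi : Integrable (fun x => f x * T x) (μ.restrict E) := by
    have : Integrable T (μ.restrict E) :=
      Integrable.of_bound hT.aestronglyMeasurable B' (ae_restrict_of_ae hTB)
    exact this.bdd_mul (c := B) hfm.aestronglyMeasurable (.of_forall fun x => by
      rw [Real.norm_eq_abs, abs_of_nonneg (hf0 x)]; exact hfB x)
  have e1 := ofReal_integral_eq_lintegral_ofReal hfi (.of_forall hf0)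
  have e2 := ofReal_integral_eq_lintegral_ofReal hTi
    (.of_forall fun x => mul_nonneg (hf0 x) (hT0 x))
  have e3 := ofReal_integral_eq_lintegral_ofReal (hbi (μ.restrict E) inferInstance)
    (.of_forall fun x => mul_nonneg (hf0 x) (hb0 x))
  have n1 : 0 ≤ ∫ x in E, f x ∂μ := integral_nonneg hf0
  have n2 : 0 ≤ ∫ x in E, f x * T x ∂μ := integral_nonneg fun x => mul_nonneg (hf0 x) (hT0 x)
  have n3 : 0 ≤ ∫ x in E, f x * b x ∂μ := integral_nonneg fun x => mul_nonneg (hf0 x) (hb0 x)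
  rw [← e1, ← e2, ← e3, ← ENNReal.ofReal_mul hc, ← ENNReal.ofReal_add n2 n3,
    ← ENNReal.ofReal_add (mul_nonneg hc n1) n3]
  exact ⟨ENNReal.ofReal_le_ofReal key.1, ENNReal.ofReal_le_ofReal key.2⟩

/-! ### Consequences of the two power conditions -/

variable {M L : ℕ} {Ω : Type*} [MeasurableSpace Ω] {Pr : Measure Ω} {N : Deployment M Ω}
  {lam R : ℝ} {i : Mobile M}

namespace Deployment

variable {D α : ℝ} {φ : Mobile M → Ω × Fading M L → ℝ}

lemma IsPowerAllocation.ae_totalPower_le {P : ℝ} (hφ : N.IsPowerAllocation Pr L D P φ) (k : ℕ) :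
    ∀ᵐ p ∂(jointLaw Pr M L), totalPower φ k p ≤ P := by
  filter_upwards [hφ.power_le] with p hp using hp k

/-- Lower bound on the mean power received from a BS. -/
lemma ofReal_mul_lintegral_active_le [IsProbabilityMeasure Pr] (hN : N.IsTypical Pr lam R i)
    {P Pbar δ γ : ℝ} (hφ : N.IsPowerAllocation Pr L D P φ) (hD : 0 < D) (hα : 0 ≤ α)
    (hγ : 0 ≤ γ) (hPbar : 0 ≤ Pbar) (hmean : N.MeanPowerCondition Pr L D Pbar δ γ i φ)
    {k : ℕ} (hk : k ≠ i.1) :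
    ENNReal.ofReal Pbar * ∫⁻ ω, {ω | N.Active L D k ω}.indicator
        (fun ω => pathLoss α D (N.bs k ω)) ω ∂Pr ≤
      ∫⁻ p, N.meanCellPower L D α φ k p ∂(jointLaw Pr M L) +
        ENNReal.ofReal (|δ| * D ^ (-γ)) * ∫⁻ ω, pathLoss α D (N.bs k ω) ∂Pr := by
  have hrm := hN.isMeasurable.r i k
  have hr : Measurable fun p : Ω × Fading M L => N.r i k p.1 := hrm.comp measurable_fst
  have hr0 : ∀ ω, 0 ≤ N.r i k ω := fun ω => dist_nonneg
  have hA := hN.isMeasurable.active L D k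
  have hE : MeasurableSet {p : Ω × Fading M L | N.Active L D k p.1} := hA.preimage measurable_fst
  -- The cut-off restricts to distances `x ≥ D`, where `x^(-γ) ≤ D^(-γ)`. The sign of `δ` is not
  -- prescribed, whence `|δ|`.
  have hbound : ∀ x : ℝ, pathLossReal α D x * (|δ| * x ^ (-γ)) ≤
      |δ| * D ^ (-γ) * pathLossReal α D x := by
    intro x
    rcases le_or_gt D x with h | h
    · rw [mul_comm]
      refine mul_le_mul_of_nonneg_right ?_ (pathLossReal_nonneg hD x)
      exact mul_le_mul_of_nonneg_left
        (Real.rpow_le_rpow_of_nonpos hD h (neg_nonpos.2 hγ)) (abs_nonneg δ)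
    · simp [pathLossReal, Set.indicator_of_notMem (show x ∉ Set.Ici D from not_le.2 h)]
  have key := (setLIntegral_mul_le_of_abs_condExp_sub_le (μ := jointLaw Pr M L)
    (m := MeasurableSpace.comap (fun p : Ω × Fading M L => N.r i k p.1) inferInstance)
    (E := {p | N.Active L D k p.1}) (f := fun p => pathLossReal α D (N.r i k p.1))
    (T := totalPower φ k) (b := fun p => |δ| * N.r i k p.1 ^ (-γ)) (B := D ^ (-α)) (B' := P)
    (B'' := |δ| * D ^ (-γ) * D ^ (-α)) hr.comap_le hPbar
    ((measurable_pathLossReal α D).comp (comap_measurable _)).stronglyMeasurable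
    (fun p => pathLossReal_nonneg hD _) (fun p => pathLossReal_le hα hD _)
    (measurable_totalPower hφ.measurable k) (totalPower_nonneg k) (by
      filter_upwards [hφ.ae_totalPower_le k] with p hp
      rwa [abs_of_nonneg (totalPower_nonneg k p)]) (by fun_prop)
    (fun p => mul_nonneg (abs_nonneg _) (Real.rpow_nonneg (hr0 _) _))
    (fun p => (hbound _).trans (mul_le_mul_of_nonneg_left (pathLossReal_le hα hD _)
      (by positivity))) (by
      filter_upwards [hmean k hk] with p hp
      refine hp.trans (mul_le_mul_of_nonneg_right (le_abs_self δ) (Real.rpow_nonneg (hr0 _) _)))).1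
  -- The condition on the mean power conditions on the distance to mobile `i`, whereas Campbell's
  -- formula needs a function of the location of the BS; the two agree almost surely because mobile
  -- `i` is at the origin.
  have hpl : ∀ᵐ p ∂(jointLaw Pr M L),
      ENNReal.ofReal (pathLossReal α D (N.r i k p.1)) = pathLoss α D (N.bs k p.1) := by
    filter_upwards [ae_jointLaw_fst (M := M) (L := L) hN.ae_regular] with p hp
    rw [hp.r_eq, pathLoss_eq_ofReal]
  have hu : Measurable fun ω => pathLoss α D (N.bs k ω) :=
    (measurable_pathLoss α D).comp (hN.isMeasurable.1 k)
  have e1 : ∫⁻ p in {p | N.Active L D k p.1}, ENNReal.ofReal (pathLossReal α D (N.r i k p.1))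
        ∂(jointLaw Pr M L) =
      ∫⁻ ω, {ω | N.Active L D k ω}.indicator (fun ω => pathLoss α D (N.bs k ω)) ω ∂Pr := by
    rw [← lintegral_jointLaw_fst (M := M) (L := L) (hu.indicator hA), ← lintegral_indicator hE]
    refine lintegral_congr_ae ?_
    filter_upwards [hpl] with p hp
    by_cases h : N.Active L D k p.1
    · rw [Set.indicator_of_mem (s := {p : Ω × Fading M L | N.Active L D k p.1}) h,
        Set.indicator_of_mem (s := {ω | N.Active L D k ω}) h, hp]
    · rw [Set.indicator_of_notMem (s := {p : Ω × Fading M L | N.Active L D k p.1}) h,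
        Set.indicator_of_notMem (s := {ω | N.Active L D k ω}) h]
  have e2 : ∫⁻ p in {p | N.Active L D k p.1},
        ENNReal.ofReal (pathLossReal α D (N.r i k p.1) * totalPower φ k p) ∂(jointLaw Pr M L) =
      ∫⁻ p, N.meanCellPower L D α φ k p ∂(jointLaw Pr M L) := by
    rw [← lintegral_indicator hE]
    refine lintegral_congr_ae ?_
    filter_upwards [hpl] with p hp
    by_cases h : N.Active L D k p.1
    · rw [Set.indicator_of_mem (s := {p : Ω × Fading M L | N.Active L D k p.1}) h,
        meanCellPower, Set.indicator_of_mem (s := {ω | N.Active L D k ω}) h,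
        ENNReal.ofReal_mul (pathLossReal_nonneg hD _), hp]
    · rw [Set.indicator_of_notMem (s := {p : Ω × Fading M L | N.Active L D k p.1}) h,
        meanCellPower, Set.indicator_of_notMem (s := {ω | N.Active L D k ω}) h, zero_mul]
  have e3 : ∫⁻ p in {p | N.Active L D k p.1},
        ENNReal.ofReal (pathLossReal α D (N.r i k p.1) * (|δ| * N.r i k p.1 ^ (-γ)))
          ∂(jointLaw Pr M L) ≤
      ENNReal.ofReal (|δ| * D ^ (-γ)) * ∫⁻ ω, pathLoss α D (N.bs k ω) ∂Pr := by
    have hu' : Measurable fun p : Ω × Fading M L => pathLoss α D (N.bs k p.1) :=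
      hu.comp measurable_fst
    rw [← lintegral_jointLaw_fst (M := M) (L := L) hu, ← lintegral_const_mul _ hu']
    refine (setLIntegral_le_lintegral _ _).trans (lintegral_mono_ae ?_)
    filter_upwards [hpl] with p hp
    rw [← hp, ← ENNReal.ofReal_mul (by positivity)]
    exact ENNReal.ofReal_le_ofReal (hbound _)
  rw [e1, e2] at key
  exact key.trans (add_le_add le_rfl e3)

/-- Upper bound on the correlation of the mean powers received from two BSs. -/
lemma lintegral_meanCellPower_mul_le [IsProbabilityMeasure Pr] (hN : N.IsTypical Pr lam R i)
    {P Pbar δ γ : ℝ} (hφ : N.IsPowerAllocation Pr L D P φ) (hD : 0 < D) (hα : 0 ≤ α)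
    (hcorr : N.PowerCorrelationCondition Pr L D P Pbar δ γ i φ)
    {k l : ℕ} (hk : k ≠ i.1) (hl : l ≠ i.1) (hkl : k ≠ l) :
    ∫⁻ p, N.meanCellPower L D α φ k p * N.meanCellPower L D α φ l p ∂(jointLaw Pr M L) ≤
      ∫⁻ ω, pathLoss α D (N.bs k ω) * pathLoss α D (N.bs l ω) *
        ENNReal.ofReal (Pbar ^ 2 + min (P ^ 2) (|δ| * dist (N.bs k ω) (N.bs l ω) ^ (-γ))) ∂Pr := by
  set E : Set (Ω × Fading M L) := {p | N.Active L D k p.1 ∧ N.Active L D l p.1} with hEdef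
  have hE : MeasurableSet E := ((hN.isMeasurable.active L D k).inter
    (hN.isMeasurable.active L D l)).preimage measurable_fst
  set d : Ω → ℝ := fun ω => min (P ^ 2) (|δ| * dist (N.bs k ω) (N.bs l ω) ^ (-γ)) with hd
  have hbk := hN.isMeasurable.1 k
  have hbl := hN.isMeasurable.1 l
  have hdm : Measurable d := by
    simp only [hd]
    fun_prop
  have hd0 : ∀ ω, 0 ≤ d ω := fun ω => le_min (sq_nonneg P)
    (mul_nonneg (abs_nonneg _) (Real.rpow_nonneg dist_nonneg _))
  set f : Ω → ℝ := fun ω => pathLossReal α D ‖N.bs k ω‖ * pathLossReal α D ‖N.bs l ω‖ with hf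
  have hpm := measurable_pathLossReal α D
  have hfm : Measurable f := by
    simp only [hf]
    fun_prop
  have hf0 : ∀ ω, 0 ≤ f ω := fun ω =>
    mul_nonneg (pathLossReal_nonneg hD _) (pathLossReal_nonneg hD _)
  have hfB : ∀ ω, f ω ≤ D ^ (-α) * D ^ (-α) := fun ω => mul_le_mul (pathLossReal_le hα hD _)
    (pathLossReal_le hα hD _) (pathLossReal_nonneg hD _) (by positivity)
  have hbs : Measurable fun (p : Ω × Fading M L) (n : ℕ) => N.bs n p.1 :=
    measurable_pi_lambda _ fun n => (hN.isMeasurable.1 n).comp measurable_fst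
  have hfs : Measurable[MeasurableSpace.comap (fun (p : Ω × Fading M L) (n : ℕ) => N.bs n p.1)
      inferInstance] fun p : Ω × Fading M L => f p.1 := by
    have h0 : Measurable fun b : ℕ → Plane => pathLossReal α D ‖b k‖ * pathLossReal α D ‖b l‖ := by
      fun_prop
    have h1 : (fun p : Ω × Fading M L => f p.1) = (fun b : ℕ → Plane =>
        pathLossReal α D ‖b k‖ * pathLossReal α D ‖b l‖) ∘ fun p n => N.bs n p.1 := rfl
    rw [h1]
    exact Measurable.comp h0 (comap_measurable _)
  have hT0 : ∀ p, 0 ≤ totalPower φ k p * totalPower φ l p := fun p =>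
    mul_nonneg (totalPower_nonneg k p) (totalPower_nonneg l p)
  have key := (setLIntegral_mul_le_of_abs_condExp_sub_le (μ := jointLaw Pr M L)
    (m := MeasurableSpace.comap (fun (p : Ω × Fading M L) (n : ℕ) => N.bs n p.1) inferInstance)
    (E := E) (f := fun p => f p.1)
    (T := fun p => totalPower φ k p * totalPower φ l p) (b := fun p => d p.1)
    (B := D ^ (-α) * D ^ (-α)) (B' := P ^ 2)
    (B'' := D ^ (-α) * D ^ (-α) * P ^ 2) hbs.comap_le (sq_nonneg Pbar)
    hfs.stronglyMeasurable (fun p => hf0 p.1) (fun p => hfB p.1)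
    ((measurable_totalPower hφ.measurable k).mul (measurable_totalPower hφ.measurable l)) hT0 (by
      filter_upwards [hφ.ae_totalPower_le k, hφ.ae_totalPower_le l] with p h1 h2
      rw [abs_of_nonneg (hT0 p), sq]
      exact mul_le_mul h1 h2 (totalPower_nonneg l p) ((totalPower_nonneg k p).trans h1))
    (hdm.comp measurable_fst) (fun p => hd0 p.1)
    (fun p => mul_le_mul (hfB p.1) (min_le_left _ _) (hd0 p.1) (by positivity)) (by
      filter_upwards [hcorr k l hk hl hkl] with p hp
      refine hp.trans (min_le_min le_rfl (mul_le_mul_of_nonneg_right (le_abs_self δ)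
        (Real.rpow_nonneg dist_nonneg _))))).2
  have e2 : ∫⁻ p in E, ENNReal.ofReal (f p.1 * (totalPower φ k p * totalPower φ l p))
        ∂(jointLaw Pr M L) =
      ∫⁻ p, N.meanCellPower L D α φ k p * N.meanCellPower L D α φ l p ∂(jointLaw Pr M L) := by
    rw [← lintegral_indicator hE]
    refine lintegral_congr fun p => ?_
    by_cases h : N.Active L D k p.1
    · by_cases h' : N.Active L D l p.1
      · rw [Set.indicator_of_mem (show p ∈ E from ⟨h, h'⟩), meanCellPower, meanCellPower,
          Set.indicator_of_mem (s := {ω | N.Active L D k ω}) h,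
          Set.indicator_of_mem (s := {ω | N.Active L D l ω}) h',
          ENNReal.ofReal_mul (hf0 _), ENNReal.ofReal_mul (totalPower_nonneg k p),
          ENNReal.ofReal_mul (pathLossReal_nonneg hD _), pathLoss_eq_ofReal, pathLoss_eq_ofReal]
        ring
      · rw [Set.indicator_of_notMem (show p ∉ E from fun h0 => h' h0.2), meanCellPower,
          meanCellPower, Set.indicator_of_notMem (s := {ω | N.Active L D l ω}) h', zero_mul,
          mul_zero]
    · rw [Set.indicator_of_notMem (show p ∉ E from fun h0 => h h0.1), meanCellPower,
        Set.indicator_of_notMem (s := {ω | N.Active L D k ω}) h, zero_mul, zero_mul]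
  rw [e2] at key
  refine key.trans ?_
  refine (add_le_add (mul_le_mul_right (setLIntegral_le_lintegral _ _) _)
    (setLIntegral_le_lintegral _ _)).trans (le_of_eq ?_)
  have hf1 : Measurable fun ω => ENNReal.ofReal (f ω) := hfm.ennreal_ofReal
  have hf2 : Measurable fun ω => ENNReal.ofReal (f ω * d ω) := (hfm.mul hdm).ennreal_ofReal
  rw [lintegral_jointLaw_fst hf1, lintegral_jointLaw_fst hf2,
    ← lintegral_const_mul _ hf1, ← lintegral_add_left (hf1.const_mul _)]
  refine lintegral_congr fun ω => ?_
  rw [ENNReal.ofReal_add (sq_nonneg _) (hd0 ω), ENNReal.ofReal_mul (hf0 ω),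
    pathLoss_eq_ofReal, pathLoss_eq_ofReal, ← ENNReal.ofReal_mul (pathLossReal_nonneg hD _)]
  ring

end Deployment

end Cellular

/-! ### First two moments and mean square convergence of the interference -/

namespace Cellular

variable {M L : ℕ} {Ω : Type*} [MeasurableSpace Ω] {Pr : Measure Ω} {N : Deployment M Ω}
  {lam R : ℝ} {i : Mobile M}

lemma sq_tsum_eq_add_tsum_pair {κ : Type*} [DecidableEq κ] (f : κ → ℝ≥0∞) :
    (∑' k, f k) ^ 2 = ∑' k, f k ^ 2 + ∑' q : {q : κ × κ // q.1 ≠ q.2}, f q.1.1 * f q.1.2 := by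
  have h1 : (∑' k, f k) ^ 2 = ∑' q : κ × κ, f q.1 * f q.2 := by
    rw [ENNReal.tsum_prod', sq, ← ENNReal.tsum_mul_right]
    simp_rw [ENNReal.tsum_mul_left]
  rw [h1, ← ENNReal.summable.tsum_add_tsum_compl (s := {q : κ × κ | q.1 = q.2}) ENNReal.summable]
  congr 1
  let e : κ ≃ {q : κ × κ | q.1 = q.2} :=
    ⟨fun k => ⟨(k, k), rfl⟩, fun q => q.1.1, fun _ => rfl, fun ⟨⟨a, b⟩, h⟩ => by
      simp only [Set.mem_ofPred_eq] at h; subst h; rfl⟩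
  rw [← e.tsum_eq]
  simp [e, sq]

namespace Deployment

/-- Power received at the typical mobile from all BSs but its own one. -/
def interference (N : Deployment M Ω) (L : ℕ) (D α : ℝ) (φ : Mobile M → Ω × Fading M L → ℝ)
    (i : Mobile M) (p : Ω × Fading M L) : ℝ≥0∞ :=
  ∑' k : {k : ℕ // k ≠ i.1}, N.cellPower L D α φ i k p

variable {D α : ℝ} {φ : Mobile M → Ω × Fading M L → ℝ}

lemma IsMeasurable.interference (hN : N.IsMeasurable) (hφ : ∀ j, Measurable (φ j)) :
    Measurable (N.interference L D α φ i) :=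
  Measurable.tsum fun k => hN.cellPower hφ k

/-- Zero forcing removes the interference from the own BS. -/
lemma tsum_rxPower_eq {ω : Ω} {g : Fading M L} (hg : GeneralPosition g)
    (h : N.Regular R i ω) (hD : R < D) :
    ∑' j : {j : Mobile M // j ≠ i}, N.rxPower L D α φ i j (ω, g) =
      (N.interference L D α φ i (ω, g)).toReal := by
  -- Mobile `i` is itself in `𝓓_k` for its own BS `k`, so the beams for the other mobiles of this BS
  -- are orthogonal to its channel.
  have hr : N.r i i.1 ω < D := (h.2 i).trans_lt hD
  have h1 : ∑' j : {j : Mobile M // j ≠ i}, ENNReal.ofReal (N.rxPower L D α φ i j (ω, g)) =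
      N.interference L D α φ i (ω, g) := by
    refine (tsum_subtype {j : Mobile M | j ≠ i}
      (fun j => ENNReal.ofReal (N.rxPower L D α φ i j (ω, g)))).trans ?_
    rw [ENNReal.tsum_prod', tsum_eq_add_tsum_ne i.1]
    simp_rw [tsum_fintype]
    rw [interference]
    refine (congrArg₂ (· + ·) (?_ : _ = (0 : ℝ≥0∞)) ?_).trans (zero_add _)
    · refine Finset.sum_eq_zero fun m _ => ?_
      by_cases hm : ((i.1, m) : Mobile M) = i
      · exact Set.indicator_of_notMem (by simpa using hm) _
      · rw [Set.indicator_of_mem (by simpa using hm),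
          rxPower_eq_zero α φ hg (j := (i.1, m)) hr hm, ENNReal.ofReal_zero]
    · refine tsum_congr fun k => Finset.sum_congr rfl fun m _ => ?_
      have hm : ((k.1, m) : Mobile M) ∈ {j : Mobile M | j ≠ i} :=
        fun h0 => k.2 (congrArg Prod.fst h0)
      exact Set.indicator_of_mem hm _
  -- No summability is needed: if the series diverges, the real sum and `toReal` of the infinite sum
  -- both have the default value 0.
  rw [← h1, ENNReal.tsum_toReal_eq fun _ => ENNReal.ofReal_ne_top]
  exact tsum_congr fun j => (ENNReal.toReal_ofReal (rxPower_nonneg ..)).symm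

lemma tsum_lintegral_pathLoss [IsProbabilityMeasure Pr] (hN : N.IsTypical Pr lam R i)
    (hlam : 0 ≤ lam) :
    ∑' k : {k : ℕ // k ≠ i.1}, ∫⁻ ω, pathLoss α D (N.bs k ω) ∂Pr =
      ENNReal.ofReal lam * ∫⁻ x, pathLoss α D x :=
  hN.hppp.tsum_lintegral hlam (measurable_pathLoss α D)

/-- By Campbell's formula the left side is the mean path loss to all BSs times `Pbar`. The error
terms are the deviation of the mean powers from `Pbar` and the path loss to the inactive BSs. -/
lemma le_lintegral_interference_add [IsProbabilityMeasure Pr] (hN : N.IsTypical Pr lam R i)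
    (hlam : 0 ≤ lam)
    {P Pbar δ γ : ℝ} (hφ : N.IsPowerAllocation Pr L D P φ) (hD : 0 < D) (hα : 0 ≤ α)
    (hγ : 0 ≤ γ) (hPbar : 0 ≤ Pbar) (hmean : N.MeanPowerCondition Pr L D Pbar δ γ i φ) :
    ENNReal.ofReal Pbar * (ENNReal.ofReal lam * ∫⁻ x, pathLoss α D x) ≤
      ∫⁻ p, N.interference L D α φ i p ∂(jointLaw Pr M L) +
        (ENNReal.ofReal (|δ| * D ^ (-γ)) * (ENNReal.ofReal lam * ∫⁻ x, pathLoss α D x) +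
        ENNReal.ofReal Pbar * ∑' k : {k : ℕ // k ≠ i.1}, ∫⁻ ω, {ω | ¬ N.Active L D k ω}.indicator
          (fun ω => pathLoss α D (N.bs k ω)) ω ∂Pr) := by
  have hu : ∀ k, Measurable fun ω => pathLoss α D (N.bs k ω) := fun k =>
    (measurable_pathLoss α D).comp (hN.isMeasurable.1 k)
  have hsplit : ∀ k, ∫⁻ ω, pathLoss α D (N.bs k ω) ∂Pr =
      ∫⁻ ω, {ω | N.Active L D k ω}.indicator (fun ω => pathLoss α D (N.bs k ω)) ω ∂Pr +
      ∫⁻ ω, {ω | ¬ N.Active L D k ω}.indicator (fun ω => pathLoss α D (N.bs k ω)) ω ∂Pr := by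
    intro k
    have hA := hN.isMeasurable.active L D k
    rw [← lintegral_add_left ((hu k).indicator hA)]
    refine lintegral_congr fun ω => ?_
    exact (congrFun (Set.indicator_self_add_compl {ω | N.Active L D k ω}
      (fun ω => pathLoss α D (N.bs k ω))) ω).symm
  have hEJ : ∫⁻ p, N.interference L D α φ i p ∂(jointLaw Pr M L) =
      ∑' k : {k : ℕ // k ≠ i.1}, ∫⁻ p, N.meanCellPower L D α φ k p ∂(jointLaw Pr M L) := by
    unfold interference
    rw [lintegral_tsum fun k : {k : ℕ // k ≠ i.1} =>
      (hN.isMeasurable.cellPower hφ.measurable k).aemeasurable]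
    exact tsum_congr fun k => lintegral_cellPower hN hφ k.2
  rw [hEJ, ← tsum_lintegral_pathLoss hN hlam]
  conv_lhs => rw [tsum_congr fun k : {k : ℕ // k ≠ i.1} => hsplit k]
  rw [ENNReal.tsum_add, mul_add, ← add_assoc]
  refine add_le_add ?_ le_rfl
  rw [← ENNReal.tsum_mul_left, ← ENNReal.tsum_mul_left, ← ENNReal.tsum_add]
  refine ENNReal.tsum_le_tsum fun k => ?_
  exact ofReal_mul_lintegral_active_le hN hφ hD hα hγ hPbar hmean k.2

/-- The square of the sum splits into diagonal and off-diagonal pairs. On the diagonal, one factor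
of the path loss is bounded by `D^(-α)`. Off the diagonal, pairs of BSs at distance at least `ρ`
have power correlation close to `Pbar²`; for closer pairs the excess is at most `P²` and the area
`πρ²` is small. The radius `ρ` is left free. -/
lemma lintegral_interference_sq_le [IsProbabilityMeasure Pr] (hN : N.IsTypical Pr lam R i)
    (hlam : 0 ≤ lam)
    {P Pbar δ γ ρ : ℝ} (hφ : N.IsPowerAllocation Pr L D P φ) (hD : 0 < D) (hα : 0 ≤ α)
    (hγ : 0 ≤ γ) (hρ : 0 < ρ) (hcorr : N.PowerCorrelationCondition Pr L D P Pbar δ γ i φ) :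
    ∫⁻ p, N.interference L D α φ i p ^ 2 ∂(jointLaw Pr M L) ≤
      fourthMoment * ENNReal.ofReal (P ^ 2) *
          (ENNReal.ofReal lam * (ENNReal.ofReal (D ^ (-α)) * ∫⁻ x, pathLoss α D x)) +
        ENNReal.ofReal lam ^ 2 * ((∫⁻ x, pathLoss α D x) *
          (ENNReal.ofReal (Pbar ^ 2 + |δ| * ρ ^ (-γ)) * (∫⁻ x, pathLoss α D x) +
            ENNReal.ofReal (D ^ (-α) * P ^ 2 * (Real.pi * ρ ^ 2)))) := by
  have hpm := measurable_pathLoss α D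
  have hc := fun k => hN.isMeasurable.cellPower (L := L) (D := D) (α := α) (i := i) hφ.measurable k
  have hple : ∀ x, pathLoss α D x ≤ ENNReal.ofReal (D ^ (-α)) := fun x => by
    rw [pathLoss_eq_ofReal]
    exact ENNReal.ofReal_le_ofReal (pathLossReal_le hα hD _)
  have hcc : ∀ q : {q : {k : ℕ // k ≠ i.1} × {k : ℕ // k ≠ i.1} // q.1 ≠ q.2},
      AEMeasurable (fun p => N.cellPower L D α φ i q.1.1 p * N.cellPower L D α φ i q.1.2 p)
        (jointLaw Pr M L) := fun q => ((hc q.1.1).mul (hc q.1.2)).aemeasurable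
  simp_rw [interference, sq_tsum_eq_add_tsum_pair]
  rw [lintegral_add_left (Measurable.tsum fun k : {k : ℕ // k ≠ i.1} =>
      (hc k).pow_const 2),
    lintegral_tsum fun k : {k : ℕ // k ≠ i.1} => ((hc k).pow_const 2).aemeasurable,
    lintegral_tsum hcc]
  refine add_le_add ?_ ?_
  · refine (ENNReal.tsum_le_tsum fun k : {k : ℕ // k ≠ i.1} =>
      lintegral_cellPower_sq_le hN hφ k.2).trans ?_
    rw [ENNReal.tsum_mul_left]
    refine mul_le_mul_right ?_ _
    have h := hN.hppp.tsum_lintegral hlam (hpm.pow_const 2)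
    refine (le_of_eq h).trans (mul_le_mul_right ?_ _)
    rw [← lintegral_const_mul _ hpm]
    refine lintegral_mono fun x => ?_
    rw [sq]
    exact mul_le_mul_left (hple x) _
  · set F : Plane → Plane → ℝ≥0∞ := fun x y => pathLoss α D x * pathLoss α D y *
        ENNReal.ofReal (Pbar ^ 2 + min (P ^ 2) (|δ| * dist x y ^ (-γ))) with hF
    have hFm : Measurable (Function.uncurry F) := by
      simp only [hF, Function.uncurry_def]
      fun_prop
    have h := hN.hppp.tsum_pair_lintegral hlam hFm
    refine (ENNReal.tsum_le_tsum fun q => ?_).trans ((le_of_eq h).trans (mul_le_mul_right ?_ _))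
    · rw [lintegral_cellPower_mul_cellPower hN hφ q.1.1.2 q.1.2.2
        (fun h0 => q.2 (Subtype.ext h0))]
      exact lintegral_meanCellPower_mul_le hN hφ hD hα hcorr q.1.1.2 q.1.2.2
        (fun h0 => q.2 (Subtype.ext h0))
    · rw [← lintegral_mul_const _ hpm]
      refine lintegral_mono fun x => ?_
      have hball : ∫⁻ y, (Metric.ball x ρ).indicator
          (fun _ => ENNReal.ofReal (D ^ (-α) * P ^ 2)) y =
          ENNReal.ofReal (D ^ (-α) * P ^ 2 * (Real.pi * ρ ^ 2)) := by
        rw [lintegral_indicator_const Metric.isOpen_ball.measurableSet, volume_ball_plane x hρ.le,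
          ← ENNReal.ofReal_mul (by positivity)]
      have hsum : Measurable fun y => ENNReal.ofReal (Pbar ^ 2 + |δ| * ρ ^ (-γ)) * pathLoss α D y +
          (Metric.ball x ρ).indicator (fun _ => ENNReal.ofReal (D ^ (-α) * P ^ 2)) y :=
        (hpm.const_mul _).add (measurable_const.indicator Metric.isOpen_ball.measurableSet)
      rw [← hball, ← lintegral_const_mul _ hpm, ← lintegral_add_left (hpm.const_mul _),
        ← lintegral_const_mul _ hsum]
      refine lintegral_mono fun y => ?_
      simp only [hF]
      rw [mul_assoc]
      refine mul_le_mul_right ?_ _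
      by_cases hy : y ∈ Metric.ball x ρ
      · rw [Set.indicator_of_mem hy]
        have h1 : ENNReal.ofReal (Pbar ^ 2 + min (P ^ 2) (|δ| * dist x y ^ (-γ))) ≤
            ENNReal.ofReal (Pbar ^ 2 + |δ| * ρ ^ (-γ)) + ENNReal.ofReal (P ^ 2) := by
          rw [← ENNReal.ofReal_add (by positivity) (by positivity)]
          refine ENNReal.ofReal_le_ofReal ?_
          have := min_le_left (P ^ 2) (|δ| * dist x y ^ (-γ))
          have : 0 ≤ |δ| * ρ ^ (-γ) := by positivity
          linarith
        refine (mul_le_mul_right h1 _).trans ?_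
        rw [mul_add, mul_comm (pathLoss α D y), ENNReal.ofReal_mul (by positivity)]
        exact add_le_add le_rfl (mul_le_mul_left (hple y) _)
      · rw [Set.indicator_of_notMem hy, add_zero, mul_comm]
        refine mul_le_mul_left (ENNReal.ofReal_le_ofReal ?_) _
        have hd : ρ ≤ dist x y := by
          rw [dist_comm]; simpa using hy
        refine add_le_add le_rfl ((min_le_right _ _).trans ?_)
        exact mul_le_mul_of_nonneg_left
          (Real.rpow_le_rpow_of_nonpos hρ hd (neg_nonpos.2 hγ)) (abs_nonneg δ)

end Deployment

/-- Bound on a mean square deviation from bounds on the first two moments. -/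
lemma lintegral_toReal_sub_sq_le {X : Type*} [MeasurableSpace X] {μ : Measure X}
    [IsProbabilityMeasure μ] {J : X → ℝ≥0∞} (hJ : Measurable J) {a b e : ℝ} (ha : 0 ≤ a)
    (hb : 0 ≤ b) (he : 0 ≤ e) (h2 : ∫⁻ x, J x ^ 2 ∂μ ≤ ENNReal.ofReal b)
    (h1 : ENNReal.ofReal a ≤ ∫⁻ x, J x ∂μ + ENNReal.ofReal e) :
    ∫⁻ x, ENNReal.ofReal (((J x).toReal - a) ^ 2) ∂μ ≤ ENNReal.ofReal (b - a ^ 2 + 2 * a * e) := by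
  have hfin : ∀ᵐ x ∂μ, J x ≠ ∞ := by
    filter_upwards [ae_lt_top (hJ.pow_const 2) (h2.trans_lt ENNReal.ofReal_lt_top).ne] with x hx h0
    simp [h0] at hx
  have e2 : ∫⁻ x, J x ^ 2 ∂μ = ∫⁻ x, ENNReal.ofReal ((J x).toReal ^ 2) ∂μ := by
    refine lintegral_congr_ae ?_
    filter_upwards [hfin] with x hx
    rw [ENNReal.ofReal_pow ENNReal.toReal_nonneg, ENNReal.ofReal_toReal hx]
  have e1 : ∫⁻ x, J x ∂μ = ∫⁻ x, ENNReal.ofReal (J x).toReal ∂μ := by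
    refine lintegral_congr_ae ?_
    filter_upwards [hfin] with x hx
    rw [ENNReal.ofReal_toReal hx]
  have hL2 : Integrable (fun x => (J x).toReal ^ 2) μ :=
    ⟨(hJ.ennreal_toReal.pow_const 2).aestronglyMeasurable, by
      rw [hasFiniteIntegral_iff_ofReal (.of_forall fun x => by positivity), ← e2]
      exact h2.trans_lt ENNReal.ofReal_lt_top⟩
  have hmem : MemLp (fun x => (J x).toReal) 2 μ :=
    (memLp_two_iff_integrable_sq hJ.ennreal_toReal.aestronglyMeasurable).2 hL2
  have hL1 : Integrable (fun x => (J x).toReal) μ := hmem.integrable (by norm_num)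
  rw [e2, ← ofReal_integral_eq_lintegral_ofReal hL2 (.of_forall fun x => by positivity),
    ENNReal.ofReal_le_ofReal_iff hb] at h2
  rw [e1, ← ofReal_integral_eq_lintegral_ofReal hL1 (.of_forall fun x => ENNReal.toReal_nonneg),
    ← ENNReal.ofReal_add (integral_nonneg fun x => ENNReal.toReal_nonneg) he,
    ENNReal.ofReal_le_ofReal_iff (add_nonneg (integral_nonneg fun x => ENNReal.toReal_nonneg) he)]
    at h1
  have hd : Integrable (fun x => ((J x).toReal - a) ^ 2) μ :=
    (hmem.sub (memLp_const a)).integrable_sq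
  rw [← ofReal_integral_eq_lintegral_ofReal hd (.of_forall fun x => by positivity)]
  refine ENNReal.ofReal_le_ofReal ?_
  -- The mean enters with the coefficient `-2a ≤ 0`, so only its lower bound is needed.
  have h3 : ∫ x, ((J x).toReal - a) ^ 2 ∂μ =
      ∫ x, (J x).toReal ^ 2 ∂μ - 2 * a * ∫ x, (J x).toReal ∂μ + a ^ 2 := by
    have : ∀ x, ((J x).toReal - a) ^ 2 = (J x).toReal ^ 2 - 2 * a * (J x).toReal + a ^ 2 :=
      fun x => by ring
    simp_rw [this]
    have hi : Integrable (fun x => (J x).toReal ^ 2 - 2 * a * (J x).toReal) μ :=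
      hL2.sub (hL1.const_mul _)
    rw [integral_add hi (integrable_const _),
      integral_sub hL2 (hL1.const_mul _), integral_const_mul]
    simp
  rw [h3]
  nlinarith

/-- The scaled interference converges in mean square. -/
lemma Deployment.IsTypical.tendsto_interference [IsProbabilityMeasure Pr] (hN : N.IsTypical Pr lam R i)
    {α s P Pbar δ γ : ℝ} (hlam : 0 ≤ lam) (hα : 2 < α) (hs : 0 < s) (hPbar : 0 ≤ Pbar)
    (hγ : 0 < γ) (hload : s ^ 2 * Real.pi * lam * M < 1)
    {φ : (L : ℕ) → Mobile M → Ω × Fading M L → ℝ}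
    (hφ : ∀ L : ℕ, 1 ≤ L → N.IsPowerAllocation Pr L (zfRadius s L) P (φ L))
    (hmean : ∀ᶠ L : ℕ in atTop, N.MeanPowerCondition Pr L (zfRadius s L) Pbar δ γ i (φ L))
    (hcorr : ∀ᶠ L : ℕ in atTop,
      N.PowerCorrelationCondition Pr L (zfRadius s L) P Pbar δ γ i (φ L)) :
    Tendsto (fun L : ℕ => ∫⁻ p, ENNReal.ofReal (((L : ℝ) ^ (α / 2 - 1) *
        (N.interference L (zfRadius s L) α (φ L) i p).toReal -
          s ^ (2 - α) * (2 * Real.pi * Pbar * lam / (α - 2))) ^ 2) ∂(jointLaw Pr M L))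
      atTop (𝓝 0) := by
  obtain ⟨C, hC0, hC⟩ := hN.exists_tsum_lintegral_not_active_le hlam hs hload hα
  set κ : ℝ := 2 * Real.pi / (α - 2) with hκ
  have hκ0 : 0 ≤ κ := div_nonneg (by positivity) (by linarith)
  set F : ℝ := (fourthMoment).toReal with hF
  have hF0 : 0 ≤ F := ENNReal.toReal_nonneg
  have hFe : fourthMoment = ENNReal.ofReal F := (ENNReal.ofReal_toReal 
    (show fourthMoment ≠ ∞ from lintegral_norm_pow_four_stdComplexGaussian_lt_top.ne)).symm
  set q : ℝ := s ^ (2 - α) with hq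
  -- This is `c² (b - a² + 2ae)` below as a function of `D`; the leading term of `b`, with the
  -- factor `Pbar²`, has cancelled against `a²`.
  set G : ℝ → ℝ := fun D => q ^ 2 * (F * P ^ 2 * lam * κ * D ^ (-2 : ℝ) +
      lam ^ 2 * κ ^ 2 * |δ| * D ^ (-(γ / 2)) + lam ^ 2 * κ * P ^ 2 * Real.pi * D ^ (-1 : ℝ) +
      2 * Pbar * lam * κ * (|δ| * D ^ (-γ) * lam * κ + Pbar * C * D ^ (-2 : ℝ))) with hG
  have hGt : Tendsto G atTop (𝓝 0) := by
    have h1 := tendsto_rpow_neg_atTop (show (0 : ℝ) < 2 by norm_num)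
    have h2 := tendsto_rpow_neg_atTop (show (0 : ℝ) < γ / 2 by positivity)
    have h3 := tendsto_rpow_neg_atTop (show (0 : ℝ) < 1 by norm_num)
    have h4 := tendsto_rpow_neg_atTop hγ
    have := ((((h1.const_mul (F * P ^ 2 * lam * κ)).add
      (h2.const_mul (lam ^ 2 * κ ^ 2 * |δ|))).add
      (h3.const_mul (lam ^ 2 * κ * P ^ 2 * Real.pi))).add
      (((((h4.const_mul |δ|).mul_const lam).mul_const κ).add
        (h1.const_mul (Pbar * C))).const_mul (2 * Pbar * lam * κ))).const_mul (q ^ 2)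
    simpa [hG] using this
  have hlim : Tendsto (fun L : ℕ => ENNReal.ofReal (G (zfRadius s L))) atTop (𝓝 0) := by
    have := ENNReal.tendsto_ofReal (hGt.comp (tendsto_zfRadius hs))
    rwa [ENNReal.ofReal_zero] at this
  refine tendsto_of_tendsto_of_tendsto_of_le_of_le' tendsto_const_nhds hlim
    (.of_forall fun _ => zero_le) ?_
  filter_upwards [hmean, hcorr, hC, eventually_ge_atTop 1] with L hmeanL hcorrL hCL hL
  have hD := zfRadius_pos hs hL
  have hDsq := zfRadius_sq s L
  set D := zfRadius s L with hDdef
  have hφL := hφ L hL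
  -- With `ρ = √D`, the correlation error `ρ^(-γ)` vanishes and close pairs contribute `D^(-α) ρ² =
  -- D^(2-α) D^(-1)`, which is negligible as well.
  set ρ : ℝ := D ^ (1 / 2 : ℝ) with hρ
  have hρ0 : 0 < ρ := Real.rpow_pos_of_pos hD _
  have hρ2 : ρ ^ 2 = D := by
    rw [hρ, ← Real.rpow_natCast, ← Real.rpow_mul hD.le]; norm_num
  have hργ : ρ ^ (-γ) = D ^ (-(γ / 2)) := by
    rw [hρ, ← Real.rpow_mul hD.le]; congr 1; ring
  set v : ℝ := D ^ (2 - α) with hv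
  have hv0 : 0 < v := Real.rpow_pos_of_pos hD _
  have hvα : D ^ (-α) = v * D ^ (-2 : ℝ) := by
    rw [hv, ← Real.rpow_add hD]; congr 1; ring
  have hD2 : D * D ^ (-2 : ℝ) = D ^ (-1 : ℝ) := by
    nth_rw 1 [← Real.rpow_one D]
    rw [← Real.rpow_add hD]; norm_num
  have hL0 : (0 : ℝ) < L := by exact_mod_cast hL
  set c : ℝ := (L : ℝ) ^ (α / 2 - 1) with hc
  -- Since `L = (D/s)²`, the scaling `L^(α/2-1)` exactly compensates `D^(2-α)` and leaves the factor
  -- `s^(2-α)` of the limit.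
  have hcv : c * v = q := by
    have h1 : (L : ℝ) = (D / s) ^ (2 : ℝ) := by
      rw [Real.rpow_two, div_pow, hDsq]; field_simp
    rw [hc, hv, hq, h1, ← Real.rpow_mul (by positivity), Real.div_rpow hD.le hs.le,
      show 2 * (α / 2 - 1) = α - 2 by ring, show 2 - α = -(α - 2) by ring, Real.rpow_neg hD.le,
      Real.rpow_neg hs.le]
    have := Real.rpow_pos_of_pos hD (α - 2)
    have := Real.rpow_pos_of_pos hs (α - 2)
    field_simp
  have hα0 : 0 ≤ α := by linarith
  have hU : ∫⁻ x, pathLoss α D x = ENNReal.ofReal (κ * v) := lintegral_pathLoss hα hD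
  have hu0 : 0 ≤ κ * v := by positivity
  set a : ℝ := Pbar * (lam * (κ * v)) with ha
  set e : ℝ := |δ| * D ^ (-γ) * (lam * (κ * v)) + Pbar * (C * D ^ (-α)) with he
  set b : ℝ := F * P ^ 2 * (lam * (D ^ (-α) * (κ * v))) + lam ^ 2 * ((κ * v) *
    ((Pbar ^ 2 + |δ| * ρ ^ (-γ)) * (κ * v) + D ^ (-α) * P ^ 2 * (Real.pi * ρ ^ 2))) with hb
  have hmom := lintegral_toReal_sub_sq_le (μ := jointLaw Pr M L)
    (J := N.interference L D α (φ L) i) (hN.isMeasurable.interference hφL.measurable)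
    (a := a) (b := b) (e := e) (by positivity) (by positivity) (by positivity) (by
      refine (Deployment.lintegral_interference_sq_le hN hlam hφL hD hα0 hγ.le hρ0 hcorrL).trans
        (le_of_eq ?_)
      rw [hU, hFe, hb, ← ENNReal.ofReal_mul hF0, ← ENNReal.ofReal_mul (by positivity),
        ← ENNReal.ofReal_mul hlam, ← ENNReal.ofReal_mul (by positivity), ← ENNReal.ofReal_pow hlam,
        ← ENNReal.ofReal_mul (by positivity), ← ENNReal.ofReal_add (by positivity) (by positivity),
        ← ENNReal.ofReal_mul hu0, ← ENNReal.ofReal_mul (by positivity),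
        ← ENNReal.ofReal_add (by positivity) (by positivity)]) (by
      have h := Deployment.le_lintegral_interference_add hN hlam hφL hD hα0 hγ.le hPbar hmeanL
      rw [hU, ← ENNReal.ofReal_mul hlam, ← ENNReal.ofReal_mul hPbar,
        ← ENNReal.ofReal_mul (by positivity)] at h
      refine h.trans (add_le_add le_rfl ?_)
      rw [he, ENNReal.ofReal_add (by positivity) (by positivity), ENNReal.ofReal_mul hPbar]
      exact add_le_add le_rfl (mul_le_mul_right hCL _))
  have hcy : c * a = q * (2 * Real.pi * Pbar * lam / (α - 2)) := by
    rw [← hcv, ha, hκ]; ring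
  calc ∫⁻ p, ENNReal.ofReal ((c * (N.interference L D α (φ L) i p).toReal -
        q * (2 * Real.pi * Pbar * lam / (α - 2))) ^ 2) ∂(jointLaw Pr M L)
      = ENNReal.ofReal (c ^ 2) * ∫⁻ p, ENNReal.ofReal
          (((N.interference L D α (φ L) i p).toReal - a) ^ 2) ∂(jointLaw Pr M L) := by
        rw [← lintegral_const_mul' _ _ ENNReal.ofReal_ne_top]
        refine lintegral_congr fun p => ?_
        rw [← ENNReal.ofReal_mul (sq_nonneg c), ← hcy]
        congr 1
        ring
    _ ≤ ENNReal.ofReal (c ^ 2) * ENNReal.ofReal (b - a ^ 2 + 2 * a * e) :=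
        mul_le_mul_right hmom _
    _ = ENNReal.ofReal (G D) := by
        rw [← ENNReal.ofReal_mul (sq_nonneg c)]
        congr 1
        simp only [hG]
        rw [← hcv, ← hργ, ← hD2, hb, ha, he, hvα, hρ2]
        ring

end Cellular

/-! ### The gain of the desired signal -/

namespace Cellular

variable {M L : ℕ} {Ω : Type*} [MeasurableSpace Ω] {Pr : Measure Ω} {N : Deployment M Ω}
  {lam R : ℝ} {i : Mobile M} {D : ℝ}

namespace Deployment

/-- The vectors that are nulled exclude that of `j`, so resampling the latter projects a fresh
Gaussian vector onto a fixed subspace. -/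
lemma zfVec_refresh_self {j : Mobile M} {ω : Ω} {g : Fading M L} (h : N.Active L D j.1 ω)
    (hg : GeneralPosition g) (v : EuclideanSpace ℂ (Fin L)) :
    N.zfVec L D j (ω, refresh g j j.1 v) =
      (fadingSpan g (N.near D j.1 ω \ {j}) j.1)ᗮ.starProjection v := by
  obtain ⟨S, hS, hcard⟩ := h.exists_finset
  rw [← zfProj_mulVec_eq_starProjection (hS ▸ S.finite_toSet) (hS ▸ hg j.1 S (by omega)), zfVec]
  have hself : (fun n => refresh g j j.1 v (j, j.1, n)) = v.ofLp := by
    ext n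
    exact congrArg (fun w : EuclideanSpace ℂ (Fin L) => w n) (fadingVec_refresh_self g j j.1 v)
  simp only [hself]
  rw [zfProj_congr (g' := g) fun l hl n => ?_]
  exact congrArg (fun w : EuclideanSpace ℂ (Fin L) => w n)
    (fadingVec_refresh_of_ne g v (Or.inl hl.2))

lemma Active.finrank_fadingSpan_orthogonal {j : Mobile M} {ω : Ω} {g : Fading M L}
    (h : N.Active L D j.1 ω) (hg : GeneralPosition g) :
    1 ≤ Module.finrank ℂ (fadingSpan g (N.near D j.1 ω \ {j}) j.1)ᗮ ∧
    (Module.finrank ℂ (fadingSpan g (N.near D j.1 ω \ {j}) j.1)ᗮ : ℝ) + N.nearCount D j ω = L := by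
  obtain ⟨S, hS, hcard⟩ := h.exists_finset
  have h1 := Cellular.finrank_fadingSpan_orthogonal (hg j.1 S (by omega))
  have h2 : N.nearCount D j ω = S.card := by
    rw [nearCount, ← hS, Set.encard_coe_eq_coe_finsetCard]
    simp
  rw [hS] at h1
  refine ⟨by omega, ?_⟩
  rw [h2]
  exact_mod_cast h1

/-- Averages over the desired signal may be computed with a projection onto a fixed subspace. -/
lemma setLIntegral_zfVec_le [IsProbabilityMeasure Pr] (hN : N.IsMeasurable)
    {H : EuclideanSpace ℂ (Fin L) → ℝ≥0∞} (hH : Measurable H) {B : Ω → ℝ≥0∞} (hB : Measurable B)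
    (hle : ∀ ω (K : Submodule ℂ (EuclideanSpace ℂ (Fin L))), 1 ≤ Module.finrank ℂ K →
      (Module.finrank ℂ K : ℝ) + N.nearCount D i ω = L →
      ∫⁻ v, H (K.starProjection v) ∂(gaussVec (Fin L)) ≤ B ω) :
    ∫⁻ p in {p | N.Active L D i.1 p.1}, H (N.zfVec L D i p) ∂(jointLaw Pr M L) ≤
      ∫⁻ ω, B ω ∂Pr := by
  have hA := hN.active L D i.1
  have hE : MeasurableSet {p : Ω × Fading M L | N.Active L D i.1 p.1} := hA.preimage measurable_fst
  have hF : Measurable ({p : Ω × Fading M L | N.Active L D i.1 p.1}.indicator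
      fun p => H (N.zfVec L D i p)) := (hH.comp (hN.zfVec D i)).indicator hE
  rw [← lintegral_indicator hE, lintegral_jointLaw_indicator_refresh i i.1 hF hA
    (.of_forall fun p (hp : p ∉ {p : Ω × Fading M L | N.Active L D i.1 p.1}) =>
      Set.indicator_of_notMem hp _), ← lintegral_jointLaw_fst hB]
  refine lintegral_mono_ae ?_
  filter_upwards [ae_jointLaw_generalPosition (Pr := Pr)] with ⟨ω, g⟩ hg
  simp only at hg
  by_cases h : N.Active L D i.1 ω
  · rw [Set.indicator_of_mem (s := {ω | N.Active L D i.1 ω}) h]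
    have e : ∀ v, {p : Ω × Fading M L | N.Active L D i.1 p.1}.indicator
        (fun p => H (N.zfVec L D i p)) (ω, refresh g i i.1 v) =
        H ((fadingSpan g (N.near D i.1 ω \ {i}) i.1)ᗮ.starProjection v) := by
      intro v
      have hm : (ω, refresh g i i.1 v) ∈ {p : Ω × Fading M L | N.Active L D i.1 p.1} := h
      rw [Set.indicator_of_mem hm, zfVec_refresh_self h hg]
    simp_rw [e]
    have hfr := h.finrank_fadingSpan_orthogonal hg
    exact hle ω _ hfr.1 hfr.2
  · rw [Set.indicator_of_notMem (s := {ω | N.Active L D i.1 ω}) h]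
    exact zero_le

/-- The dimension of the subspace plus `nearCount` equals `L`. The deviation is therefore the
fluctuation of the squared norm around the dimension minus that of `nearCount` around its
approximate mean, divided by `L`. Both have second moments `O(L)`. -/
lemma IsTypical.exists_setLIntegral_zfVec_sub_sq_le [IsProbabilityMeasure Pr]
    (hN : N.IsTypical Pr lam R i) (hlam : 0 ≤ lam) {s : ℝ} (hs : 0 < s) :
    ∃ C : ℝ, 0 ≤ C ∧ ∀ᶠ L : ℕ in atTop,
      ∫⁻ p in {p | N.Active L (zfRadius s L) i.1 p.1},
        ENNReal.ofReal ((‖N.zfVec L (zfRadius s L) i p‖ ^ 2 / L -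
          (1 - s ^ 2 * Real.pi * lam * M)) ^ 2) ∂(jointLaw Pr M L) ≤ ENNReal.ofReal (C / L) := by
  obtain ⟨C, hC0, hC⟩ := hN.exists_lintegral_nearCount_zfRadius_le hlam hs
  set F : ℝ := (fourthMoment).toReal with hF
  have hF0 : 0 ≤ F := ENNReal.toReal_nonneg
  have hFe : fourthMoment = ENNReal.ofReal F := (ENNReal.ofReal_toReal
    (show fourthMoment ≠ ∞ from lintegral_norm_pow_four_stdComplexGaussian_lt_top.ne)).symm
  set A := s ^ 2 * Real.pi * lam * M with hA
  refine ⟨2 * (F + C), by positivity, ?_⟩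
  filter_upwards [hC, eventually_ge_atTop 1] with L hCL hL
  have hL0 : (0 : ℝ) < L := by exact_mod_cast hL
  set D := zfRadius s L
  have hn := hN.isMeasurable.nearCount D i
  have hn2 : Measurable fun ω => ENNReal.ofReal ((N.nearCount D i ω - A * L) ^ 2) := by fun_prop
  refine (setLIntegral_zfVec_le hN.isMeasurable
    (H := fun w => ENNReal.ofReal ((‖w‖ ^ 2 / L - (1 - A)) ^ 2))
    (B := fun ω => ENNReal.ofReal (2 / (L : ℝ) ^ 2) * (ENNReal.ofReal (F * L) +
      ENNReal.ofReal ((N.nearCount D i ω - A * L) ^ 2))) (by fun_prop)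
      (by fun_prop) ?_).trans ?_
  · intro ω K hK1 hK2
    set f : ℝ := (Module.finrank ℂ K : ℝ) with hf
    have hn0 : 0 ≤ N.nearCount D i ω := ENNReal.toReal_nonneg
    have hpt : ∀ v : EuclideanSpace ℂ (Fin L),
        ENNReal.ofReal ((‖K.starProjection v‖ ^ 2 / L - (1 - A)) ^ 2) ≤
        ENNReal.ofReal (2 / (L : ℝ) ^ 2) * (ENNReal.ofReal ((‖K.starProjection v‖ ^ 2 - f) ^ 2) +
          ENNReal.ofReal ((N.nearCount D i ω - A * L) ^ 2)) := by
      intro v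
      rw [← ENNReal.ofReal_add (by positivity) (by positivity),
        ← ENNReal.ofReal_mul (by positivity)]
      refine ENNReal.ofReal_le_ofReal ?_
      have e : ‖K.starProjection v‖ ^ 2 / L - (1 - A) =
          ((‖K.starProjection v‖ ^ 2 - f) - (N.nearCount D i ω - A * L)) / L := by
        rw [← hK2]
        have : (f + N.nearCount D i ω) ≠ 0 := by rw [hK2]; exact hL0.ne'
        field_simp
        ring
      rw [e, div_pow, div_mul_eq_mul_div]
      refine div_le_div_of_nonneg_right ?_ (by positivity)
      nlinarith [sq_nonneg ((‖K.starProjection v‖ ^ 2 - f) + (N.nearCount D i ω - A * L))]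
    refine (lintegral_mono hpt).trans ?_
    rw [lintegral_const_mul' _ _ ENNReal.ofReal_ne_top, lintegral_add_right _ measurable_const,
      lintegral_const, measure_univ, mul_one]
    refine mul_le_mul_right (add_le_add ?_ le_rfl) _
    refine (lintegral_norm_sq_starProjection_sub_sq_le K).trans ?_
    rw [hFe, ← ENNReal.ofReal_natCast, ← ENNReal.ofReal_mul hF0]
    refine ENNReal.ofReal_le_ofReal (mul_le_mul_of_nonneg_left ?_ hF0)
    linarith
  · rw [lintegral_const_mul' _ _ ENNReal.ofReal_ne_top, lintegral_add_left measurable_const,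
      lintegral_const, measure_univ, mul_one]
    refine (mul_le_mul_right (add_le_add le_rfl hCL) _).trans (le_of_eq ?_)
    rw [← ENNReal.ofReal_add (by positivity) (by positivity), ← ENNReal.ofReal_mul (by positivity)]
    congr 1
    field_simp

lemma setLIntegral_zfVec_rpow_le [IsProbabilityMeasure Pr] (hN : N.IsMeasurable) :
    ∫⁻ p in {p | N.Active L D i.1 p.1},
      ENNReal.ofReal (‖N.zfVec L D i p‖ ^ (-(1 / 2) : ℝ)) ∂(jointLaw Pr M L) ≤ negMoment := by
  refine (setLIntegral_zfVec_le hN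
    (H := fun w => ENNReal.ofReal (‖w‖ ^ (-(1 / 2) : ℝ)))
    (B := fun _ => negMoment) (by fun_prop) measurable_const fun ω K hK _ =>
      lintegral_norm_starProjection_rpow_le K hK).trans ?_
  simp

end Deployment

/-- Fourth power of `log t ≤ 16 t^(1/16)`. The exponent is chosen for `t` inversely proportional to
`‖Q g‖²`, when the bound is a multiple of `‖Q g‖^(-1/2)`, whose mean is finite. -/
lemma log_pow_four_le {t : ℝ} (ht : 1 ≤ t) : Real.log t ^ 4 ≤ 16 ^ 4 * t ^ (1 / 4 : ℝ) := by
  have h := Real.log_le_rpow_div (zero_le_one.trans ht) (show (0 : ℝ) < 1 / 16 by norm_num)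
  have h0 := Real.log_nonneg ht
  have h2 : (t ^ (1 / 16 : ℝ)) ^ 4 = t ^ (1 / 4 : ℝ) := by
    rw [← Real.rpow_natCast, ← Real.rpow_mul (zero_le_one.trans ht)]; norm_num
  calc Real.log t ^ 4 ≤ (t ^ (1 / 16 : ℝ) / (1 / 16)) ^ 4 := pow_le_pow_left₀ h0 h 4
    _ = 16 ^ 4 * t ^ (1 / 4 : ℝ) := by rw [← h2]; ring

lemma abs_log_sub_log_le {x y m : ℝ} (hm : 0 < m) (hx : m ≤ x) (hy : m ≤ y) :
    |Real.log x - Real.log y| ≤ |x - y| / m := by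
  have hx0 := hm.trans_le hx
  have hy0 := hm.trans_le hy
  have key : ∀ a b : ℝ, m ≤ a → m ≤ b → Real.log a - Real.log b ≤ |a - b| / m := by
    intro a b ha hb
    have ha0 := hm.trans_le ha
    have hb0 := hm.trans_le hb
    rw [← Real.log_div ha0.ne' hb0.ne']
    refine (Real.log_le_sub_one_of_pos (by positivity)).trans ?_
    rw [div_sub_one hb0.ne']
    calc (a - b) / b ≤ |a - b| / b := by gcongr; exact le_abs_self _
      _ ≤ |a - b| / m := by gcongr
  rw [abs_le]
  constructor
  · have := key y x hy hx
    rw [abs_sub_comm] at this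
    linarith
  · exact key x y hx hy

/-- The logarithm of a positive variable deviates little from that of a constant if the variable
does and is rarely small. -/
lemma sq_log_sub_log_le {x c t : ℝ} (hx : 0 < x) (hc : 0 < c) (hc1 : c ≤ 1) (ht : 0 < t) :
    (Real.log x - Real.log c) ^ 2 ≤
      4 / c ^ 2 * (1 + t) * (x - c) ^ 2 + 16 ^ 4 * (t⁻¹ * x ^ (-(1 / 4) : ℝ)) := by
  rcases le_or_gt (c / 2) x with h | h
  · have h1 := abs_log_sub_log_le (by positivity : 0 < c / 2) h (by linarith : c / 2 ≤ c)
    have h2 : (Real.log x - Real.log c) ^ 2 ≤ (|x - c| / (c / 2)) ^ 2 := by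
      rw [← sq_abs]
      exact pow_le_pow_left₀ (abs_nonneg _) h1 2
    have h3 : (|x - c| / (c / 2)) ^ 2 = 4 / c ^ 2 * (x - c) ^ 2 := by
      rw [div_pow, sq_abs]; field_simp; norm_num
    have h4 : 0 ≤ 4 / c ^ 2 * t * (x - c) ^ 2 := by positivity
    have h5 : 0 ≤ 16 ^ 4 * (t⁻¹ * x ^ (-(1 / 4) : ℝ)) := by positivity
    nlinarith
  · have hcx : 1 ≤ c / x := by rw [le_div_iff₀ hx]; linarith
    have h1 : (Real.log x - Real.log c) ^ 2 = Real.log (c / x) ^ 2 := by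
      rw [Real.log_div hc.ne' hx.ne']; ring
    set l := Real.log (c / x)
    -- The parameter `t` balances two bounds: `t` is charged to the event that `x` is small, which
    -- is rare, and `l⁴/t` to the negative moment.
    have h2 : l ^ 2 ≤ t + t⁻¹ * l ^ 4 := by
      have h3 : 0 ≤ (t - l ^ 2) ^ 2 / t := by positivity
      have h4 : (t - l ^ 2) ^ 2 / t = t - 2 * l ^ 2 + t⁻¹ * l ^ 4 := by
        field_simp; ring
      have h5 : 0 ≤ l ^ 2 := sq_nonneg l
      linarith
    have h3 : l ^ 4 ≤ 16 ^ 4 * x ^ (-(1 / 4) : ℝ) := by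
      refine (log_pow_four_le hcx).trans ?_
      refine mul_le_mul_of_nonneg_left ?_ (by norm_num)
      rw [Real.div_rpow hc.le hx.le, Real.rpow_neg hx.le, div_eq_mul_inv]
      have : c ^ (1 / 4 : ℝ) ≤ 1 := Real.rpow_le_one hc.le hc1 (by norm_num)
      have h6 : 0 ≤ (x ^ (1 / 4 : ℝ))⁻¹ := by positivity
      nlinarith
    have h4 : t ≤ 4 / c ^ 2 * (1 + t) * (x - c) ^ 2 := by
      -- Chebyshev's inequality in pointwise form: `x < c/2` forces `|x - c| > c/2`.
      have h5 : 1 ≤ 4 / c ^ 2 * (x - c) ^ 2 := by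
        rw [div_mul_eq_mul_div, le_div_iff₀ (by positivity)]
        nlinarith
      nlinarith
    rw [h1]
    have h7 : t⁻¹ * l ^ 4 ≤ t⁻¹ * (16 ^ 4 * x ^ (-(1 / 4) : ℝ)) :=
      mul_le_mul_of_nonneg_left h3 (by positivity)
    linarith

namespace Deployment

/-- The logarithm of the scaled gain of the desired signal converges in mean square. -/
lemma IsTypical.tendsto_log_zfVec [IsProbabilityMeasure Pr]
    (hN : N.IsTypical Pr lam R i) (hlam : 0 ≤ lam) {s : ℝ} (hs : 0 < s)
    (hload : s ^ 2 * Real.pi * lam * M < 1) :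
    Tendsto (fun L : ℕ => ∫⁻ p in {p | N.Active L (zfRadius s L) i.1 p.1},
        ENNReal.ofReal ((Real.log (‖N.zfVec L (zfRadius s L) i p‖ ^ 2 / L) -
          Real.log (1 - s ^ 2 * Real.pi * lam * M)) ^ 2) ∂(jointLaw Pr M L)) atTop (𝓝 0) := by
  obtain ⟨C, hC0, hC⟩ := hN.exists_setLIntegral_zfVec_sub_sq_le hlam hs
  have hpi := Real.pi_pos
  set c := 1 - s ^ 2 * Real.pi * lam * M with hc
  have hc0 : 0 < c := by linarith
  have hc1 : c ≤ 1 := by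
    have : 0 ≤ s ^ 2 * Real.pi * lam * M := by positivity
    linarith
  set F : ℝ := negMoment.toReal with hF
  have hF0 : 0 ≤ F := ENNReal.toReal_nonneg
  have hFe : negMoment = ENNReal.ofReal F := (ENNReal.ofReal_toReal
    (show negMoment ≠ ∞ from lintegral_norm_rpow_neg_stdComplexGaussian_lt_top.ne)).symm
  set G : ℝ → ℝ := fun x => 4 / c ^ 2 * C * (x ^ (-1 : ℝ) + x ^ (-(1 / 2) : ℝ)) +
    16 ^ 4 * F * x ^ (-(1 / 4) : ℝ) with hG
  have hGt : Tendsto G atTop (𝓝 0) := by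
    have h1 := tendsto_rpow_neg_atTop (show (0 : ℝ) < 1 by norm_num)
    have h2 := tendsto_rpow_neg_atTop (show (0 : ℝ) < 1 / 2 by norm_num)
    have h3 := tendsto_rpow_neg_atTop (show (0 : ℝ) < 1 / 4 by norm_num)
    have := ((h1.add h2).const_mul (4 / c ^ 2 * C)).add (h3.const_mul (16 ^ 4 * F))
    simpa [hG] using this
  have hlim : Tendsto (fun L : ℕ => ENNReal.ofReal (G L)) atTop (𝓝 0) := by
    have := ENNReal.tendsto_ofReal (hGt.comp (tendsto_natCast_atTop_atTop (R := ℝ)))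
    rwa [ENNReal.ofReal_zero] at this
  refine tendsto_of_tendsto_of_tendsto_of_le_of_le' tendsto_const_nhds hlim
    (.of_forall fun _ => zero_le) ?_
  filter_upwards [hC, eventually_ge_atTop 1] with L hCL hL
  have hL0 : (0 : ℝ) < L := by exact_mod_cast hL
  set D := zfRadius s L
  -- The deviation term is of order `(1 + t)/L`, and the negative moment of `‖Q g‖²/L` contributes
  -- order `L^(1/4)/t`; with `t = √L` both tend to 0.
  set t : ℝ := (L : ℝ) ^ (1 / 2 : ℝ) with ht
  have ht0 : 0 < t := Real.rpow_pos_of_pos hL0 _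
  have hE : MeasurableSet {p : Ω × Fading M L | N.Active L D i.1 p.1} :=
    (hN.isMeasurable.active L D i.1).preimage measurable_fst
  have hz := hN.isMeasurable.zfVec (L := L) D i
  have hpt : ∀ᵐ p ∂((jointLaw Pr M L).restrict {p | N.Active L D i.1 p.1}),
      ENNReal.ofReal ((Real.log (‖N.zfVec L D i p‖ ^ 2 / L) - Real.log c) ^ 2) ≤
      ENNReal.ofReal (4 / c ^ 2 * (1 + t)) *
        ENNReal.ofReal ((‖N.zfVec L D i p‖ ^ 2 / L - c) ^ 2) +
      ENNReal.ofReal (16 ^ 4 * (L : ℝ) ^ (-(1 / 4) : ℝ)) *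
        ENNReal.ofReal (‖N.zfVec L D i p‖ ^ (-(1 / 2) : ℝ)) := by
    filter_upwards [ae_restrict_mem hE, ae_restrict_of_ae
      (ae_jointLaw_generalPosition (Pr := Pr))] with p hp hg
    have hw : 0 < ‖N.zfVec L D i p‖ := norm_pos_iff.2 (zfVec_ne_zero hp hg)
    set w := ‖N.zfVec L D i p‖
    rw [← ENNReal.ofReal_mul (by positivity), ← ENNReal.ofReal_mul (by positivity),
      ← ENNReal.ofReal_add (by positivity) (by positivity)]
    refine ENNReal.ofReal_le_ofReal ((sq_log_sub_log_le (x := w ^ 2 / L) (by positivity) hc0 hc1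
      ht0).trans (le_of_eq ?_))
    congr 1
    have e1 : (w ^ 2) ^ (-(1 / 4) : ℝ) = w ^ (-(1 / 2) : ℝ) := by
      rw [← Real.rpow_two, ← Real.rpow_mul hw.le]; norm_num
    have e2 : t⁻¹ * ((L : ℝ) ^ (-(1 / 4) : ℝ))⁻¹ = (L : ℝ) ^ (-(1 / 4) : ℝ) := by
      rw [ht, ← Real.rpow_neg hL0.le, ← Real.rpow_neg hL0.le, ← Real.rpow_add hL0]; norm_num
    rw [Real.div_rpow (by positivity) hL0.le, e1, div_eq_mul_inv]
    nth_rw 2 [← e2]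
    ring
  refine (lintegral_mono_ae hpt).trans ?_
  rw [lintegral_add_left (by fun_prop), lintegral_const_mul' _ _ ENNReal.ofReal_ne_top,
    lintegral_const_mul' _ _ ENNReal.ofReal_ne_top]
  refine (add_le_add (mul_le_mul_right hCL _) (mul_le_mul_right
    (setLIntegral_zfVec_rpow_le hN.isMeasurable) _)).trans (le_of_eq ?_)
  rw [hFe, ← ENNReal.ofReal_mul (by positivity), ← ENNReal.ofReal_mul (by positivity),
    ← ENNReal.ofReal_add (by positivity) (by positivity)]
  congr 1
  have e1 : (L : ℝ)⁻¹ = (L : ℝ) ^ (-1 : ℝ) := (Real.rpow_neg_one _).symm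
  have e2 : t * (L : ℝ) ^ (-1 : ℝ) = (L : ℝ) ^ (-(1 / 2) : ℝ) := by
    rw [ht, ← Real.rpow_add hL0]; norm_num
  simp only [hG]
  rw [← e2, div_eq_mul_inv C, e1]
  ring

end Deployment

end Cellular

namespace Cellular

/-! ### Elementary inequalities for logarithms -/

lemma log_one_add_mul_le {a b : ℝ} (ha : 0 ≤ a) (hb : 0 ≤ b) :
    Real.log (1 + a * b) ≤ Real.log (1 + a) + Real.log (1 + b) := by
  rw [← Real.log_mul (by positivity) (by positivity)]
  exact Real.log_le_log (by positivity) (by nlinarith)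

lemma log_one_add_rpow_neg_le {x α : ℝ} (hx : 0 < x) (hα : 0 ≤ α) :
    Real.log (1 + x ^ (-α)) ≤ Real.log 2 + α * |Real.log x| := by
  have h1 : x ^ (-α) ≤ Real.exp (α * |Real.log x|) := by
    rw [Real.rpow_def_of_pos hx]
    refine Real.exp_le_exp.2 ?_
    nlinarith [neg_abs_le (Real.log x)]
  have h2 : 1 ≤ Real.exp (α * |Real.log x|) := Real.one_le_exp (by positivity)
  have h3 : 0 ≤ x ^ (-α) := Real.rpow_nonneg hx.le _
  calc Real.log (1 + x ^ (-α)) ≤ Real.log (2 * Real.exp (α * |Real.log x|)) :=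
        Real.log_le_log (by positivity) (by linarith)
    _ = _ := by rw [Real.log_mul two_ne_zero (Real.exp_ne_zero _), Real.log_exp]

/-- For `x ≤ y`, `(1 + A y)/(1 + A x) ≤ y/x`. The bound is uniform in `A`, so the allocated power,
the distance and the factor `L^(α/2)` disappear from the error. -/
lemma abs_log_one_add_mul_sub_le {A x y : ℝ} (hA : 0 ≤ A) (hx : 0 < x) (hy : 0 < y) :
    |Real.log (1 + A * x) - Real.log (1 + A * y)| ≤ |Real.log x - Real.log y| := by
  have key : ∀ x y : ℝ, 0 < x → 0 < y → x ≤ y →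
      |Real.log (1 + A * x) - Real.log (1 + A * y)| ≤ |Real.log x - Real.log y| := by
    intro x y hx hy h
    have h1 : Real.log (1 + A * x) ≤ Real.log (1 + A * y) :=
      Real.log_le_log (by positivity) (by gcongr)
    have h2 : Real.log x ≤ Real.log y := Real.log_le_log hx h
    rw [abs_sub_comm, abs_of_nonneg (by linarith), abs_sub_comm (Real.log x),
      abs_of_nonneg (by linarith), ← Real.log_div (by positivity) (by positivity),
      ← Real.log_div (by positivity) (by positivity)]
    refine Real.log_le_log (by positivity) ?_
    rw [div_le_div_iff₀ (by positivity) hx]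
    nlinarith
  rcases le_total x y with h | h
  · exact key x y hx hy h
  · rw [abs_sub_comm, abs_sub_comm (Real.log x)]
    exact key y x hy hx h

/-! ### Pathwise bounds on the rates -/

variable {M L : ℕ} {Ω : Type*} [MeasurableSpace Ω] {Pr : Measure Ω} {N : Deployment M Ω}
  {lam R : ℝ} {i : Mobile M}

namespace Deployment

variable {D α : ℝ} {φ : Mobile M → Ω × Fading M L → ℝ}

lemma IsPowerAllocation.ae_sq_le {P : ℝ} (hφ : N.IsPowerAllocation Pr L D P φ) (j : Mobile M) :
    ∀ᵐ p ∂(jointLaw Pr M L), φ j p ^ 2 ≤ P := by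
  filter_upwards [hφ.power_le] with p hp
  exact (Finset.single_le_sum (f := fun m => φ (j.1, m) p ^ 2) (fun m _ => sq_nonneg _)
    (Finset.mem_univ j.2)).trans (hp j.1)

/-- The asymptotic rate in terms of `P`, the number of antennas, and the distance to the BS. -/
lemma log_two_mul_asympRate_le {s μ Pbar P : ℝ} {p : Ω × Fading M L} (hL : 1 ≤ L) (hlam : 0 ≤ lam)
    (hα : 2 < α) (hs : 0 < s) (hμ : 0 < μ) (hPbar : 0 ≤ Pbar)
    (hload : s ^ 2 * Real.pi * lam * M < 1) (hr : 0 < N.r i i.1 p.1) (hP : φ i p ^ 2 ≤ P) :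
    0 ≤ N.asympRate L α s lam μ Pbar φ i p ∧
    Real.log 2 * N.asympRate L α s lam μ Pbar φ i p ≤
      (2 * Real.log 2 + Real.log (1 + P / μ) + 2 * α) * (L : ℝ) ^ (1 / 4 : ℝ) +
        α * |Real.log (N.r i i.1 p.1)| := by
  have hL1 : (1 : ℝ) ≤ L := by exact_mod_cast hL
  have hL0 : (0 : ℝ) < L := by linarith
  have hpi := Real.pi_pos
  have hα2 : 0 < α - 2 := by linarith
  have hα0 : 0 < α := by linarith
  set c := 1 - s ^ 2 * Real.pi * lam * M with hc
  have hc0 : 0 < c := by linarith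
  have hc1 : c ≤ 1 := by
    have : 0 ≤ s ^ 2 * Real.pi * lam * M := by positivity
    linarith
  have hy : 0 ≤ s ^ (2 - α) * (2 * Real.pi * Pbar * lam / (α - 2)) := by positivity
  set y := s ^ (2 - α) * (2 * Real.pi * Pbar * lam / (α - 2))
  set x := N.r i i.1 p.1
  have hxα : 0 < x ^ (-α) := Real.rpow_pos_of_pos hr _
  have hP0 : 0 ≤ P := (sq_nonneg _).trans hP
  have hl2 : 0 < Real.log 2 := Real.log_pos one_lt_two
  have hR : N.asympRate L α s lam μ Pbar φ i p =
      Real.log (1 + (L : ℝ) ^ (α / 2) * ((c * φ i p ^ 2 * x ^ (-α)) / (y + μ))) / Real.log 2 := rfl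
  have harg : 0 ≤ (L : ℝ) ^ (α / 2) * ((c * φ i p ^ 2 * x ^ (-α)) / (y + μ)) := by positivity
  rw [hR, mul_div_cancel₀ _ hl2.ne']
  refine ⟨div_nonneg (Real.log_nonneg (by linarith)) hl2.le, ?_⟩
  have hfrac : (c * φ i p ^ 2 * x ^ (-α)) / (y + μ) ≤ P / μ * x ^ (-α) := by
    rw [div_mul_eq_mul_div]
    refine div_le_div₀ (by positivity) ?_ hμ (by linarith)
    refine mul_le_mul_of_nonneg_right ?_ hxα.le
    nlinarith [sq_nonneg (φ i p)]
  have h1 : Real.log (1 + (L : ℝ) ^ (α / 2) * ((c * φ i p ^ 2 * x ^ (-α)) / (y + μ))) ≤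
      Real.log (1 + (L : ℝ) ^ (α / 2) * (P / μ * x ^ (-α))) :=
    Real.log_le_log (by linarith) (by gcongr)
  have h2 := log_one_add_mul_le (a := (L : ℝ) ^ (α / 2)) (b := P / μ * x ^ (-α))
    (by positivity) (by positivity)
  have h3 := log_one_add_mul_le (a := P / μ) (b := x ^ (-α)) (by positivity) (by positivity)
  have h4 := log_one_add_rpow_neg_le hr hα0.le
  have h5 : Real.log (1 + (L : ℝ) ^ (α / 2)) ≤ Real.log 2 + α / 2 * Real.log L := by
    rw [← Real.log_rpow hL0, ← Real.log_mul two_ne_zero (by positivity)]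
    refine Real.log_le_log (by positivity) ?_
    have := Real.one_le_rpow hL1 (by positivity : 0 ≤ α / 2)
    linarith
  -- The crude power suffices: its square `√L` is still beaten by the probability `O(1/L)` that the
  -- serving BS is inactive.
  have h6 : Real.log L ≤ 4 * (L : ℝ) ^ (1 / 4 : ℝ) := by
    have := Real.log_le_rpow_div hL0.le (show (0 : ℝ) < 1 / 4 by norm_num)
    linarith
  have h7 : 1 ≤ (L : ℝ) ^ (1 / 4 : ℝ) := Real.one_le_rpow hL1 (by norm_num)
  have h8 : 0 ≤ Real.log (1 + P / μ) := Real.log_nonneg (by linarith [div_nonneg hP0 hμ.le])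
  have h9 : α / 2 * Real.log L ≤ 2 * α * (L : ℝ) ^ (1 / 4 : ℝ) := by nlinarith
  nlinarith

lemma rate_nonneg {σ2 : ℝ} (hσ : 0 < σ2) (p : Ω × Fading M L) :
    0 ≤ N.rate L D α σ2 φ i p ∧ N.sinr L D α σ2 φ i p ≤ N.rxPower L D α φ i i p / σ2 ∧
      0 ≤ N.sinr L D α σ2 φ i p := by
  have h0 : 0 ≤ ∑' j : {j : Mobile M // j ≠ i}, N.rxPower L D α φ i j p :=
    tsum_nonneg fun j => rxPower_nonneg ..
  have h1 := N.rxPower_nonneg (L := L) (D := D) α φ i i p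
  have h2 : 0 ≤ N.sinr L D α σ2 φ i p := div_nonneg h1 (by linarith)
  refine ⟨div_nonneg (Real.log_nonneg (by linarith)) (Real.log_nonneg one_le_two), ?_, h2⟩
  exact div_le_div_of_nonneg_left h1 hσ (by linarith)

/-- The interference is dropped and the beam gain bounded by the norm of the channel. This serves
only for square integrability at fixed `L`, so no uniformity in `L` is sought. -/
lemma log_two_mul_rate_le {σ2 P : ℝ} (hσ : 0 < σ2) (hα : 0 ≤ α) {p : Ω × Fading M L}
    (hr : 0 < N.r i i.1 p.1) (hP : φ i p ^ 2 ≤ P) :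
    Real.log 2 * N.rate L D α σ2 φ i p ≤
      Real.log (1 + P / σ2) + (Real.log 2 + α * |Real.log (N.r i i.1 p.1)|) +
        2 * Real.sqrt (1 + ‖fadingVec p.2 i i.1‖ ^ 2) := by
  have hl2 : 0 < Real.log 2 := Real.log_pos one_lt_two
  obtain ⟨-, h1, h0⟩ := rate_nonneg (N := N) (L := L) (D := D) (α := α) (φ := φ) (i := i) hσ p
  have hxα : 0 < N.r i i.1 p.1 ^ (-α) := Real.rpow_pos_of_pos hr _
  have hP0 : 0 ≤ P := (sq_nonneg _).trans hP
  set G := ‖fadingVec p.2 i i.1‖ ^ 2 with hG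
  have hG0 : 0 ≤ G := sq_nonneg _
  have h2 : N.sinr L D α σ2 φ i p ≤ P / σ2 * (N.r i i.1 p.1 ^ (-α) * G) := by
    refine h1.trans ?_
    rw [div_mul_eq_mul_div]
    refine div_le_div_of_nonneg_right ((rxPower_le (ω := p.1) (g := p.2) α φ i i).trans ?_) hσ.le
    rw [← hG, mul_comm (N.r i i.1 p.1 ^ (-α)), mul_assoc]
    exact mul_le_mul_of_nonneg_right hP (by positivity)
  rw [rate, Real.logb, mul_div_cancel₀ _ hl2.ne']
  have h3 : Real.log (1 + N.sinr L D α σ2 φ i p) ≤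
      Real.log (1 + P / σ2 * (N.r i i.1 p.1 ^ (-α) * G)) :=
    Real.log_le_log (by linarith) (by linarith)
  have h4 := log_one_add_mul_le (a := P / σ2) (b := N.r i i.1 p.1 ^ (-α) * G)
    (by positivity) (by positivity)
  have h5 := log_one_add_mul_le (a := N.r i i.1 p.1 ^ (-α)) (b := G) (by positivity) hG0
  have h6 := log_one_add_rpow_neg_le hr hα
  -- The square root makes the bound square integrable by the second moment of the fading vector
  -- alone.
  have h7 : Real.log (1 + G) ≤ 2 * Real.sqrt (1 + G) := by
    have h8 : 0 < Real.sqrt (1 + G) := Real.sqrt_pos.2 (by linarith)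
    have h9 := Real.log_le_sub_one_of_pos h8
    rw [Real.log_sqrt (by linarith)] at h9
    linarith
  linarith

/-- Rate deviation when the serving BS is active. -/
lemma sq_rate_sub_asympRate_le {s μ Pbar : ℝ} (hL : 1 ≤ L) (hlam : 0 ≤ lam)
    (hα : 2 < α) (hs : 0 < s) (hμ : 0 < μ) (hPbar : 0 ≤ Pbar)
    (hload : s ^ 2 * Real.pi * lam * M < 1) {ω : Ω} {g : Fading M L} (hg : GeneralPosition g)
    (h : N.Regular R i ω) (hact : N.Active L D i.1 ω) (hD : R < D) :
    (N.rate L D α (μ * (L : ℝ) ^ (-(α / 2 - 1))) φ i (ω, g) -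
      N.asympRate L α s lam μ Pbar φ i (ω, g)) ^ 2 ≤
    2 / Real.log 2 ^ 2 * ((Real.log (‖N.zfVec L D i (ω, g)‖ ^ 2 / L) -
      Real.log (1 - s ^ 2 * Real.pi * lam * M)) ^ 2 +
      (μ ^ 2)⁻¹ * ((L : ℝ) ^ (α / 2 - 1) * (N.interference L D α φ i (ω, g)).toReal -
        s ^ (2 - α) * (2 * Real.pi * Pbar * lam / (α - 2))) ^ 2) := by
  have hL0 : (0 : ℝ) < L := by exact_mod_cast hL
  have hpi := Real.pi_pos
  have hα2 : 0 < α - 2 := by linarith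
  have hl2 : 0 < Real.log 2 := Real.log_pos one_lt_two
  have hr0 : 0 ≤ N.r i i.1 ω := dist_nonneg
  set c := 1 - s ^ 2 * Real.pi * lam * M with hc
  have hc0 : 0 < c := by linarith
  have hy : 0 ≤ s ^ (2 - α) * (2 * Real.pi * Pbar * lam / (α - 2)) := by positivity
  set I := (N.interference L D α φ i (ω, g)).toReal with hI
  have hI0 : 0 ≤ I := ENNReal.toReal_nonneg
  have hw : 0 < ‖N.zfVec L D i (ω, g)‖ := norm_pos_iff.2 (zfVec_ne_zero hact hg)
  set ζ := α / 2 - 1 with hζ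
  have hLζ : 0 < (L : ℝ) ^ ζ := Real.rpow_pos_of_pos hL0 _
  have hA : 0 ≤ (L : ℝ) ^ (α / 2) * (φ i (ω, g) ^ 2 * N.r i i.1 ω ^ (-α)) := by positivity
  set A := (L : ℝ) ^ (α / 2) * (φ i (ω, g) ^ 2 * N.r i i.1 ω ^ (-α)) with hAdef
  set X := ‖N.zfVec L D i (ω, g)‖ ^ 2 / L with hX
  have hX0 : 0 < X := by positivity
  -- Numerator and denominator are multiplied by `L^ζ`: the noise becomes `μ`, and `L^ζ ‖Q g‖² =
  -- L^(α/2) X`.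
  have e1 : N.rate L D α (μ * (L : ℝ) ^ (-ζ)) φ i (ω, g) =
      Real.log (1 + A * (X / ((L : ℝ) ^ ζ * I + μ))) / Real.log 2 := by
    rw [rate, Real.logb, sinr, tsum_rxPower_eq hg h hD, rxPower_self α φ hg hact, ← hI,
      Real.rpow_neg hL0.le]
    congr 3
    have hLα : (L : ℝ) ^ (α / 2) = (L : ℝ) ^ ζ * L := by
      nth_rw 3 [← Real.rpow_one (L : ℝ)]
      rw [← Real.rpow_add hL0, hζ]; congr 1; ring
    have hden : (L : ℝ) ^ ζ * I + μ ≠ 0 := by positivity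
    have hden2 : I + μ * ((L : ℝ) ^ ζ)⁻¹ ≠ 0 := by positivity
    have e : I + μ * ((L : ℝ) ^ ζ)⁻¹ = ((L : ℝ) ^ ζ * I + μ) / (L : ℝ) ^ ζ := by field_simp
    rw [hAdef, hX, hLα, e]
    field_simp
  set y := s ^ (2 - α) * (2 * Real.pi * Pbar * lam / (α - 2))
  have e2 : N.asympRate L α s lam μ Pbar φ i (ω, g) =
      Real.log (1 + A * (c / (y + μ))) / Real.log 2 := by
    rw [asympRate, Real.logb]
    congr 3
    rw [hAdef]
    ring
  have hden : 0 < (L : ℝ) ^ ζ * I + μ := by positivity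
  have hyμ : 0 < y + μ := by positivity
  have h1 := abs_log_one_add_mul_sub_le hA (x := X / ((L : ℝ) ^ ζ * I + μ)) (y := c / (y + μ))
    (by positivity) (by positivity)
  rw [Real.log_div hX0.ne' hden.ne', Real.log_div hc0.ne' hyμ.ne'] at h1
  -- Thanks to the noise both denominators are at least `μ`, where the logarithm is `1/μ`-Lipschitz;
  -- mean square convergence of the interference then needs no lower bound on it.
  have h2 := abs_log_sub_log_le hμ (x := (L : ℝ) ^ ζ * I + μ) (y := y + μ)
    (by linarith [mul_nonneg hLζ.le hI0]) (by linarith)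
  rw [add_sub_add_right_eq_sub] at h2
  set a := Real.log X - Real.log c
  set b := Real.log ((L : ℝ) ^ ζ * I + μ) - Real.log (y + μ)
  set d := (L : ℝ) ^ ζ * I - y
  rw [show Real.log X - Real.log ((L : ℝ) ^ ζ * I + μ) - (Real.log c - Real.log (y + μ)) = a - b by
    ring] at h1
  rw [e1, e2, ← sub_div, div_pow, div_mul_eq_mul_div]
  refine div_le_div_of_nonneg_right ?_ (by positivity)
  have h3 : b ^ 2 ≤ (μ ^ 2)⁻¹ * d ^ 2 := by
    have : b ^ 2 ≤ (|d| / μ) ^ 2 := by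
      rw [← sq_abs]
      exact pow_le_pow_left₀ (abs_nonneg _) h2 2
    refine this.trans (le_of_eq ?_)
    rw [div_pow, sq_abs]; field_simp
  rw [← sq_abs]
  calc _ ≤ |a - b| ^ 2 := pow_le_pow_left₀ (abs_nonneg _) h1 2
    _ = (a - b) ^ 2 := sq_abs _
    _ ≤ 2 * (a ^ 2 + b ^ 2) := by nlinarith [sq_nonneg (a + b)]
    _ ≤ _ := by linarith

/-- Rate deviation when the serving BS is inactive. -/
lemma sq_rate_sub_asympRate_le_of_not_active {s μ Pbar P σ2 : ℝ} (hL : 1 ≤ L) (hlam : 0 ≤ lam)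
    (hα : 2 < α) (hs : 0 < s) (hμ : 0 < μ) (hPbar : 0 ≤ Pbar)
    (hload : s ^ 2 * Real.pi * lam * M < 1) {ω : Ω} {g : Fading M L}
    (hact : ¬ N.Active L D i.1 ω) (hr : 0 < N.r i i.1 ω) (hP : φ i (ω, g) ^ 2 ≤ P) :
    (N.rate L D α σ2 φ i (ω, g) - N.asympRate L α s lam μ Pbar φ i (ω, g)) ^ 2 ≤
    2 / Real.log 2 ^ 2 * ((2 * Real.log 2 + Real.log (1 + P / μ) + 2 * α) ^ 2 *
      (L : ℝ) ^ (1 / 2 : ℝ) + α ^ 2 * Real.log (N.r i i.1 ω) ^ 2) := by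
  have hl2 : 0 < Real.log 2 := Real.log_pos one_lt_two
  have h1 : N.rate L D α σ2 φ i (ω, g) = 0 := by
    rw [rate, sinr, rxPower_eq, if_neg hact]
    simp
  obtain ⟨h2, h3⟩ := log_two_mul_asympRate_le (φ := φ) (p := (ω, g)) hL hlam hα hs hμ hPbar hload
    hr hP
  set k := 2 * Real.log 2 + Real.log (1 + P / μ) + 2 * α
  set T := N.asympRate L α s lam μ Pbar φ i (ω, g)
  have h4 : (L : ℝ) ^ (1 / 2 : ℝ) = ((L : ℝ) ^ (1 / 4 : ℝ)) ^ 2 := by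
    rw [← Real.rpow_natCast, ← Real.rpow_mul (by positivity)]; norm_num
  rw [h1, h4, div_mul_eq_mul_div, le_div_iff₀ (by positivity), ← sq_abs (Real.log (N.r i i.1 ω))]
  simp only at h3
  set l := |Real.log (N.r i i.1 ω)|
  set q := (L : ℝ) ^ (1 / 4 : ℝ)
  calc (0 - T) ^ 2 * Real.log 2 ^ 2 = (Real.log 2 * T) ^ 2 := by ring
    _ ≤ (k * q + α * l) ^ 2 := pow_le_pow_left₀ (mul_nonneg hl2.le h2) h3 2
    _ ≤ _ := by nlinarith [sq_nonneg (k * q - α * l)]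

end Deployment

end Cellular

/-! ### Square integrability and mean square convergence of the rate -/

namespace Cellular

variable {M L : ℕ} {Ω : Type*} [MeasurableSpace Ω] {Pr : Measure Ω} {N : Deployment M Ω}
  {lam R : ℝ} {i : Mobile M}

lemma integrable_norm_sq_gaussVec :
    Integrable (fun v : EuclideanSpace ℂ (Fin L) => ‖v‖ ^ 2) (gaussVec (Fin L)) := by
  refine ⟨by fun_prop, ?_⟩
  rw [hasFiniteIntegral_iff_ofReal (.of_forall fun v => by positivity)]
  -- The concentration bound for the full space also yields integrability of the squared norm.
  have h := lintegral_norm_sq_starProjection_sub_sq_le (L := L) ⊤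
  have hpt : ∀ v : EuclideanSpace ℂ (Fin L), ENNReal.ofReal (‖v‖ ^ 2) ≤
      ENNReal.ofReal (L + 1) + ENNReal.ofReal ((‖v‖ ^ 2 - L) ^ 2) := by
    intro v
    rw [← ENNReal.ofReal_add (by positivity) (by positivity)]
    refine ENNReal.ofReal_le_ofReal ?_
    nlinarith [sq_nonneg (‖v‖ ^ 2 - L - 1)]
  refine (lintegral_mono hpt).trans_lt ?_
  rw [lintegral_add_left measurable_const, lintegral_const, measure_univ, mul_one]
  refine ENNReal.add_lt_top.2 ⟨ENNReal.ofReal_lt_top, ?_⟩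
  simp only [Submodule.starProjection_top, finrank_top, finrank_euclideanSpace,
    Fintype.card_fin, ContinuousLinearMap.id_apply] at h
  exact h.trans_lt (ENNReal.mul_lt_top lintegral_norm_pow_four_stdComplexGaussian_lt_top (by simp))

namespace Deployment

lemma memLp_rate_sub_asympRate [IsProbabilityMeasure Pr] (hN : N.IsTypical Pr lam R i)
    {α s μ σ2 P Pbar D : ℝ} (hL : 1 ≤ L) (hlam : 0 ≤ lam) (hα : 2 < α) (hs : 0 < s) (hμ : 0 < μ)
    (hσ : 0 < σ2) (hPbar : 0 ≤ Pbar) (hload : s ^ 2 * Real.pi * lam * M < 1)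
    (hlog : Integrable (fun ω => (Real.log (N.r i i.1 ω)) ^ 2) Pr)
    {φ : Mobile M → Ω × Fading M L → ℝ} (hφ : N.IsPowerAllocation Pr L D P φ) :
    MemLp (fun p => N.rate L D α σ2 φ i p - N.asympRate L α s lam μ Pbar φ i p) 2
      (jointLaw Pr M L) := by
  have hrm := hN.isMeasurable.r i i.1
  have hl2 : 0 < Real.log 2 := Real.log_pos one_lt_two
  have hlogr : MemLp (fun p : Ω × Fading M L => |Real.log (N.r i i.1 p.1)|) 2
      (jointLaw Pr M L) := by
    have hm : Measurable fun p : Ω × Fading M L => |Real.log (N.r i i.1 p.1)| := by fun_prop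
    refine (memLp_two_iff_integrable_sq hm.aestronglyMeasurable).2 ?_
    simp_rw [sq_abs]
    exact hlog.comp_fst (fadingLaw M L)
  have hgain : MemLp (fun p : Ω × Fading M L => Real.sqrt (1 + ‖fadingVec p.2 i i.1‖ ^ 2)) 2
      (jointLaw Pr M L) := by
    have hm : Measurable fun g : Fading M L => Real.sqrt (1 + ‖fadingVec g i i.1‖ ^ 2) := by
      have := measurable_fadingVec (M := M) (L := L) i i.1
      fun_prop
    refine (memLp_two_iff_integrable_sq (hm.comp measurable_snd).aestronglyMeasurable).2 ?_
    have h1 : Integrable (fun g : Fading M L => ‖fadingVec g i i.1‖ ^ 2) (fadingLaw M L) := by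
      have h := integrable_norm_sq_gaussVec (L := L)
      rw [← map_fadingVec i i.1] at h
      exact h.comp_measurable (measurable_fadingVec i i.1)
    have h2 : Integrable (fun g : Fading M L => 1 + ‖fadingVec g i i.1‖ ^ 2) (fadingLaw M L) :=
      (integrable_const _).add h1
    refine (h2.comp_snd Pr).congr (.of_forall fun p => ?_)
    exact (Real.sq_sqrt (by positivity)).symm
  set k1 := Real.log (1 + P / σ2) + Real.log 2
  set k2 := (2 * Real.log 2 + Real.log (1 + P / μ) + 2 * α) * (L : ℝ) ^ (1 / 4 : ℝ)
  have hbound : MemLp (fun p : Ω × Fading M L => (Real.log 2)⁻¹ * ((k1 + k2) +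
      (2 * α) * |Real.log (N.r i i.1 p.1)| + 2 * Real.sqrt (1 + ‖fadingVec p.2 i i.1‖ ^ 2))) 2
      (jointLaw Pr M L) :=
    (((memLp_const (k1 + k2)).add (hlogr.const_mul (2 * α))).add
      (hgain.const_mul 2)).const_mul (Real.log 2)⁻¹
  refine hbound.mono ((hN.isMeasurable.rate D α σ2 hφ.measurable i).sub
    (hN.isMeasurable.asympRate α s lam μ Pbar hφ.measurable i)).aestronglyMeasurable ?_
  filter_upwards [ae_jointLaw_fst (M := M) (L := L) hN.dist_pos, hφ.ae_sq_le i] with p hr hP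
  have h1 := (rate_nonneg (N := N) (L := L) (D := D) (α := α) (φ := φ) (i := i) hσ p).1
  have h2 := log_two_mul_rate_le (D := D) hσ (by linarith : 0 ≤ α) hr hP
  obtain ⟨h3, h4⟩ := log_two_mul_asympRate_le hL hlam hα hs hμ hPbar hload hr hP
  set T := N.asympRate L α s lam μ Pbar φ i p
  set T' := N.rate L D α σ2 φ i p
  rw [Real.norm_eq_abs, Real.norm_eq_abs]
  refine le_trans ?_ (le_abs_self _)
  rw [inv_mul_eq_div, le_div_iff₀ hl2]
  -- Both rates are nonnegative, so separate upper bounds suffice.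
  have h5 : |T' - T| ≤ T' + T := by
    rw [abs_le]; constructor <;> linarith
  have h6 : |T' - T| * Real.log 2 ≤ (T' + T) * Real.log 2 :=
    mul_le_mul_of_nonneg_right h5 hl2.le
  linarith

/-- The rate converges in mean square. -/
lemma IsTypical.tendsto_lintegral_rate_sub_asympRate [IsProbabilityMeasure Pr]
    (hN : N.IsTypical Pr lam R i)
    {α s μ P Pbar δ γ : ℝ} (hlam : 0 ≤ lam) (hα : 2 < α) (hs : 0 < s) (hμ : 0 < μ)
    (hPbar : 0 ≤ Pbar) (hγ : 0 < γ) (hload : s ^ 2 * Real.pi * lam * M < 1)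
    (hlog : Integrable (fun ω => (Real.log (N.r i i.1 ω)) ^ 2) Pr)
    {φ : (L : ℕ) → Mobile M → Ω × Fading M L → ℝ}
    (hφ : ∀ L : ℕ, 1 ≤ L → N.IsPowerAllocation Pr L (zfRadius s L) P (φ L))
    (hmean : ∀ᶠ L : ℕ in atTop, N.MeanPowerCondition Pr L (zfRadius s L) Pbar δ γ i (φ L))
    (hcorr : ∀ᶠ L : ℕ in atTop,
      N.PowerCorrelationCondition Pr L (zfRadius s L) P Pbar δ γ i (φ L)) :
    Tendsto (fun L : ℕ => ∫⁻ p, ENNReal.ofReal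
        ((N.rate L (zfRadius s L) α (μ * (L : ℝ) ^ (-(α / 2 - 1))) (φ L) i p -
          N.asympRate L α s lam μ Pbar (φ L) i p) ^ 2) ∂(jointLaw Pr M L)) atTop (𝓝 0) := by
  have hsignal := hN.tendsto_log_zfVec hlam hs hload
  have hinterf := hN.tendsto_interference hlam hα hs hPbar hγ hload hφ hmean hcorr
  obtain ⟨C, hC0, hC⟩ := hN.exists_measure_not_active_le hlam hs hload
  have hrm := hN.isMeasurable.r i i.1
  set k := 2 * Real.log 2 + Real.log (1 + P / μ) + 2 * α
  have hrate : Tendsto (fun L : ℕ => ENNReal.ofReal (k ^ 2 * C * (L : ℝ) ^ (-(1 / 2) : ℝ)))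
      atTop (𝓝 0) := by
    have := ENNReal.tendsto_ofReal (((tendsto_rpow_neg_atTop (show (0 : ℝ) < 1 / 2 by
      norm_num)).comp (tendsto_natCast_atTop_atTop (R := ℝ))).const_mul (k ^ 2 * C))
    simpa using this
  have hprob : Tendsto (fun L : ℕ => Pr {ω | ¬ N.Active L (zfRadius s L) i.1 ω}) atTop (𝓝 0) := by
    have h1 : Tendsto (fun L : ℕ => ENNReal.ofReal (C / L)) atTop (𝓝 0) := by
      have := ENNReal.tendsto_ofReal (tendsto_const_div_atTop_nhds_zero_nat C)
      rwa [ENNReal.ofReal_zero] at this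
    exact tendsto_of_tendsto_of_tendsto_of_le_of_le' tendsto_const_nhds h1
      (.of_forall fun _ => zero_le) hC
  -- Absolute continuity of the integral: `log² r` is integrable and the probability of inactivity
  -- tends to 0, so no independence of the two is required.
  have hlogr : Tendsto (fun L : ℕ => ∫⁻ ω in {ω | ¬ N.Active L (zfRadius s L) i.1 ω},
      ENNReal.ofReal (Real.log (N.r i i.1 ω) ^ 2) ∂Pr) atTop (𝓝 0) := by
    refine tendsto_setLIntegral_zero ?_ hprob
    exact ((hasFiniteIntegral_iff_ofReal (.of_forall fun ω => sq_nonneg _)).1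
      hlog.hasFiniteIntegral).ne
  have hlim : Tendsto (fun L : ℕ => ENNReal.ofReal (2 / Real.log 2 ^ 2) *
      ((∫⁻ p in {p | N.Active L (zfRadius s L) i.1 p.1},
        ENNReal.ofReal ((Real.log (‖N.zfVec L (zfRadius s L) i p‖ ^ 2 / L) -
          Real.log (1 - s ^ 2 * Real.pi * lam * M)) ^ 2) ∂(jointLaw Pr M L)) +
      ENNReal.ofReal (μ ^ 2)⁻¹ * (∫⁻ p, ENNReal.ofReal (((L : ℝ) ^ (α / 2 - 1) *
        (N.interference L (zfRadius s L) α (φ L) i p).toReal -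
          s ^ (2 - α) * (2 * Real.pi * Pbar * lam / (α - 2))) ^ 2) ∂(jointLaw Pr M L)) +
      (ENNReal.ofReal (k ^ 2 * C * (L : ℝ) ^ (-(1 / 2) : ℝ)) +
      ENNReal.ofReal (α ^ 2) * ∫⁻ ω in {ω | ¬ N.Active L (zfRadius s L) i.1 ω},
        ENNReal.ofReal (Real.log (N.r i i.1 ω) ^ 2) ∂Pr))) atTop (𝓝 0) := by
    have h1 := ENNReal.Tendsto.const_mul (a := ENNReal.ofReal (μ ^ 2)⁻¹) hinterf
      (Or.inr ENNReal.ofReal_ne_top)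
    have h2 := ENNReal.Tendsto.const_mul (a := ENNReal.ofReal (α ^ 2)) hlogr
      (Or.inr ENNReal.ofReal_ne_top)
    have h3 := ENNReal.Tendsto.const_mul (a := ENNReal.ofReal (2 / Real.log 2 ^ 2))
      ((hsignal.add h1).add (hrate.add h2)) (Or.inr ENNReal.ofReal_ne_top)
    simpa using h3
  refine tendsto_of_tendsto_of_tendsto_of_le_of_le' tendsto_const_nhds hlim
    (.of_forall fun _ => zero_le) ?_
  filter_upwards [hC, eventually_ge_atTop 1, (tendsto_zfRadius hs).eventually_gt_atTop R]
    with L hCL hL hD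
  have hL0 : (0 : ℝ) < L := by exact_mod_cast hL
  have hφL := hφ L hL
  set D := zfRadius s L
  have hA := hN.isMeasurable.active L D i.1
  have hE : MeasurableSet {p : Ω × Fading M L | N.Active L D i.1 p.1} := hA.preimage measurable_fst
  have hz := hN.isMeasurable.zfVec (L := L) D i
  have hI := hN.isMeasurable.interference (D := D) (α := α) (i := i) hφL.measurable
  -- On the active event the error is bounded by the signal and interference deviations; on its
  -- complement the rate is zero and the limit is bounded directly.
  rw [← lintegral_add_compl _ hE, mul_add]
  refine add_le_add ?_ ?_
  · have hz2 : Measurable fun p => ENNReal.ofReal ((Real.log (‖N.zfVec L D i p‖ ^ 2 / L) -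
        Real.log (1 - s ^ 2 * Real.pi * lam * M)) ^ 2) := by fun_prop
    refine le_trans ?_ (mul_le_mul_right (add_le_add le_rfl
      (mul_le_mul_right (setLIntegral_le_lintegral {p | N.Active L D i.1 p.1} _) _)) _)
    rw [← lintegral_const_mul' _ _ ENNReal.ofReal_ne_top, ← lintegral_add_left hz2,
      ← lintegral_const_mul' _ _ ENNReal.ofReal_ne_top]
    refine lintegral_mono_ae ?_
    filter_upwards [ae_restrict_mem hE, ae_restrict_of_ae (ae_jointLaw_generalPosition (Pr := Pr)),
      ae_restrict_of_ae (ae_jointLaw_fst hN.ae_regular)] with p hp hg hreg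
    rw [← ENNReal.ofReal_mul (by positivity), ← ENNReal.ofReal_add (by positivity) (by positivity),
      ← ENNReal.ofReal_mul (by positivity)]
    exact ENNReal.ofReal_le_ofReal
      (sq_rate_sub_asympRate_le hL hlam hα hs hμ hPbar hload hg hreg hp hD)
  · have hE' : {p : Ω × Fading M L | N.Active L D i.1 p.1}ᶜ =
        {p : Ω × Fading M L | ¬ N.Active L D i.1 p.1} := rfl
    have hlm : Measurable fun ω => ENNReal.ofReal (Real.log (N.r i i.1 ω) ^ 2) := by fun_prop
    have hA' : MeasurableSet {ω | ¬ N.Active L D i.1 ω} := hA.compl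
    have hpt : ∀ᵐ p ∂((jointLaw Pr M L).restrict {p | N.Active L D i.1 p.1}ᶜ),
        ENNReal.ofReal ((N.rate L D α (μ * (L : ℝ) ^ (-(α / 2 - 1))) (φ L) i p -
          N.asympRate L α s lam μ Pbar (φ L) i p) ^ 2) ≤
        ENNReal.ofReal (2 / Real.log 2 ^ 2) * (ENNReal.ofReal (k ^ 2 * (L : ℝ) ^ (1 / 2 : ℝ)) +
          ENNReal.ofReal (α ^ 2) * ENNReal.ofReal (Real.log (N.r i i.1 p.1) ^ 2)) := by
      filter_upwards [ae_restrict_mem hE.compl, ae_restrict_of_ae (hφL.ae_sq_le i),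
        ae_restrict_of_ae (ae_jointLaw_fst hN.dist_pos)] with p hp hP hr
      rw [← ENNReal.ofReal_mul (by positivity),
        ← ENNReal.ofReal_add (by positivity) (by positivity), ← ENNReal.ofReal_mul (by positivity)]
      exact ENNReal.ofReal_le_ofReal
        (sq_rate_sub_asympRate_le_of_not_active hL hlam hα hs hμ hPbar hload hp hr hP)
    have hfst : ∫⁻ p in {p : Ω × Fading M L | N.Active L D i.1 p.1}ᶜ,
        (ENNReal.ofReal (k ^ 2 * (L : ℝ) ^ (1 / 2 : ℝ)) +
          ENNReal.ofReal (α ^ 2) * ENNReal.ofReal (Real.log (N.r i i.1 p.1) ^ 2))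
          ∂(jointLaw Pr M L) =
        ∫⁻ ω in {ω | ¬ N.Active L D i.1 ω}, (ENNReal.ofReal (k ^ 2 * (L : ℝ) ^ (1 / 2 : ℝ)) +
          ENNReal.ofReal (α ^ 2) * ENNReal.ofReal (Real.log (N.r i i.1 ω) ^ 2)) ∂Pr := by
      have hm : Measurable fun ω => ENNReal.ofReal (k ^ 2 * (L : ℝ) ^ (1 / 2 : ℝ)) +
          ENNReal.ofReal (α ^ 2) * ENNReal.ofReal (Real.log (N.r i i.1 ω) ^ 2) := by fun_prop
      rw [← lintegral_indicator hA', ← lintegral_indicator hE.compl,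
        ← lintegral_jointLaw_fst (M := M) (L := L) (hm.indicator hA')]
      refine lintegral_congr fun p => ?_
      by_cases h : N.Active L D i.1 p.1
      · rw [Set.indicator_of_notMem (s := {p : Ω × Fading M L | N.Active L D i.1 p.1}ᶜ)
          (not_not.2 h), Set.indicator_of_notMem (s := {ω | ¬ N.Active L D i.1 ω}) (not_not.2 h)]
      · rw [Set.indicator_of_mem (s := {p : Ω × Fading M L | N.Active L D i.1 p.1}ᶜ) h,
          Set.indicator_of_mem (s := {ω | ¬ N.Active L D i.1 ω}) h]
    refine (lintegral_mono_ae hpt).trans ?_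
    rw [lintegral_const_mul' _ _ ENNReal.ofReal_ne_top, hfst,
      lintegral_add_left measurable_const, lintegral_const_mul' _ _ ENNReal.ofReal_ne_top,
      setLIntegral_const]
    refine mul_le_mul_right (add_le_add ?_ le_rfl) _
    refine (mul_le_mul_right hCL _).trans (le_of_eq ?_)
    rw [← ENNReal.ofReal_mul (by positivity)]
    congr 1
    -- The squared limit, of order `√L`, meets the probability `C / L` of inactivity.
    have e : (L : ℝ) ^ (-(1 / 2) : ℝ) = (L : ℝ) ^ (1 / 2 : ℝ) * (L : ℝ) ^ (-1 : ℝ) := by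
      rw [← Real.rpow_add hL0]; norm_num
    rw [e, Real.rpow_neg_one]
    ring

end Deployment

end Cellular

end

theorem corollary1 {Ω : Type*} [MeasurableSpace Ω] (Pr : Measure Ω) [IsProbabilityMeasure Pr]
    {M : ℕ} (N : Cellular.Deployment M Ω) (i : Cellular.Mobile M)
    (lam R α s μ P Pbar δ γ : ℝ)
    (hlam : 0 < lam) (hα : 2 < α) (hs : 0 < s) (hμ : 0 < μ) (hPbar : 0 ≤ Pbar) (hγ : 0 < γ)
    (hload : s ^ 2 * Real.pi * lam * M < 1)
    (hN : N.IsTypical Pr lam R i)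
    (hlog : Integrable (fun ω => (Real.log (N.r i i.1 ω)) ^ 2) Pr)
    (φ : (L : ℕ) → Cellular.Mobile M → Ω × Cellular.Fading M L → ℝ)
    (hφ : ∀ L : ℕ, 1 ≤ L → N.IsPowerAllocation Pr L (s * (L : ℝ) ^ (1 / 2 : ℝ)) P (φ L))
    (hmean : ∀ᶠ L : ℕ in atTop,
      N.MeanPowerCondition Pr L (s * (L : ℝ) ^ (1 / 2 : ℝ)) Pbar δ γ i (φ L))
    (hcorr : ∀ᶠ L : ℕ in atTop,
      N.PowerCorrelationCondition Pr L (s * (L : ℝ) ^ (1 / 2 : ℝ)) P Pbar δ γ i (φ L)) :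
    (∀ L : ℕ, 1 ≤ L →
      MemLp (fun p => N.rate L (s * (L : ℝ) ^ (1 / 2 : ℝ)) α (μ * (L : ℝ) ^ (-(α / 2 - 1)))
          (φ L) i p - N.asympRate L α s lam μ Pbar (φ L) i p) 2 (Cellular.jointLaw Pr M L)) ∧
    Tendsto (fun L : ℕ =>
      ∫ p, |N.rate L (s * (L : ℝ) ^ (1 / 2 : ℝ)) α (μ * (L : ℝ) ^ (-(α / 2 - 1))) (φ L) i p
        - N.asympRate L α s lam μ Pbar (φ L) i p| ^ 2 ∂(Cellular.jointLaw Pr M L))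
      atTop (𝓝 0) := by
  refine ⟨fun L hL => ?_, ?_⟩
  · have hL0 : (0 : ℝ) < L := by exact_mod_cast hL
    exact Cellular.Deployment.memLp_rate_sub_asympRate hN hL hlam.le hα hs hμ (by positivity) hPbar
      hload hlog (hφ L hL)
  · have h := hN.tendsto_lintegral_rate_sub_asympRate hlam.le hα hs hμ hPbar hγ hload hlog hφ
      hmean hcorr
    have h2 := (ENNReal.tendsto_toReal ENNReal.zero_ne_top).comp h
    rw [ENNReal.toReal_zero] at h2
    refine h2.congr' ?_
    filter_upwards [eventually_ge_atTop 1] with L hL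
    have hφL := (hφ L hL).measurable
    have hm : Measurable fun p => N.rate L (s * (L : ℝ) ^ (1 / 2 : ℝ)) α
        (μ * (L : ℝ) ^ (-(α / 2 - 1))) (φ L) i p - N.asympRate L α s lam μ Pbar (φ L) i p :=
      ((hN.isMeasurable.rate (s * (L : ℝ) ^ (1 / 2 : ℝ)) α (μ * (L : ℝ) ^ (-(α / 2 - 1)))
      hφL i).sub (hN.isMeasurable.asympRate α s lam μ Pbar hφL i))
    simp_rw [sq_abs]
    rw [integral_eq_lintegral_of_nonneg_ae (.of_forall fun p => sq_nonneg _)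
      (hm.pow_const 2).aestronglyMeasurable]
    rfl
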